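/- For $z,x\in\mathbb R^n$ let $\operatorname{dist}(z,x)=\min\{\|x-z\|_2,\|x+z\|_2\}$, let $\|z\|_0=|\operatorname{supp}(z)|$, and for $x\neq 0$ let $x_{\min}=\min\{|x_i| : x_i\ne 0\}$. For $r\ge 0$ put $\mathcal E(r)=\{z\in\mathbb R^n : \operatorname{dist}(z,x^\dagger)\le r\|x^\dagger\|_2,\ \|z\|_0\le s\}$. Given $a_1,\dots,a_m\in\mathbb C^n$ and $y_j=|\langle a_j,x^\dagger\rangle|^2$, let $$f(z)=\frac1{4m}\sum_{j=1}^m\big(|\langle a_j,z\rangle|^2-y_j\big)^2,\qquad F_j(z)=\frac{1}{2\sqrt m}\big(|\langle a_j,z\rangle|^2-y_j\big),$$ let $J(z)\in\mathbb R^{m\times n}$ have $j$-th row $\frac1{\sqrt m}\big(a_{jR}a_{jR}^\top z+a_{jI}a_{jI}^\top z\big)^\top$, where $a_{jR},a_{jI}$ are the real and imaginary parts of $a_j$, and let $\mathcal H_s$ be the hard thresholding operator, which keeps $s$ entries of largest magnitude (ties broken arbitrarily) and sets the others to zero. There exist absolute constants $0<\mu_1<\mu_2$, $\delta,C_1,C_2,C_3,C_4>0$,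 $\rho,\alpha\in(0,1)$ and $\beta>0$ such that the following holds. Let $2s\le n$, let $x^\dagger\in\mathbb R^n$ be nonzero with $\|x^\dagger\|_0\le s$, let $m\ge C_4\,s\log(n/s)$, let $z^k\in\mathcal E(\delta)$ and $z^{k,0}\in\mathbb R^n$ be fixed vectors, and let $\mu^k\in\big(\mu_1/\|x^\dagger\|_2^2,\ \mu_2/\|x^\dagger\|_2^2\big)$. If $a_1,\dots,a_m$ are i.i.d. $\mathcal{CN}(0,I)$, then with probability at least $1-C_1m^{-1}-C_2\exp(-C_3m/\log m)$ both of the following hold. (a) $u^k=\mathcal H_s\big(z^k-\mu^k\nabla f(z^k)\big)$ satisfies $\operatorname{dist}(u^k,x^\dagger)\le\rho\,\operatorname{dist}(z^k,x^\dagger)$. (b) If $\operatorname{supp}(z^{k,0})\subseteq S_{k+1}:=\operatorname{supp}(u^k)$ and $\operatorname{dist}(z^{k,0},x^\dagger)\le\operatorname{dist}(u^k,x^\dagger)$, then the Gauss–Newton step $z^{k+1}\in\arg\min_{\operatorname{supp}(z)\subseteq S_{k+1}}\|J(z^{k,0})(z-z^{k,0})+F(z^{k,0})\|_2^2$ satisfies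 $$\operatorname{dist}(z^{k+1},x^\dagger)\le\alpha\,\operatorname{dist}(z^k,x^\dagger),$$ and, if moreover $z^k\in\mathcal E\big(x^\dagger_{\min}/\|x^\dagger\|_2\big)$, that is, $\operatorname{dist}(z^k,x^\dagger)\le x^\dagger_{\min}$, then also $$\operatorname{dist}(z^{k+1},x^\dagger)\le\frac{\beta}{\|x^\dagger\|_2}\,\operatorname{dist}(z^k,x^\dagger)^2 .$$ -/

import Mathlib

open MeasureTheory ProbabilityTheory

namespace GraHTP

noncomputable section

/-- The standard complex Gaussian law `CN(0,1)` on `ℂ`: independent real and imaginary parts,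
each `N(0,1/2)`. -/
def complexGaussian : Measure ℂ :=
  ((gaussianReal 0 (1 / 2)).prod (gaussianReal 0 (1 / 2))).map (fun p : ℝ × ℝ => (⟨p.1, p.2⟩ : ℂ))

/-- The law `CN(0, I)` on `ℂⁿ`. -/
def complexGaussianVector (n : ℕ) : Measure (Fin n → ℂ) :=
  Measure.pi (fun _ => complexGaussian)

variable {n m : ℕ}

/-- The support of a vector, as a finite index set. -/
def supp (z : EuclideanSpace ℝ (Fin n)) : Finset (Fin n) :=
  Finset.univ.filter (fun i => z i ≠ 0)

/-- `‖z‖₀ ≤ s`. -/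
def IsSparse (s : ℕ) (z : EuclideanSpace ℝ (Fin n)) : Prop :=
  (supp z).card ≤ s

/-- The smallest magnitude of a nonzero component of `x` (meaningful for `x ≠ 0`). -/
def xmin (x : EuclideanSpace ℝ (Fin n)) : ℝ :=
  sInf ((fun i => |x i|) '' {i | x i ≠ 0})

/-- Distance up to a global sign. -/
def sdist (z x : EuclideanSpace ℝ (Fin n)) : ℝ :=
  min ‖x - z‖ ‖x + z‖

/-- The `s`-sparse vectors at (sign-invariant) distance at most `r ‖x‖` from `x`. -/
def basin (s : ℕ) (x : EuclideanSpace ℝ (Fin n)) (r : ℝ) : Set (EuclideanSpace ℝ (Fin n)) :=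
  {z | sdist z x ≤ r * ‖x‖ ∧ IsSparse s z}

/-- The complex number `⟨a, z⟩` for a complex sensing vector `a` and a real vector `z`. -/
def cdot (a : Fin n → ℂ) (z : EuclideanSpace ℝ (Fin n)) : ℂ :=
  ∑ i, star (a i) * (z i : ℂ)

/-- Noiseless phaseless measurements `y_j = |⟨a_j, x⟩|²`. -/
def measurements (a : Fin m → Fin n → ℂ) (x : EuclideanSpace ℝ (Fin n)) : Fin m → ℝ :=
  fun j => ‖cdot (a j) x‖ ^ 2

/-- The intensity-based loss `f(z) = (1/4m) ∑ⱼ (|⟨a_j, z⟩|² - y_j)²`. -/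
def loss (a : Fin m → Fin n → ℂ) (y : Fin m → ℝ) (z : EuclideanSpace ℝ (Fin n)) : ℝ :=
  1 / (4 * (m : ℝ)) * ∑ j, (‖cdot (a j) z‖ ^ 2 - y j) ^ 2

/-- The residual map, `F_j(z) = (|⟨a_j, z⟩|² - y_j) / (2√m)`. -/
def resid (a : Fin m → Fin n → ℂ) (y : Fin m → ℝ) (z : EuclideanSpace ℝ (Fin n)) :
    Fin m → ℝ :=
  fun j => 1 / (2 * Real.sqrt m) * (‖cdot (a j) z‖ ^ 2 - y j)

/-- The Jacobian of the residual map: its `j`-th row is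
`(a_{jR} a_{jR}ᵀ z + a_{jI} a_{jI}ᵀ z)ᵀ / √m`. -/
def jacobian (a : Fin m → Fin n → ℂ) (z : EuclideanSpace ℝ (Fin n)) :
    Matrix (Fin m) (Fin n) ℝ :=
  Matrix.of fun j i => 1 / Real.sqrt m *
    ((∑ l, (a j l).re * z l) * (a j i).re + (∑ l, (a j l).im * z l) * (a j i).im)

/-- `u` is a value of the hard thresholding operator at `v`: `s` components of largest magnitude
are kept and the others are set to zero. Ties may be broken in any way. -/
def IsHardThreshold (s : ℕ) (v u : EuclideanSpace ℝ (Fin n)) : Prop :=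
  ∃ S : Finset (Fin n), S.card = s ∧ (∀ i ∈ S, ∀ j ∉ S, |v j| ≤ |v i|) ∧
    ∀ i, u i = if i ∈ S then v i else 0

/-- `u` is a hard-thresholded gradient step from `z` with step size `μ`. -/
def IsGradientStep (a : Fin m → Fin n → ℂ) (y : Fin m → ℝ) (s : ℕ) (μ : ℝ)
    (z u : EuclideanSpace ℝ (Fin n)) : Prop :=
  IsHardThreshold s (z - μ • gradient (loss a y) z) u

/-- `w'` is a Gauss-Newton step from `w` on the index set `S`: a minimizer of
`‖J(w) (v - w) + F(w)‖²` over the vectors `v` supported in `S`. -/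
def IsGaussNewtonStep (a : Fin m → Fin n → ℂ) (y : Fin m → ℝ) (S : Finset (Fin n))
    (w w' : EuclideanSpace ℝ (Fin n)) : Prop :=
  supp w' ⊆ S ∧ ∀ v : EuclideanSpace ℝ (Fin n), supp v ⊆ S →
    ∑ j, ((jacobian a w).mulVec (w' - w).ofLp j + resid a y w j) ^ 2 ≤
      ∑ j, ((jacobian a w).mulVec (v - w).ofLp j + resid a y w j) ^ 2

end

end GraHTP

/-! ### Gaussian product laws: invariance and the real encoding of the rows. -/

namespace GraHTP

/-! By homogeneity and sign symmetry one may take `‖x‖ = 1` and `z`, `w` on the right side of the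
sign. The vectors `x`, `z`, `w` span a space of dimension at most three with an orthonormal frame
containing `x`. The coordinates of the Gaussian rows in this frame are independent of their
orthogonal parts, and everything rests on conditioning on these coordinates. Chebyshev's inequality
makes their empirical moments close to the true ones with probability `1 - O(1/m)`
(`exists_frameGood_const`).

Gradient step. In the frame, the gradient is close to the Hessian at `x` applied to the error, with
eigenvalue 4 along `x` and 1 across, so step sizes near 0.4 contract by about 0.6. Orthogonally to
the frame, the gradient is a linear combination of rows with weights fixed by the frame coordinates,
hence a multiple of a single Gaussian vector, small on all sparse supports (`noise_tail`). Hard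
thresholding costs at most `√2.62`, and `0.61² · 2.62 < 1` (`gradient_step_inner`,
`hardThreshold_error`, `StepGood.gradient_step`).

Gauss–Newton step. The normal equations ask for a restricted isometry of a matrix with heavy-tailed
rows. Rows with large frame coordinates ("heavy") are separated. On the light rows a Chernoff bound
and a net give the isometry uniformly over supports (`lightDev_sup_tail`, `light_rip`). On the heavy
rows completing the square leaves only their action on `y = x - restrict S x`, the part of `x`
missed by the support `S` of the gradient step (`gaussNewton_error`).

The set `S` depends on the rows, but no bound uniform in `S` is needed for the heavy part: the
gradient sees the orthogonal parts only through one combination of rows. Once the frame coordinates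
and this combination are fixed, `S` and `y` are fixed, while the rest of the array is still
Gaussian, and Chebyshev suffices (`stepCoord_frameArray`, `heavySum_tail`, `heavyGood_tail`). For
this, `S` must be a function of the gradient, so ties are excluded almost surely by a quartic
polynomial argument (`gv_ties_eq_zero`), and the weights of the combination must not concentrate on
heavy rows (`sum_gradWeight_sq_ge`).

The Gauss–Newton error is then controlled by `‖y‖` plus a quadratic remainder. Always `‖y‖` is at
most the error of the gradient step, which gives the linear rate; below `xmin` nothing is missed, `y
= 0`, and only the quadratic term survives (`StepGood.gaussNewton_step`). All failure probabilities
are `O(1/m)`. -/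

/-- The product of centered Gaussian laws of variance `1/2`. -/
noncomputable def gv (κ : Type*) [Fintype κ] : Measure (κ → ℝ) :=
  Measure.pi fun _ => gaussianReal 0 (1 / 2)

noncomputable instance (κ : Type*) [Fintype κ] : IsProbabilityMeasure (gv κ) := by
  unfold gv; infer_instance

lemma charFun_half_gaussian (t : ℝ) :
    charFun (gaussianReal 0 (1 / 2)) t = Complex.exp (-((t ^ 2 / 4 : ℝ) : ℂ)) := by
  rw [charFun_gaussianReal]
  congr 1
  push_cast
  ring

/-- Matrices with orthonormal rows preserve the Gaussian product law. -/
lemma measurePreserving_mulVec {κ κ' : Type*} [Fintype κ] [Fintype κ'] [DecidableEq κ]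
    (M : Matrix κ κ' ℝ) (hM : M * M.transpose = 1) :
    MeasurePreserving (fun x => M.mulVec x) (gv κ') (gv κ) := by
  have hmeas : Measurable fun x : κ' → ℝ => M.mulVec x := by
    unfold Matrix.mulVec dotProduct; fun_prop
  refine ⟨hmeas, ?_⟩
  have : IsProbabilityMeasure ((gv κ').map fun x => M.mulVec x) :=
    Measure.isProbabilityMeasure_map hmeas.aemeasurable
  unfold gv at this ⊢
  refine charFun_eq_pi_iff.1 fun t => ?_
  have key : charFun (((Measure.pi fun _ : κ' => gaussianReal 0 (1 / 2)).map
      fun x => M.mulVec x).map (WithLp.toLp 2)) t =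
      charFun ((Measure.pi fun _ : κ' => gaussianReal 0 (1 / 2)).map (WithLp.toLp 2))
        (WithLp.toLp 2 (M.transpose.mulVec t.ofLp)) := by
    simp only [charFun]
    rw [integral_map (by fun_prop) (by fun_prop), integral_map (by fun_prop) (by fun_prop),
      integral_map (by fun_prop) (by fun_prop)]
    refine integral_congr_ae (Filter.Eventually.of_forall fun x => ?_)
    have : inner ℝ (WithLp.toLp 2 (M.mulVec x)) t =
        inner ℝ (WithLp.toLp 2 x) (WithLp.toLp 2 (M.transpose.mulVec t.ofLp)) := by
      simp only [EuclideanSpace.inner_eq_star_dotProduct, star_trivial]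
      rw [Matrix.dotProduct_mulVec, Matrix.mulVec_transpose]
    simp only [this]
  rw [key, charFun_pi]
  simp_rw [charFun_half_gaussian]
  rw [← Complex.exp_sum, ← Complex.exp_sum]
  congr 1
  -- The characteristic function depends only on the norm of its argument, and `M Mᵀ = 1` makes `Mᵀ`
  -- an isometry.
  have h : ∑ i, (M.transpose.mulVec t.ofLp i) ^ 2 = ∑ i, t i ^ 2 := by
    have h1 : (M.transpose.mulVec t.ofLp) ⬝ᵥ (M.transpose.mulVec t.ofLp) = t.ofLp ⬝ᵥ t.ofLp := by
      rw [Matrix.dotProduct_mulVec, Matrix.vecMul_transpose, Matrix.mulVec_mulVec, hM,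
        Matrix.one_mulVec]
    simpa [dotProduct, sq] using h1
  simp only [Finset.sum_neg_distrib, neg_inj]
  norm_cast
  rw [← Finset.sum_div, ← Finset.sum_div, h]

/-- A pair of matrices with `M Mᵀ + N Nᵀ = 1` combines independent Gaussian vectors into one. -/
lemma measurePreserving_mulVec_add {κ κ₁ κ₂ : Type*} [Fintype κ] [Fintype κ₁] [Fintype κ₂]
    [DecidableEq κ] (M : Matrix κ κ₁ ℝ) (N : Matrix κ κ₂ ℝ)
    (h : M * M.transpose + N * N.transpose = 1) :
    MeasurePreserving (fun p : (κ₁ → ℝ) × (κ₂ → ℝ) => M.mulVec p.1 + N.mulVec p.2)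
      ((gv κ₁).prod (gv κ₂)) (gv κ) := by
  have h1 := measurePreserving_sumPiEquivProdPi_symm (X := fun _ : κ₁ ⊕ κ₂ => ℝ)
    (fun _ => gaussianReal 0 (1 / 2))
  -- The independent pair is one Gaussian vector on `κ₁ ⊕ κ₂`, and the block matrix `[M N]` has
  -- orthonormal rows.
  have h2 := measurePreserving_mulVec (Matrix.fromCols M N) (by
    rw [Matrix.transpose_fromCols, Matrix.fromCols_mul_fromRows, h])
  have h3 := h2.comp h1
  convert h3 using 1
  swap
  · rfl
  ext p i
  simp only [Function.comp]
  have : (MeasurableEquiv.sumPiEquivProdPi fun _ : κ₁ ⊕ κ₂ => ℝ).symm p = Sum.elim p.1 p.2 := by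
    ext (a | a) <;> rfl
  rw [this, Matrix.fromCols_mulVec_sumElim]

lemma measurePreserving_reindex {κ κ' : Type*} [Fintype κ] [Fintype κ'] (e : κ ≃ κ') :
    MeasurePreserving (fun x : κ → ℝ => fun i => x (e.symm i)) (gv κ) (gv κ') := by
  convert measurePreserving_piCongrLeft (α := fun _ : κ' => ℝ)
    (fun _ => gaussianReal 0 (1 / 2)) e using 1
  swap
  · rfl
  swap
  · rfl
  ext x i
  simp [MeasurableEquiv.coe_piCongrLeft, Equiv.piCongrLeft_apply]

lemma measurePreserving_curry {κ κ' : Type*} [Fintype κ] [Fintype κ'] :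
    MeasurePreserving (fun x : κ × κ' → ℝ => fun i j => x (i, j)) (gv (κ × κ'))
      (Measure.pi fun _ : κ => gv κ') := by
  refine ⟨by fun_prop, ?_⟩
  have := Measure.infinitePi_map_curry (ι := κ) (κ := κ') (X := ℝ)
    (μ := fun _ _ => gaussianReal 0 (1 / 2))
  simp only [Measure.infinitePi_eq_pi] at this
  exact this

/-- The complex vectors encoded by a real array of real and imaginary parts. -/
def toComplexRows {n m : ℕ} (A : (Fin m × Fin 2) × Fin n → ℝ) : Fin m → Fin n → ℂ :=
  fun j i => ⟨A ((j, 0), i), A ((j, 1), i)⟩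

lemma measurePreserving_pair :
    MeasurePreserving (fun x : Fin 2 → ℝ => (⟨x 0, x 1⟩ : ℂ)) (gv (Fin 2)) complexGaussian := by
  have h1 := measurePreserving_finTwoArrow (gaussianReal 0 (1 / 2))
  have h2 : Measurable (fun p : ℝ × ℝ => (⟨p.1, p.2⟩ : ℂ)) :=
    Complex.measurableEquivRealProd.symm.measurable
  have h3 : MeasurePreserving (fun p : ℝ × ℝ => (⟨p.1, p.2⟩ : ℂ))
    ((gaussianReal 0 (1 / 2)).prod (gaussianReal 0 (1 / 2))) complexGaussian := ⟨h2, rfl⟩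
  exact h3.comp h1

instance : IsProbabilityMeasure complexGaussian := by
  have := measurePreserving_pair
  rw [← this.map_eq]
  exact Measure.isProbabilityMeasure_map this.measurable.aemeasurable

instance (n : ℕ) : IsProbabilityMeasure (complexGaussianVector n) := by
  unfold complexGaussianVector; infer_instance

lemma measurePreserving_toComplexRows {n m : ℕ} :
    MeasurePreserving (toComplexRows (n := n) (m := m)) (gv ((Fin m × Fin 2) × Fin n))
      (Measure.pi fun _ : Fin m => complexGaussianVector n) := by
  -- The array lists real and imaginary parts before coordinates, whereas the law on `ℂⁿ` is built
  -- coordinate by coordinate.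
  let e : (Fin m × Fin 2) × Fin n ≃ Fin m × (Fin n × Fin 2) :=
    (Equiv.prodAssoc _ _ _).trans ((Equiv.refl _).prodCongr (Equiv.prodComm _ _))
  have h1 := measurePreserving_reindex e
  have h2 := measurePreserving_curry (κ := Fin m) (κ' := Fin n × Fin 2)
  have h3 : MeasurePreserving (fun (x : Fin n × Fin 2 → ℝ) i => (⟨x (i, 0), x (i, 1)⟩ : ℂ))
      (gv (Fin n × Fin 2)) (complexGaussianVector n) :=
    (measurePreserving_pi (fun _ : Fin n => gv (Fin 2)) (fun _ : Fin n => complexGaussian)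
      (fun _ => measurePreserving_pair)).comp measurePreserving_curry
  have h4 := measurePreserving_pi (fun _ : Fin m => gv (Fin n × Fin 2))
      (fun _ : Fin m => complexGaussianVector n) (fun _ => h3)
  exact h4.comp (h2.comp h1)

/-- A bound on a product measure from bounds on the sections outside an exceptional set. -/
lemma prod_measure_le {α β : Type*} [MeasurableSpace α] [MeasurableSpace β] (μ : Measure α)
    (ν : Measure β) [IsProbabilityMeasure μ] [IsProbabilityMeasure ν] {W : Set (α × β)}
    (hW : MeasurableSet W) (B : Set α) {b : ENNReal}
    (h : ∀ x ∉ B, ν {y | (x, y) ∈ W} ≤ b) : μ.prod ν W ≤ μ B + b := by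
  rw [Measure.prod_apply hW]
  calc ∫⁻ x, ν (Prod.mk x ⁻¹' W) ∂μ ≤ ∫⁻ x, (B.indicator (fun _ => 1) x + b) ∂μ := by
        refine lintegral_mono fun x => ?_
        by_cases hx : x ∈ B
        · simp only [Set.indicator_of_mem hx]
          exact prob_le_one.trans le_self_add
        · rw [Set.indicator_of_notMem hx, zero_add]
          exact h x hx
    _ = (∫⁻ x, B.indicator (fun _ => 1) x ∂μ) + b := by
        rw [lintegral_add_right _ measurable_const]; simp
    _ ≤ μ B + b := by
        gcongr
        -- Only an inequality is needed here, so `B` may be non-measurable.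
        exact lintegral_indicator_one_le B

end GraHTP

/-! ### Moments, exponential tails and Chebyshev's inequality. -/

namespace GraHTP

/-- All absolute moments of `f` are finite. -/
def HasAllMoments {α : Type*} [MeasurableSpace α] (f : α → ℝ) (μ : Measure α) : Prop :=
  ∀ p : ENNReal, p ≠ ⊤ → MemLp f p μ

section
variable {α : Type*} [MeasurableSpace α] {μ : Measure α} {f g : α → ℝ}

lemma HasAllMoments.add (hf : HasAllMoments f μ) (hg : HasAllMoments g μ) :
    HasAllMoments (fun x => f x + g x) μ := fun p hp => (hf p hp).add (hg p hp)

/-- Hölder with exponents `2p, 2p`. Closure under products is the reason for asking for all finite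
exponents rather than one. -/
lemma HasAllMoments.mul (hf : HasAllMoments f μ) (hg : HasAllMoments g μ) :
    HasAllMoments (fun x => f x * g x) μ := fun p hp => by
  have h2 : p * 2 ≠ ⊤ := ENNReal.mul_ne_top hp (by simp)
  have : ENNReal.HolderTriple (p * 2) (p * 2) p := by
    constructor
    rw [ENNReal.mul_inv (by simp) (by simp), ← mul_add, ENNReal.inv_two_add_inv_two, mul_one]
  exact (hg _ h2).mul (hf _ h2)

lemma HasAllMoments.const [IsFiniteMeasure μ] (c : ℝ) : HasAllMoments (fun _ => c) μ :=
  fun _ _ => memLp_const c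

lemma HasAllMoments.sum {κ : Type*} (s : Finset κ) {F : κ → α → ℝ}
    (h : ∀ i ∈ s, HasAllMoments (F i) μ) : HasAllMoments (fun x => ∑ i ∈ s, F i x) μ :=
  fun p hp => memLp_finsetSum s fun i hi => h i hi p hp

lemma HasAllMoments.pow [IsFiniteMeasure μ] (hf : HasAllMoments f μ) (k : ℕ) :
    HasAllMoments (fun x => f x ^ k) μ := by
  induction k with
  | zero => simpa using HasAllMoments.const (μ := μ) 1
  | succ k ih => simpa [pow_succ] using ih.mul hf

lemma HasAllMoments.integrable (hf : HasAllMoments f μ) : Integrable f μ :=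
  memLp_one_iff_integrable.1 (hf 1 (by simp))

lemma HasAllMoments.memLp_two (hf : HasAllMoments f μ) : MemLp f 2 μ := hf 2 (by simp)
end

lemma measurePreserving_coord {κ : Type*} [Fintype κ] (i : κ) :
    MeasurePreserving (fun x : κ → ℝ => x i) (gv κ) (gaussianReal 0 (1 / 2)) :=
  measurePreserving_eval (fun _ => gaussianReal 0 (1 / 2)) i

lemma hasAllMoments_coord {κ : Type*} [Fintype κ] (i : κ) :
    HasAllMoments (fun x : κ → ℝ => x i) (gv κ) := fun p hp =>
  (memLp_id_gaussianReal' p hp).comp_measurePreserving (measurePreserving_coord i)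

lemma half_gaussian_density (f : ℝ → ℝ) :
    ∫ x, f x ∂(gaussianReal 0 (1 / 2)) =
      ∫ x, (√Real.pi)⁻¹ * Real.exp (-x ^ 2) * f x := by
  rw [integral_gaussianReal_eq_integral_smul (by norm_num)]
  refine integral_congr_ae (Filter.Eventually.of_forall fun x => ?_)
  have h : (√(2 * Real.pi * ((1 / 2 : NNReal) : ℝ)))⁻¹ = (√Real.pi)⁻¹ := by
    congr 2
    push_cast
    ring
  simp only [gaussianPDFReal, smul_eq_mul, h]
  norm_num

/-- No condition on `t` is needed: for `t ≥ 1` the integral diverges and both sides are zero by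
convention. A nonzero value therefore proves integrability, which is how `integrable_exp_sq`
follows. -/
lemma integral_exp_sq (t : ℝ) :
    ∫ x, Real.exp (t * x ^ 2) ∂(gaussianReal 0 (1 / 2)) = (√(1 - t))⁻¹ := by
  rw [half_gaussian_density]
  have : ∀ x : ℝ, (√Real.pi)⁻¹ * Real.exp (-x ^ 2) * Real.exp (t * x ^ 2) =
      (√Real.pi)⁻¹ * Real.exp (-(1 - t) * x ^ 2) := by
    intro x
    rw [mul_assoc, ← Real.exp_add]
    ring_nf
  simp_rw [this]
  rw [integral_const_mul, integral_gaussian, Real.sqrt_div Real.pi_pos.le]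
  have h1 : √Real.pi ≠ 0 := (Real.sqrt_pos.2 Real.pi_pos).ne'
  field_simp

lemma integrable_exp_sq {t : ℝ} (ht : t < 1) :
    Integrable (fun x => Real.exp (t * x ^ 2)) (gaussianReal 0 (1 / 2)) := by
  by_contra h
  have := integral_exp_sq t
  rw [integral_undef h] at this
  have h2 : 0 < (√(1 - t))⁻¹ := inv_pos.2 (Real.sqrt_pos.2 (by linarith))
  linarith

/-- This is `-log (1 - t) ≤ t + t²`, the input for the cumulant bound of a centred square. After
inversion the linear bound for `exp` suffices for `t ≤ 0`, while `t ≥ 0` needs the quadratic one. -/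
lemma exp_neg_le_one_sub {t : ℝ} (ht : |t| ≤ 1 / 2) : Real.exp (-t - t ^ 2) ≤ 1 - t := by
  obtain ⟨h1, h2⟩ := abs_le.1 ht
  have hpos : 0 < 1 - t := by linarith
  rw [show -t - t ^ 2 = -(t + t ^ 2) by ring, Real.exp_neg]
  refine inv_le_of_inv_le₀ hpos ?_
  rw [inv_le_iff_one_le_mul₀' hpos]
  rcases le_total 0 t with h | h
  · have := Real.quadratic_le_exp_of_nonneg (x := t + t ^ 2) (by positivity)
    have h3 : 1 ≤ (1 - t) * (1 + (t + t ^ 2) + (t + t ^ 2) ^ 2 / 2) := by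
      have : (1 - t) * (1 + (t + t ^ 2) + (t + t ^ 2) ^ 2 / 2) - 1 =
        t ^ 2 / 2 * ((1 - 2 * t) + t * (1 - t - t ^ 2)) := by ring
      have h4 : 0 ≤ 1 - t - t ^ 2 := by nlinarith
      have : 0 ≤ t ^ 2 / 2 * ((1 - 2 * t) + t * (1 - t - t ^ 2)) := by
        have : 0 ≤ 1 - 2 * t := by linarith
        positivity
      linarith
    nlinarith
  · have := Real.add_one_le_exp (t + t ^ 2)
    have h3 : 1 ≤ (1 - t) * (t + t ^ 2 + 1) := by
      have : (1 - t) * (t + t ^ 2 + 1) - 1 = -t * t ^ 2 := by ring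
      have : 0 ≤ -t * t ^ 2 := mul_nonneg (by linarith) (sq_nonneg t)
      linarith
    nlinarith

lemma integral_exp_centered_sq_le {t : ℝ} (ht : |t| ≤ 1 / 2) :
    ∫ x, Real.exp (t * (x ^ 2 - 1 / 2)) ∂(gaussianReal 0 (1 / 2)) ≤ Real.exp (t ^ 2) := by
  obtain ⟨h1, h2⟩ := abs_le.1 ht
  have : ∀ x : ℝ, Real.exp (t * (x ^ 2 - 1 / 2)) = Real.exp (-t / 2) * Real.exp (t * x ^ 2) := by
    intro x
    rw [← Real.exp_add]
    ring_nf
  simp_rw [this]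
  rw [integral_const_mul, integral_exp_sq]
  have h3 : Real.exp ((-t - t ^ 2) / 2) ≤ √(1 - t) := by
    apply Real.le_sqrt_of_sq_le
    rw [← Real.exp_nat_mul]
    convert exp_neg_le_one_sub ht using 2
    push_cast
    ring
  have h4 : (√(1 - t))⁻¹ ≤ Real.exp (-((-t - t ^ 2) / 2)) := by
    rw [Real.exp_neg]
    exact inv_anti₀ (Real.exp_pos _) h3
  calc Real.exp (-t / 2) * (√(1 - t))⁻¹
      ≤ Real.exp (-t / 2) * Real.exp (-((-t - t ^ 2) / 2)) := by gcongr
    _ = Real.exp (t ^ 2 / 2) := by rw [← Real.exp_add]; ring_nf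
    _ ≤ Real.exp (t ^ 2) := by
        apply Real.exp_le_exp.2
        have := sq_nonneg t
        linarith

lemma markov_exp {α : Type*} [MeasurableSpace α] {μ : Measure α} [IsProbabilityMeasure μ]
    {f : α → ℝ} (hf : Integrable (fun x => Real.exp (f x)) μ) {b c : ℝ}
    (h : ∫ x, Real.exp (f x) ∂μ ≤ Real.exp b) :
    μ {x | c ≤ f x} ≤ ENNReal.ofReal (Real.exp (b - c)) := by
  have h1 := mul_meas_ge_le_integral_of_nonneg
    (Filter.Eventually.of_forall fun x => (Real.exp_pos (f x)).le) hf (Real.exp c)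
  have h2 : {x | Real.exp c ≤ Real.exp (f x)} = {x | c ≤ f x} := by simp
  rw [h2] at h1
  rw [← ENNReal.ofReal_toReal (measure_ne_top μ {x | c ≤ f x})]
  apply ENNReal.ofReal_le_ofReal
  rw [Real.exp_sub, le_div_iff₀ (Real.exp_pos c), mul_comm]
  exact h1.trans h

lemma integral_exp_sum_le {κ : Type*} [Fintype κ] (f : κ → ℝ → ℝ) (b : κ → ℝ)
    (hf : ∀ i, Integrable (fun x => Real.exp (f i x)) (gaussianReal 0 (1 / 2)))
    (h : ∀ i, ∫ x, Real.exp (f i x) ∂(gaussianReal 0 (1 / 2)) ≤ Real.exp (b i)) :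
    Integrable (fun x => Real.exp (∑ i, f i (x i))) (gv κ) ∧
      ∫ x, Real.exp (∑ i, f i (x i)) ∂(gv κ) ≤ Real.exp (∑ i, b i) := by
  simp_rw [Real.exp_sum]
  unfold gv
  refine ⟨Integrable.fintype_prod_dep (f := fun i x => Real.exp (f i x)) hf, ?_⟩
  rw [integral_fintype_prod_eq_prod (fun i x => Real.exp (f i x))]
  exact Finset.prod_le_prod (fun i _ => integral_nonneg fun x => (Real.exp_pos _).le)
    fun i _ => h i

/-- Chernoff with `t = η / (2 K²)`, the minimiser of the exponent `N t² K² - t η N`; the condition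
`η ≤ K` keeps every `t * a i` in the range `|·| ≤ 1/2` of the cumulant bound. -/
lemma weighted_chiSq_upper {κ : Type*} [Fintype κ] (a : κ → ℝ) {K η N : ℝ} (hK : 0 < K)
    (ha : ∀ i, |a i| ≤ K) (hη : 0 < η) (hηK : η ≤ K) (hN : (Fintype.card κ : ℝ) ≤ N) :
    gv κ {g | η * N ≤ ∑ i, a i * (g i ^ 2 - 1 / 2)} ≤
      ENNReal.ofReal (Real.exp (-(η ^ 2 / (4 * K ^ 2)) * N)) := by
  have hN0 : 0 ≤ N := (Nat.cast_nonneg _).trans hN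
  set t := η / (2 * K ^ 2) with ht
  have htpos : 0 < t := by positivity
  have hta : ∀ i, |t * a i| ≤ 1 / 2 := by
    intro i
    rw [abs_mul, abs_of_pos htpos]
    calc t * |a i| ≤ t * K := by gcongr; exact ha i
      _ = η / K / 2 := by rw [ht]; field_simp
      _ ≤ 1 / 2 := by
        have : η / K ≤ 1 := (div_le_one hK).2 hηK
        linarith
  have hint : ∀ i, Integrable (fun x => Real.exp (t * a i * (x ^ 2 - 1 / 2)))
      (gaussianReal 0 (1 / 2)) := by
    intro i
    have : ∀ x : ℝ, Real.exp (t * a i * (x ^ 2 - 1 / 2)) =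
        Real.exp (-(t * a i) / 2) * Real.exp (t * a i * x ^ 2) := by
      intro x
      rw [← Real.exp_add]
      ring_nf
    simp_rw [this]
    exact (integrable_exp_sq (by linarith [(abs_le.1 (hta i)).2])).const_mul _
  obtain ⟨h1, h2⟩ := integral_exp_sum_le (fun i x => t * a i * (x ^ 2 - 1 / 2))
    (fun i => (t * a i) ^ 2) hint (fun i => integral_exp_centered_sq_le (hta i))
  have h3 := markov_exp h1 h2 (c := t * (η * N))
  have h4 : {g : κ → ℝ | η * N ≤ ∑ i, a i * (g i ^ 2 - 1 / 2)} =
      {g | t * (η * N) ≤ ∑ i, t * a i * (g i ^ 2 - 1 / 2)} := by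
    ext g
    simp only [Set.mem_ofPred_eq, mul_assoc, ← Finset.mul_sum]
    exact (mul_le_mul_iff_right₀ htpos).symm
  rw [h4]
  refine h3.trans (ENNReal.ofReal_le_ofReal (Real.exp_le_exp.2 ?_))
  have h5 : ∑ i, (t * a i) ^ 2 ≤ N * (t * K) ^ 2 := by
    calc ∑ i, (t * a i) ^ 2 ≤ ∑ _i : κ, (t * K) ^ 2 := by
          refine Finset.sum_le_sum fun i _ => ?_
          rw [← sq_abs, abs_mul, abs_of_pos htpos]
          gcongr
          exact ha i
      _ = Fintype.card κ * (t * K) ^ 2 := by simp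
      _ ≤ N * (t * K) ^ 2 := by gcongr
  have h6 : N * (t * K) ^ 2 - t * (η * N) = -(η ^ 2 / (4 * K ^ 2)) * N := by
    rw [ht]
    field_simp
    ring
  linarith

/-- Chernoff bound for a weighted sum of centred squares of Gaussian variables. -/
lemma weighted_chiSq_tail {κ : Type*} [Fintype κ] (a : κ → ℝ) {K η N : ℝ} (hK : 0 < K)
    (ha : ∀ i, |a i| ≤ K) (hη : 0 < η) (hηK : η ≤ K) (hN : (Fintype.card κ : ℝ) ≤ N) :
    gv κ {g | η * N ≤ |∑ i, a i * (g i ^ 2 - 1 / 2)|} ≤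
      ENNReal.ofReal (2 * Real.exp (-(η ^ 2 / (4 * K ^ 2)) * N)) := by
  have h1 := weighted_chiSq_upper a hK ha hη hηK hN
  have h2 := weighted_chiSq_upper (fun i => -a i) hK (fun i => by simpa using ha i) hη hηK hN
  have h3 : {g : κ → ℝ | η * N ≤ |∑ i, a i * (g i ^ 2 - 1 / 2)|} ⊆
      {g | η * N ≤ ∑ i, a i * (g i ^ 2 - 1 / 2)} ∪
      {g | η * N ≤ ∑ i, -a i * (g i ^ 2 - 1 / 2)} := by
    intro g hg
    simp only [Set.mem_ofPred_eq, Set.mem_union, neg_mul, Finset.sum_neg_distrib] at hg ⊢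
    exact le_abs.1 hg
  calc _ ≤ _ := measure_mono h3
    _ ≤ _ := measure_union_le _ _
    _ ≤ _ := add_le_add h1 h2
    _ = _ := by rw [← ENNReal.ofReal_add (Real.exp_pos _).le (Real.exp_pos _).le, two_mul]

lemma sqrt_two_inv_exp : (√(1 - 1 / 2 : ℝ))⁻¹ ≤ Real.exp 1 := by
  have h1 : (1 / 2 : ℝ) ≤ √(1 - 1 / 2) := by
    apply Real.le_sqrt_of_sq_le
    norm_num
  have h2 : (√(1 - 1 / 2 : ℝ))⁻¹ ≤ 2 := by
    rw [inv_le_comm₀ (by positivity) (by norm_num)]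
    linarith
  linarith [Real.add_one_le_exp (1 : ℝ)]

/-- Tail bound for the sum of squares of the Gaussian coordinates in a given index set. -/
lemma chiSq_tail {κ : Type*} [Fintype κ] [DecidableEq κ] (T : Finset κ) (c : ℝ) :
    gv κ {g | c ≤ ∑ i ∈ T, g i ^ 2} ≤ ENNReal.ofReal (Real.exp (T.card - c / 2)) := by
  have hint : ∀ i, Integrable (fun x => Real.exp (if i ∈ T then 1 / 2 * x ^ 2 else 0))
      (gaussianReal 0 (1 / 2)) := by
    intro i
    split_ifs
    · exact integrable_exp_sq (by norm_num)
    · exact integrable_const _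
  obtain ⟨h1, h2⟩ := integral_exp_sum_le (fun i x => if i ∈ T then 1 / 2 * x ^ 2 else 0)
    (fun i => if i ∈ T then 1 else 0) hint (fun i => by
      split_ifs
      · rw [integral_exp_sq]; exact sqrt_two_inv_exp
      · simp)
  -- With exponential parameter `1/2` a coordinate in `T` has moment generating function `√2 ≤ e`,
  -- and a coordinate outside `T` contributes the factor 1.
  have h3 := markov_exp h1 h2 (c := c / 2)
  simp only [Finset.sum_ite_mem, Finset.univ_inter, ← Finset.mul_sum, Finset.sum_const,
    nsmul_eq_mul, mul_one] at h3
  convert h3 using 3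
  ext g
  constructor <;> intro h <;> linarith

/-- Chebyshev's inequality for sums of functions of independent variables. -/
lemma chebyshev_pi {κ α : Type*} [Fintype κ] [MeasurableSpace α] (μ : Measure α)
    [IsProbabilityMeasure μ] (f : κ → α → ℝ) (hf : ∀ i, MemLp (f i) 2 μ) {c V : ℝ} (hc : 0 < c)
    (hV : ∑ i, Var[f i; μ] ≤ V) :
    (Measure.pi fun _ : κ => μ) {x | c ≤ |∑ i, f i (x i) - ∑ i, ∫ y, f i y ∂μ|} ≤
      ENNReal.ofReal (V / c ^ 2) := by
  have h1 : ∀ i, MemLp (fun x : κ → α => f i (x i)) 2 (Measure.pi fun _ : κ => μ) := fun i =>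
    (hf i).comp_measurePreserving (measurePreserving_eval (fun _ => μ) i)
  have h2 : MemLp (∑ i, fun x : κ → α => f i (x i)) 2 (Measure.pi fun _ : κ => μ) :=
    memLp_finsetSum' _ fun i _ => h1 i
  have h3 := meas_ge_le_variance_div_sq h2 hc
  rw [variance_sum_pi hf] at h3
  have h4 : ∫ x, (∑ i, fun x : κ → α => f i (x i)) x ∂(Measure.pi fun _ : κ => μ) =
      ∑ i, ∫ y, f i y ∂μ := by
    simp only [Finset.sum_apply]
    rw [integral_finsetSum _ fun i _ => (h1 i).integrable (by norm_num)]
    refine Finset.sum_congr rfl fun i _ => ?_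
    have hmp := measurePreserving_eval (fun _ : κ => μ) i
    have := integral_map hmp.measurable.aemeasurable (f := f i)
      (by rw [hmp.map_eq]; exact (hf i).1)
    rw [hmp.map_eq] at this
    exact this.symm
  rw [h4] at h3
  simp only [Finset.sum_apply] at h3
  refine h3.trans (ENNReal.ofReal_le_ofReal ?_)
  gcongr

end GraHTP

/-! ### Fourth-order Gaussian moments and the law of large numbers in the frame. -/

namespace GraHTP

section moments
variable {κ : Type*} [Fintype κ]

lemma measurePreserving_flip [DecidableEq κ] (a : κ) :
    MeasurePreserving (fun (x : κ → ℝ) i => if i = a then -x i else x i) (gv κ) (gv κ) := by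
  have := measurePreserving_mulVec (Matrix.diagonal fun i : κ => if i = a then (-1 : ℝ) else 1) (by
    rw [Matrix.diagonal_transpose, Matrix.diagonal_mul_diagonal]
    convert Matrix.diagonal_one with i
    split_ifs <;> norm_num)
  convert this using 2 with x
  ext i
  rw [Matrix.mulVec_diagonal]
  split_ifs <;> ring

/-- Functions that are odd in one coordinate have zero Gaussian mean. -/
lemma integral_eq_zero_of_odd [DecidableEq κ] (a : κ) {f : (κ → ℝ) → ℝ} (hf : HasAllMoments f (gv κ))
    (h : ∀ x, f (fun i => if i = a then -x i else x i) = -f x) : ∫ x, f x ∂(gv κ) = 0 := by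
  have hmp := measurePreserving_flip a
  have h1 := integral_map hmp.measurable.aemeasurable (f := f)
    (by rw [hmp.map_eq]; exact hf.integrable.1)
  rw [hmp.map_eq] at h1
  simp_rw [h, integral_neg] at h1
  linarith

lemma integral_coord (a : κ) (f : ℝ → ℝ) (hf : Measurable f) :
    ∫ x, f (x a) ∂(gv κ) = ∫ y, f y ∂(gaussianReal 0 (1 / 2)) := by
  have hmp := measurePreserving_coord a
  have h1 := integral_map (μ := gv κ) hmp.measurable.aemeasurable (f := f)
    hf.aestronglyMeasurable
  rw [hmp.map_eq] at h1
  exact h1.symm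

lemma integral_coord_mul {a b : κ} (hab : a ≠ b) (f g : ℝ → ℝ) (hf : Measurable f)
    (hg : Measurable g) :
    ∫ x, f (x a) * g (x b) ∂(gv κ) =
      (∫ y, f y ∂(gaussianReal 0 (1 / 2))) * ∫ y, g y ∂(gaussianReal 0 (1 / 2)) := by
  have h1 := (iIndepFun_pi (μ := fun _ : κ => gaussianReal 0 (1 / 2)) (X := fun _ x => x)
    (fun _ => aemeasurable_id)).indepFun hab
  have h2 := (h1.comp hf hg).integral_fun_mul_eq_mul_integral
    (by exact (hf.comp (measurable_pi_apply a)).aestronglyMeasurable)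
    (by exact (hg.comp (measurable_pi_apply b)).aestronglyMeasurable)
  rw [← integral_coord a f hf, ← integral_coord b g hg]
  exact h2

lemma integral_sq_half : ∫ y : ℝ, y ^ 2 ∂(gaussianReal 0 (1 / 2)) = 1 / 2 := by
  have h := variance_fun_id_gaussianReal (μ := 0) (v := 1 / 2)
  rw [variance_of_integral_eq_zero (by fun_prop) (by simp)] at h
  rw [h]
  norm_num

/-- Rotation invariance determines the fourth moment: `(x₀ + x₁) / √2` has the law of `x₀`, and
expanding the fourth power gives `M = M / 2 + (3/2) · (1/2)²`, the odd terms having mean zero. -/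
lemma integral_pow_four_half : ∫ y : ℝ, y ^ 4 ∂(gaussianReal 0 (1 / 2)) = 3 / 4 := by
  have hs : (1 / √2 : ℝ) ^ 2 = 1 / 2 := by rw [div_pow, Real.sq_sqrt] <;> norm_num
  have hmp := measurePreserving_mulVec (Matrix.of fun (_ : Fin 1) (_ : Fin 2) => (1 / √2 : ℝ)) (by
    ext i j
    obtain rfl := Subsingleton.elim i j
    simp only [Matrix.mul_apply, Matrix.transpose_apply, Matrix.of_apply, Fin.sum_univ_two,
      Matrix.one_apply_eq]
    linarith)
  have hmp2 := (measurePreserving_coord (0 : Fin 1)).comp hmp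
  have h1 := integral_map (μ := gv (Fin 2)) hmp2.measurable.aemeasurable (f := fun y : ℝ => y ^ 4)
    (by fun_prop)
  rw [hmp2.map_eq] at h1
  have h2 : ∀ x : Fin 2 → ℝ, ((fun x : Fin 1 → ℝ => x 0) ∘ fun x : Fin 2 → ℝ =>
      (Matrix.of fun (_ : Fin 1) (_ : Fin 2) => (1 / √2 : ℝ)).mulVec x) x ^ 4 =
      1 / 4 * (x 0) ^ 4 + (1 / 4 * (x 1) ^ 4 + (3 / 2 * ((x 0) ^ 2 * (x 1) ^ 2) +
        (x 0 ^ 3 * x 1 + x 0 * x 1 ^ 3))) := by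
    intro x
    simp only [Function.comp, Matrix.mulVec, dotProduct, Matrix.of_apply, Fin.sum_univ_two]
    have h4 : (1 / √2 : ℝ) ^ 4 = 1 / 4 := by
      rw [show (4 : ℕ) = 2 * 2 by norm_num, pow_mul, hs]; norm_num
    rw [← mul_add, mul_pow, h4]
    ring
  simp_rw [h2] at h1
  have m0 := hasAllMoments_coord (0 : Fin 2)
  have m1 := hasAllMoments_coord (1 : Fin 2)
  have i4 : ∀ a : Fin 2, Integrable (fun x : Fin 2 → ℝ => 1 / 4 * (x a) ^ 4) (gv (Fin 2)) :=
    fun a => ((HasAllMoments.const _).mul ((hasAllMoments_coord a).pow 4)).integrable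
  have i22 := ((HasAllMoments.const (3 / 2)).mul ((m0.pow 2).mul (m1.pow 2))).integrable
  have i31 := (m0.pow 3).mul m1
  have i13 := m0.mul (m1.pow 3)
  have z1 := integral_eq_zero_of_odd 1 i31 (fun x => by simp)
  have z2 := integral_eq_zero_of_odd 0 i13 (fun x => by simp)
  have k4 : ∀ a : Fin 2, ∫ x, (x a) ^ 4 ∂(gv (Fin 2)) =
      ∫ y : ℝ, y ^ 4 ∂(gaussianReal 0 (1 / 2)) :=
    fun a => integral_coord a (fun y => y ^ 4) (by fun_prop)
  have k22 : ∫ x, (x 0) ^ 2 * (x 1) ^ 2 ∂(gv (Fin 2)) = 1 / 2 * (1 / 2) := by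
    rw [integral_coord_mul (κ := Fin 2) (a := 0) (b := 1) (by decide) (fun y => y ^ 2)
      (fun y => y ^ 2) (by fun_prop) (by fun_prop), integral_sq_half]
  have s1 := integral_add (i4 0) ((i4 1).add (i22.add (i31.add i13).integrable))
  have s2 := integral_add (i4 1) (i22.add (i31.add i13).integrable)
  have s3 := integral_add i22 (i31.add i13).integrable
  have s4 := integral_add i31.integrable i13.integrable
  simp only [Pi.add_apply] at s1 s2 s3 s4
  rw [s1, s2, s3, s4, z1, z2, integral_const_mul, integral_const_mul, integral_const_mul, k4, k4,
    k22] at h1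
  linarith

end moments

/-- Row average of a function of the row blocks of a Gaussian array. -/
lemma average_concentration {m d : ℕ} {f : (Fin 2 × Fin d → ℝ) → ℝ}
    (hf : HasAllMoments f (gv (Fin 2 × Fin d))) {ε : ℝ} (hε : 0 < ε) (hm : 0 < m) :
    gv ((Fin m × Fin 2) × Fin d)
      {X | ε * m ≤ |∑ j, f (fun p => X ((j, p.1), p.2)) - m * ∫ y, f y ∂(gv (Fin 2 × Fin d))|} ≤
      ENNReal.ofReal (Var[f; gv (Fin 2 × Fin d)] / ε ^ 2 / m) := by
  have hm' : (0 : ℝ) < m := by exact_mod_cast hm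
  have hmp := (measurePreserving_curry (κ := Fin m) (κ' := Fin 2 × Fin d)).comp
    (measurePreserving_reindex (Equiv.prodAssoc (Fin m) (Fin 2) (Fin d)))
  have h1 := chebyshev_pi (gv (Fin 2 × Fin d)) (fun _ : Fin m => f) (fun _ => hf.memLp_two)
    (c := ε * m) (V := m * Var[f; gv (Fin 2 × Fin d)]) (by positivity) (by simp)
  simp only [Finset.sum_const, Finset.card_univ, Fintype.card_fin, nsmul_eq_mul] at h1
  have h2 : ENNReal.ofReal (m * Var[f; gv (Fin 2 × Fin d)] / (ε * m) ^ 2) =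
      ENNReal.ofReal (Var[f; gv (Fin 2 × Fin d)] / ε ^ 2 / m) := by
    congr 1
    field_simp
  rw [h2] at h1
  rw [← hmp.map_eq] at h1
  exact (Measure.le_map_apply hmp.measurable.aemeasurable _).trans h1

section frame
variable {d : ℕ} (k₀ : Fin d)

/-- One plus the squared norm of a block, to the sixth power. -/
def blockMoment (y : Fin 2 × Fin d → ℝ) : ℝ := (1 + ∑ p, y p ^ 2) ^ 6

/-- The real part of the product of the complex coordinates `k₀` and `k` of a block. -/
def blockProd (k : Fin d) (y : Fin 2 × Fin d → ℝ) : ℝ := ∑ σ, y (σ, k₀) * y (σ, k)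

lemma hasAllMoments_blockMoment : HasAllMoments (blockMoment (d := d)) (gv (Fin 2 × Fin d)) :=
  ((HasAllMoments.const 1).add
    (HasAllMoments.sum _ fun p _ => (hasAllMoments_coord p).pow 2)).pow 6

lemma hasAllMoments_blockProd (k : Fin d) :
    HasAllMoments (blockProd k₀ k) (gv (Fin 2 × Fin d)) :=
  HasAllMoments.sum _ fun _ _ => (hasAllMoments_coord _).mul (hasAllMoments_coord _)

lemma integral_sum_two {f g : (Fin 2 × Fin d → ℝ) → ℝ} (hf : HasAllMoments f (gv (Fin 2 × Fin d)))
    (hg : HasAllMoments g (gv (Fin 2 × Fin d))) :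
    ∫ y, (f y + g y) ∂(gv (Fin 2 × Fin d)) =
      ∫ y, f y ∂(gv (Fin 2 × Fin d)) + ∫ y, g y ∂(gv (Fin 2 × Fin d)) :=
  integral_add hf.integrable hg.integrable

lemma integral_blockProd_self :
    ∫ y, blockProd k₀ k₀ y ∂(gv (Fin 2 × Fin d)) = 1 := by
  have h : ∀ y : Fin 2 × Fin d → ℝ, blockProd k₀ k₀ y = y (0, k₀) ^ 2 + y (1, k₀) ^ 2 := by
    intro y; simp only [blockProd, Fin.sum_univ_two]; ring
  simp_rw [h]
  rw [integral_sum_two ((hasAllMoments_coord _).pow 2) ((hasAllMoments_coord _).pow 2),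
    integral_coord _ (fun y => y ^ 2) (by fun_prop),
    integral_coord _ (fun y => y ^ 2) (by fun_prop), integral_sq_half]
  norm_num

/-- For `k ≠ l` some coordinate off `k₀` enters oddly, so the mean vanishes. The diagonal values are
`E|a|⁴ = 2` at `k₀` and `E (Re (conj a b))² = 1/2` elsewhere; their doubles 4 and 1 are the
eigenvalues of the Hessian at the solution. -/
lemma integral_blockProd_mul (k l : Fin d) :
    ∫ y, blockProd k₀ k y * blockProd k₀ l y ∂(gv (Fin 2 × Fin d)) =
      if k = l then (if k = k₀ then 2 else 1 / 2) else 0 := by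
  have hm := (hasAllMoments_blockProd k₀ k).mul (hasAllMoments_blockProd k₀ l)
  have sq4 : ∀ a b : Fin 2 × Fin d, a ≠ b → ∫ y, y a ^ 2 * y b ^ 2 ∂(gv (Fin 2 × Fin d)) =
      1 / 4 := by
    intro a b hab
    rw [integral_coord_mul hab (fun y => y ^ 2) (fun y => y ^ 2) (by fun_prop) (by fun_prop),
      integral_sq_half]
    norm_num
  have c := fun p : Fin 2 × Fin d => hasAllMoments_coord p
  have flip : ∀ k l : Fin d, k ≠ l → l ≠ k₀ →
      ∫ y, blockProd k₀ k y * blockProd k₀ l y ∂(gv (Fin 2 × Fin d)) = 0 := by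
    intro k l hkl hl
    have m1 : ∀ σ, HasAllMoments (fun y => blockProd k₀ k y * (y (σ, k₀) * y (σ, l)))
        (gv (Fin 2 × Fin d)) := fun σ => (hasAllMoments_blockProd k₀ k).mul ((c _).mul (c _))
    have e : ∀ y : Fin 2 × Fin d → ℝ, blockProd k₀ k y * blockProd k₀ l y =
        blockProd k₀ k y * (y (0, k₀) * y (0, l)) + blockProd k₀ k y * (y (1, k₀) * y (1, l)) := by
      intro y
      conv_lhs => rw [blockProd.eq_1 k₀ l]
      rw [Fin.sum_univ_two]
      ring
    simp_rw [e]
    rw [integral_sum_two (m1 0) (m1 1)]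
    have z : ∀ σ, ∫ y, blockProd k₀ k y * (y (σ, k₀) * y (σ, l)) ∂(gv (Fin 2 × Fin d)) = 0 := by
      intro σ
      refine integral_eq_zero_of_odd (σ, l) (m1 σ) fun x => ?_
      simp [blockProd, hkl, hl.symm]
    rw [z, z, add_zero]
  split_ifs with hkl hk
  · subst hkl hk
    have e : ∀ y : Fin 2 × Fin d → ℝ, blockProd k k y * blockProd k k y =
        (y (0, k) ^ 4 + y (1, k) ^ 4) + 2 * (y (0, k) ^ 2 * y (1, k) ^ 2) := by
      intro y; simp only [blockProd, Fin.sum_univ_two]; ring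
    simp_rw [e]
    rw [integral_sum_two (((c _).pow 4).add ((c _).pow 4))
      ((HasAllMoments.const 2).mul (((c _).pow 2).mul ((c _).pow 2))),
      integral_sum_two ((c _).pow 4) ((c _).pow 4), integral_const_mul, sq4 _ _ (by simp),
      integral_coord _ (fun y => y ^ 4) (by fun_prop),
      integral_coord _ (fun y => y ^ 4) (by fun_prop), integral_pow_four_half]
    norm_num
  · subst hkl
    have e : ∀ y : Fin 2 × Fin d → ℝ, blockProd k₀ k y * blockProd k₀ k y =
        (y (0, k₀) ^ 2 * y (0, k) ^ 2 + y (1, k₀) ^ 2 * y (1, k) ^ 2) +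
          2 * (y (0, k) * (y (0, k₀) * (y (1, k₀) * y (1, k)))) := by
      intro y; simp only [blockProd, Fin.sum_univ_two]; ring
    simp_rw [e]
    have mz := (c (0, k)).mul ((c (0, k₀)).mul ((c (1, k₀)).mul (c (1, k))))
    have z := integral_eq_zero_of_odd (0, k) mz (fun x => by simp [Ne.symm hk])
    rw [integral_sum_two ((((c _).pow 2).mul ((c _).pow 2)).add (((c _).pow 2).mul ((c _).pow 2)))
      ((HasAllMoments.const 2).mul mz), integral_const_mul, z,
      integral_sum_two (((c _).pow 2).mul ((c _).pow 2)) (((c _).pow 2).mul ((c _).pow 2)),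
      sq4 _ _ (by simp [Ne.symm hk]), sq4 _ _ (by simp [Ne.symm hk])]
    norm_num
  · by_cases hl : l = k₀
    · simp_rw [mul_comm (blockProd k₀ k _)]
      refine flip l k (Ne.symm hkl) fun h => hkl (h.trans hl.symm)
    · exact flip k l hkl hl

/-- Law-of-large-numbers conditions on the projections of the sampling vectors to a frame. -/
structure FrameGood {m : ℕ} (C ε : ℝ) (X : (Fin m × Fin 2) × Fin d → ℝ) : Prop where
  moment : ∑ j, blockMoment (fun p => X ((j, p.1), p.2)) ≤ C * m
  cov : ∀ k l, |∑ j, blockProd k₀ k (fun p => X ((j, p.1), p.2)) *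
    blockProd k₀ l (fun p => X ((j, p.1), p.2)) -
      m * (if k = l then (if k = k₀ then 2 else 1 / 2) else 0)| ≤ ε * m
  energy : |∑ j, blockProd k₀ k₀ (fun p => X ((j, p.1), p.2)) - m| ≤ ε * m

end frame

/-- Union of Chebyshev bounds, each of the form variance over `ε² m`. Summing the variances over all
`k₀` as well makes the constant depend on `d` and `ε` alone. -/
lemma exists_frameGood_const (d : ℕ) {ε : ℝ} (hε : 0 < ε) :
    ∃ C > 0, ∀ (m : ℕ) (k₀ : Fin d), 0 < m →
      gv ((Fin m × Fin 2) × Fin d)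
        {X | ¬ FrameGood k₀ (∫ y, blockMoment y ∂(gv (Fin 2 × Fin d)) + 1) ε X} ≤
        ENNReal.ofReal (C / m) := by
  set V₁ := Var[blockMoment (d := d); gv (Fin 2 × Fin d)]
  set V₂ : Fin d → Fin d → Fin d → ℝ := fun k₀ k l =>
    Var[fun y => blockProd k₀ k y * blockProd k₀ l y; gv (Fin 2 × Fin d)] / ε ^ 2
  set V₃ : Fin d → ℝ := fun k₀ => Var[blockProd k₀ k₀; gv (Fin 2 × Fin d)] / ε ^ 2
  have n1 : 0 ≤ V₁ := variance_nonneg _ _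
  have n2 : ∀ k₀ k l, 0 ≤ V₂ k₀ k l := fun _ _ _ => div_nonneg (variance_nonneg _ _) (sq_nonneg _)
  have n3 : ∀ k₀, 0 ≤ V₃ k₀ := fun _ => div_nonneg (variance_nonneg _ _) (sq_nonneg _)
  refine ⟨1 + V₁ + ∑ k₀, ∑ k, ∑ l, V₂ k₀ k l + ∑ k₀, V₃ k₀, ?_, fun m k₀ hm => ?_⟩
  · have := Finset.sum_nonneg fun k₀ (_ : k₀ ∈ Finset.univ) => n3 k₀
    have := Finset.sum_nonneg fun k₀ (_ : k₀ ∈ Finset.univ) => Finset.sum_nonneg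
      fun k (_ : k ∈ Finset.univ) => Finset.sum_nonneg fun l (_ : l ∈ Finset.univ) => n2 k₀ k l
    linarith
  have hm' : (0 : ℝ) < m := by exact_mod_cast hm
  have h1 := average_concentration (m := m) (hasAllMoments_blockMoment (d := d)) one_pos hm
  have h2 := fun k l => average_concentration (m := m)
    ((hasAllMoments_blockProd k₀ k).mul (hasAllMoments_blockProd k₀ l)) hε hm
  have h3 := average_concentration (m := m) (hasAllMoments_blockProd k₀ k₀) hε hm
  simp_rw [integral_blockProd_mul] at h2
  rw [integral_blockProd_self, mul_one] at h3
  have hsub : {X : (Fin m × Fin 2) × Fin d → ℝ |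
      ¬ FrameGood k₀ (∫ y, blockMoment y ∂(gv (Fin 2 × Fin d)) + 1) ε X} ⊆
      {X | 1 * m ≤ |∑ j, blockMoment (fun p => X ((j, p.1), p.2)) -
        m * ∫ y, blockMoment y ∂(gv (Fin 2 × Fin d))|} ∪
      ((⋃ k, ⋃ l, {X | ε * m ≤ |∑ j, blockProd k₀ k (fun p => X ((j, p.1), p.2)) *
        blockProd k₀ l (fun p => X ((j, p.1), p.2)) -
          m * (if k = l then (if k = k₀ then 2 else 1 / 2) else 0)|}) ∪
      {X | ε * m ≤ |∑ j, blockProd k₀ k₀ (fun p => X ((j, p.1), p.2)) - m|}) := by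
    intro X hX
    by_contra hc
    simp only [Set.mem_union, Set.mem_iUnion, not_or, not_exists, Set.mem_ofPred_eq, not_le] at hc
    refine hX ⟨?_, fun k l => (hc.2.1 k l).le, hc.2.2.le⟩
    have := (abs_lt.1 hc.1).2
    nlinarith
  refine (measure_mono hsub).trans ((measure_union_le _ _).trans ?_)
  have hU : gv ((Fin m × Fin 2) × Fin d) (⋃ k, ⋃ l, {X | ε * m ≤ |∑ j,
      blockProd k₀ k (fun p => X ((j, p.1), p.2)) *
        blockProd k₀ l (fun p => X ((j, p.1), p.2)) -
          m * (if k = l then (if k = k₀ then 2 else 1 / 2) else 0)|}) ≤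
      ENNReal.ofReal ((∑ k, ∑ l, V₂ k₀ k l) / m) := by
    refine (measure_iUnion_fintype_le _ _).trans ?_
    rw [Finset.sum_div, ENNReal.ofReal_sum_of_nonneg fun k _ =>
      div_nonneg (Finset.sum_nonneg fun l _ => n2 k₀ k l) hm'.le]
    refine Finset.sum_le_sum fun k _ => (measure_iUnion_fintype_le _ _).trans ?_
    rw [Finset.sum_div, ENNReal.ofReal_sum_of_nonneg fun l _ => div_nonneg (n2 k₀ k l) hm'.le]
    exact Finset.sum_le_sum fun l _ => h2 k l
  refine (add_le_add h1 ((measure_union_le _ _).trans (add_le_add hU h3))).trans ?_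
  have m1 : 0 ≤ V₁ / 1 ^ 2 / m := div_nonneg (div_nonneg n1 (by norm_num)) hm'.le
  have m2 : 0 ≤ (∑ k, ∑ l, V₂ k₀ k l) / m := div_nonneg
    (Finset.sum_nonneg fun k _ => Finset.sum_nonneg fun l _ => n2 k₀ k l) hm'.le
  have m3 : 0 ≤ V₃ k₀ / m := div_nonneg (n3 k₀) hm'.le
  rw [← ENNReal.ofReal_add m2 m3, ← ENNReal.ofReal_add m1 (add_nonneg m2 m3)]
  apply ENNReal.ofReal_le_ofReal
  have e2 : ∑ k, ∑ l, V₂ k₀ k l ≤ ∑ k₀, ∑ k, ∑ l, V₂ k₀ k l :=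
    Finset.single_le_sum (f := fun k₀ => ∑ k, ∑ l, V₂ k₀ k l)
      (fun k₀ _ => Finset.sum_nonneg fun k _ => Finset.sum_nonneg fun l _ => n2 k₀ k l)
      (Finset.mem_univ k₀)
  have e3 : V₃ k₀ ≤ ∑ k₀, V₃ k₀ :=
    Finset.single_le_sum (fun k₀ _ => n3 k₀) (Finset.mem_univ k₀)
  clear_value V₁ V₂ V₃
  rw [one_pow, div_one, ← add_div, ← add_div]
  exact div_le_div_of_nonneg_right (by linarith) hm'.le

end GraHTP

/-! ### Bilinear forms of the rows, the gradient and Jacobian formulas, orthonormal frames. -/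

namespace GraHTP

section forms
variable {n m : ℕ} (A : (Fin m × Fin 2) × Fin n → ℝ)

/-- The pairing of a row of a real array with a vector. -/
def rdot (r : Fin m × Fin 2) (v : EuclideanSpace ℝ (Fin n)) : ℝ := ∑ i, A (r, i) * v i

/-- The symmetric form `Re (conj ⟨a_j, v⟩ ⟨a_j, v'⟩)`. -/
def quad (j : Fin m) (v v' : EuclideanSpace ℝ (Fin n)) : ℝ :=
  ∑ σ, rdot A (j, σ) v * rdot A (j, σ) v'

variable (r : Fin m × Fin 2) (j : Fin m) (v v' v'' : EuclideanSpace ℝ (Fin n)) (c : ℝ)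

lemma rdot_add : rdot A r (v + v') = rdot A r v + rdot A r v' := by
  simp [rdot, mul_add, Finset.sum_add_distrib]

lemma rdot_sub : rdot A r (v - v') = rdot A r v - rdot A r v' := by
  simp [rdot, mul_sub, Finset.sum_sub_distrib]

lemma rdot_smul : rdot A r (c • v) = c * rdot A r v := by
  simp [rdot, Finset.mul_sum, mul_left_comm]

lemma rdot_sum {κ : Type*} (s : Finset κ) (F : κ → EuclideanSpace ℝ (Fin n)) :
    rdot A r (∑ k ∈ s, F k) = ∑ k ∈ s, rdot A r (F k) := by
  classical
  induction s using Finset.induction_on with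
  | empty => simp [rdot]
  | insert a s ha ih => rw [Finset.sum_insert ha, Finset.sum_insert ha, rdot_add, ih]

lemma rdot_zero : rdot A r 0 = 0 := by simp [rdot]

lemma quad_comm : quad A j v v' = quad A j v' v := by simp [quad, mul_comm]

lemma quad_add_right : quad A j v (v' + v'') = quad A j v v' + quad A j v v'' := by
  simp [quad, rdot_add]; ring

lemma quad_add_left : quad A j (v + v') v'' = quad A j v v'' + quad A j v' v'' := by
  simp [quad, rdot_add]; ring

lemma quad_sub_right : quad A j v (v' - v'') = quad A j v v' - quad A j v v'' := by
  simp [quad, rdot_sub]; ring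

lemma quad_sub_left : quad A j (v - v') v'' = quad A j v v'' - quad A j v' v'' := by
  simp [quad, rdot_sub]; ring

lemma quad_smul_right : quad A j v (c • v') = c * quad A j v v' := by
  simp [quad, rdot_smul]; ring

lemma quad_smul_left : quad A j (c • v) v' = c * quad A j v v' := by
  simp [quad, rdot_smul]; ring

lemma quad_sum_right {κ : Type*} (s : Finset κ) (F : κ → EuclideanSpace ℝ (Fin n)) :
    quad A j v (∑ k ∈ s, F k) = ∑ k ∈ s, quad A j v (F k) := by
  simp only [quad, rdot_sum, Finset.mul_sum]
  exact Finset.sum_comm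

lemma quad_self_nonneg : 0 ≤ quad A j v v :=
  Finset.sum_nonneg fun _ _ => mul_self_nonneg _

lemma quad_sq_le : quad A j v v' ^ 2 ≤ quad A j v v * quad A j v' v' := by
  have := Finset.sum_mul_sq_le_sq_mul_sq Finset.univ (fun σ => rdot A (j, σ) v)
    (fun σ => rdot A (j, σ) v')
  simpa [quad, sq] using this

end forms

section links
variable {n m : ℕ} (A : (Fin m × Fin 2) × Fin n → ℝ)

lemma norm_cdot_sq (j : Fin m) (v : EuclideanSpace ℝ (Fin n)) :
    ‖cdot (toComplexRows A j) v‖ ^ 2 = quad A j v v := by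
  have h1 : (cdot (toComplexRows A j) v).re = rdot A (j, 0) v := by
    simp [cdot, toComplexRows, rdot]
  have h2 : (cdot (toComplexRows A j) v).im = -rdot A (j, 1) v := by
    simp [cdot, toComplexRows, rdot]
  rw [← Complex.normSq_eq_norm_sq, Complex.normSq_apply, h1, h2]
  simp [quad]

lemma loss_eq (x z : EuclideanSpace ℝ (Fin n)) :
    loss (toComplexRows A) (measurements (toComplexRows A) x) z =
      1 / (4 * (m : ℝ)) * ∑ j, (quad A j z z - quad A j x x) ^ 2 := by
  simp only [loss, measurements, norm_cdot_sq]

lemma resid_eq (x w : EuclideanSpace ℝ (Fin n)) (j : Fin m) :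
    resid (toComplexRows A) (measurements (toComplexRows A) x) w j =
      1 / (2 * √m) * (quad A j w w - quad A j x x) := by
  simp only [resid, measurements, norm_cdot_sq]

lemma jacobian_mulVec (w v : EuclideanSpace ℝ (Fin n)) (j : Fin m) :
    (jacobian (toComplexRows A) w).mulVec v.ofLp j = 1 / √m * quad A j w v := by
  simp only [Matrix.mulVec, dotProduct, jacobian, Matrix.of_apply, toComplexRows, quad,
    Fin.sum_univ_two, rdot]
  simp_rw [mul_assoc, add_mul, mul_assoc]
  rw [← Finset.mul_sum, Finset.sum_add_distrib, ← Finset.mul_sum, ← Finset.mul_sum]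

/-- The pairing with a row as a continuous linear map. -/
noncomputable def rdotL (r : Fin m × Fin 2) : EuclideanSpace ℝ (Fin n) →L[ℝ] ℝ :=
  LinearMap.toContinuousLinearMap
    { toFun := rdot A r
      map_add' := fun v v' => rdot_add A r v v'
      map_smul' := fun c v => rdot_smul A r v c }

lemma inner_gradient_loss (x z v : EuclideanSpace ℝ (Fin n)) :
    inner ℝ (gradient (loss (toComplexRows A) (measurements (toComplexRows A) x)) z) v =
      1 / (m : ℝ) * ∑ j, (quad A j z z - quad A j x x) * quad A j z v := by
  have hr : ∀ r, HasFDerivAt (rdot A r) (rdotL A r) z := fun r => (rdotL A r).hasFDerivAt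
  have hq : ∀ j, HasFDerivAt (fun z => quad A j z z)
      (∑ σ, (rdot A (j, σ) z • rdotL A (j, σ) + rdot A (j, σ) z • rdotL A (j, σ))) z :=
    fun j => HasFDerivAt.fun_sum fun σ _ => (hr (j, σ)).mul (hr (j, σ))
  have hs : HasFDerivAt (fun z => 1 / (4 * (m : ℝ)) * ∑ j, (quad A j z z - quad A j x x) ^ 2)
      ((1 / (4 * (m : ℝ))) • ∑ j, (2 * (quad A j z z - quad A j x x) ^ 1) •
        (∑ σ, (rdot A (j, σ) z • rdotL A (j, σ) + rdot A (j, σ) z • rdotL A (j, σ)))) z := by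
    refine HasFDerivAt.const_mul (HasFDerivAt.fun_sum fun j _ => ?_) _
    have h := ((hq j).sub_const (quad A j x x)).pow 2
    rw [nsmul_eq_mul, Nat.cast_ofNat] at h
    exact h
  have hl : (loss (toComplexRows A) (measurements (toComplexRows A) x)) =
      fun z => 1 / (4 * (m : ℝ)) * ∑ j, (quad A j z z - quad A j x x) ^ 2 :=
    funext fun z => loss_eq A x z
  rw [gradient, hl, hs.fderiv, InnerProductSpace.toDual_symm_apply]
  have hL : ∀ r, rdotL A r v = rdot A r v := fun _ => rfl
  simp only [smul_apply, sum_apply,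
    add_apply, hL, smul_eq_mul, pow_one, quad, Fin.sum_univ_two]
  rw [Finset.mul_sum, Finset.mul_sum]
  refine Finset.sum_congr rfl fun j _ => ?_
  ring

end links

section frames
variable {n m d : ℕ} (u : Fin d → EuclideanSpace ℝ (Fin n))

/-- Projection onto the span of an orthonormal frame. -/
noncomputable def proj (v : EuclideanSpace ℝ (Fin n)) : EuclideanSpace ℝ (Fin n) :=
  ∑ k, inner ℝ (u k) v • u k

/-- The component of `v` orthogonal to an orthonormal frame. -/
noncomputable def perp (v : EuclideanSpace ℝ (Fin n)) : EuclideanSpace ℝ (Fin n) :=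
  v - proj u v

/-- The pairings of the rows of an array with the vectors of a frame. -/
def frameCoords (A : (Fin m × Fin 2) × Fin n → ℝ) : (Fin m × Fin 2) × Fin d → ℝ :=
  fun p => rdot A p.1 (u p.2)

/-- Squared norm of a block of coordinates. -/
def blockSq (X : (Fin m × Fin 2) × Fin d → ℝ) (j : Fin m) : ℝ :=
  ∑ p : Fin 2 × Fin d, X ((j, p.1), p.2) ^ 2

lemma blockSq_nonneg (X : (Fin m × Fin 2) × Fin d → ℝ) (j : Fin m) : 0 ≤ blockSq X j :=
  Finset.sum_nonneg fun _ _ => sq_nonneg _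

variable {u}

lemma proj_add_perp (v : EuclideanSpace ℝ (Fin n)) : proj u v + perp u v = v := by
  simp [perp]

lemma perp_add (v v' : EuclideanSpace ℝ (Fin n)) : perp u (v + v') = perp u v + perp u v' := by
  simp [perp, proj, inner_add_right, add_smul, Finset.sum_add_distrib]; abel

lemma perp_smul (c : ℝ) (v : EuclideanSpace ℝ (Fin n)) : perp u (c • v) = c • perp u v := by
  simp [perp, proj, inner_smul_right, mul_smul, smul_sub, Finset.smul_sum]

lemma perp_sub (v v' : EuclideanSpace ℝ (Fin n)) : perp u (v - v') = perp u v - perp u v' := by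
  simp [perp, proj, inner_sub_right, sub_smul, Finset.sum_sub_distrib]; abel

lemma inner_frame_proj (hu : Orthonormal ℝ u) (k : Fin d) (v : EuclideanSpace ℝ (Fin n)) :
    inner ℝ (u k) (proj u v) = inner ℝ (u k) v := by
  simp only [proj]
  exact hu.inner_right_fintype _ k

lemma inner_frame_perp (hu : Orthonormal ℝ u) (k : Fin d) (v : EuclideanSpace ℝ (Fin n)) :
    inner ℝ (u k) (perp u v) = 0 := by
  rw [perp, inner_sub_right, inner_frame_proj hu, sub_self]

lemma inner_proj_perp (hu : Orthonormal ℝ u) (v v' : EuclideanSpace ℝ (Fin n)) :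
    inner ℝ (proj u v) (perp u v') = 0 := by
  simp only [proj, sum_inner, inner_smul_left, inner_frame_perp hu, mul_zero,
    Finset.sum_const_zero]

lemma inner_proj_proj (hu : Orthonormal ℝ u) (v v' : EuclideanSpace ℝ (Fin n)) :
    inner ℝ (proj u v) (proj u v') = ∑ k, inner ℝ (u k) v * inner ℝ (u k) v' := by
  conv_lhs => rw [proj]
  simp [sum_inner, inner_smul_left, inner_frame_proj hu]

lemma inner_eq_frame (hu : Orthonormal ℝ u) (v v' : EuclideanSpace ℝ (Fin n)) :
    inner ℝ v v' = ∑ k, inner ℝ (u k) v * inner ℝ (u k) v' + inner ℝ (perp u v) (perp u v') := by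
  conv_lhs => rw [← proj_add_perp (u := u) v, ← proj_add_perp (u := u) v']
  rw [inner_add_left, inner_add_right, inner_add_right, inner_proj_perp hu,
    real_inner_comm _ (perp u v), inner_proj_perp hu, inner_proj_proj hu]
  ring

lemma sum_inner_sq_le (hu : Orthonormal ℝ u) (v : EuclideanSpace ℝ (Fin n)) :
    ∑ k, inner ℝ (u k) v ^ 2 ≤ ‖v‖ ^ 2 := by
  have h := inner_eq_frame hu v v
  rw [real_inner_self_eq_norm_sq, real_inner_self_eq_norm_sq] at h
  simp only [← sq] at h
  nlinarith [sq_nonneg ‖perp u v‖]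

lemma norm_perp_le (hu : Orthonormal ℝ u) (v : EuclideanSpace ℝ (Fin n)) : ‖perp u v‖ ≤ ‖v‖ := by
  have h := inner_eq_frame hu v v
  rw [real_inner_self_eq_norm_sq, real_inner_self_eq_norm_sq] at h
  simp only [← sq] at h
  have : 0 ≤ ∑ k, inner ℝ (u k) v ^ 2 := Finset.sum_nonneg fun _ _ => sq_nonneg _
  exact le_of_sq_le_sq (by linarith) (norm_nonneg _)

lemma abs_inner_frame_le (hu : Orthonormal ℝ u) (k : Fin d) (v : EuclideanSpace ℝ (Fin n)) :
    |inner ℝ (u k) v| ≤ ‖v‖ := by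
  have := abs_real_inner_le_norm (u k) v
  rwa [hu.1 k, one_mul] at this

variable (A : (Fin m × Fin 2) × Fin n → ℝ)

lemma rdot_proj (r : Fin m × Fin 2) (v : EuclideanSpace ℝ (Fin n)) :
    rdot A r (proj u v) = ∑ k, inner ℝ (u k) v * frameCoords u A (r, k) := by
  simp [proj, rdot_sum, rdot_smul, frameCoords]

lemma eq_proj {v : EuclideanSpace ℝ (Fin n)} (hv : perp u v = 0) : v = proj u v := by
  have := proj_add_perp (u := u) v
  rw [hv, add_zero] at this
  exact this.symm

lemma quad_self_le (hu : Orthonormal ℝ u) (j : Fin m) {v : EuclideanSpace ℝ (Fin n)}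
    (hv : perp u v = 0) : quad A j v v ≤ blockSq (frameCoords u A) j * ‖v‖ ^ 2 := by
  have h : ∀ σ, rdot A (j, σ) v * rdot A (j, σ) v ≤
      (∑ k, frameCoords u A ((j, σ), k) ^ 2) * ‖v‖ ^ 2 := by
    intro σ
    conv_lhs => rw [eq_proj hv]
    rw [rdot_proj, ← sq]
    refine (Finset.sum_mul_sq_le_sq_mul_sq _ _ _).trans ?_
    rw [mul_comm]
    gcongr
    exact sum_inner_sq_le hu v
  calc quad A j v v ≤ ∑ σ, (∑ k, frameCoords u A ((j, σ), k) ^ 2) * ‖v‖ ^ 2 :=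
        Finset.sum_le_sum fun σ _ => h σ
    _ = blockSq (frameCoords u A) j * ‖v‖ ^ 2 := by
        rw [← Finset.sum_mul, blockSq, Fintype.sum_prod_type]

lemma abs_quad_le (hu : Orthonormal ℝ u) (j : Fin m) {v v' : EuclideanSpace ℝ (Fin n)}
    (hv : perp u v = 0) (hv' : perp u v' = 0) :
    |quad A j v v'| ≤ blockSq (frameCoords u A) j * (‖v‖ * ‖v'‖) := by
  have hb := blockSq_nonneg (frameCoords u A) j
  apply abs_le_of_sq_le_sq _ (by positivity)
  calc quad A j v v' ^ 2 ≤ quad A j v v * quad A j v' v' := quad_sq_le A j v v'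
    _ ≤ (blockSq (frameCoords u A) j * ‖v‖ ^ 2) * (blockSq (frameCoords u A) j * ‖v'‖ ^ 2) :=
        mul_le_mul (quad_self_le A hu j hv) (quad_self_le A hu j hv') (quad_self_nonneg _ _ _)
          (by positivity)
    _ = _ := by ring

lemma perp_frame (hu : Orthonormal ℝ u) (k : Fin d) : perp u (u k) = 0 := by
  classical
  rw [perp, proj]
  simp [orthonormal_iff_ite.1 hu]

end frames

end GraHTP

/-! ### Contraction of the gradient step and the loss from hard thresholding. -/

namespace GraHTP

section gradient
variable {n m d : ℕ} {u : Fin d → EuclideanSpace ℝ (Fin n)} {k₀ : Fin d} {C ε : ℝ}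
  {A : (Fin m × Fin 2) × Fin n → ℝ}

/-- The sixth power in `blockMoment` dominates every power of the block energy that occurs, so one
moment condition serves all error estimates. -/
lemma FrameGood.sum_le {X : (Fin m × Fin 2) × Fin d → ℝ} (hg : FrameGood k₀ C ε X)
    {g : Fin m → ℝ} (h : ∀ j, g j ≤ (1 + blockSq X j) ^ 6) : ∑ j, g j ≤ C * m :=
  (Finset.sum_le_sum fun j _ => h j).trans hg.moment

lemma pow_le_one_add_pow_six {b : ℝ} (hb : 0 ≤ b) {k : ℕ} (hk : k ≤ 6) :
    b ^ k ≤ (1 + b) ^ 6 :=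
  (pow_le_pow_left₀ hb (by linarith) k).trans (pow_le_pow_right₀ (by linarith) hk)

lemma FrameGood.cov_quad (hg : FrameGood k₀ C ε (frameCoords u A)) (k l : Fin d) :
    |∑ j, quad A j (u k₀) (u k) * quad A j (u k₀) (u l) -
      m * (if k = l then (if k = k₀ then 2 else 1 / 2) else 0)| ≤ ε * m := hg.cov k l

lemma FrameGood.energy_quad (hg : FrameGood k₀ C ε (frameCoords u A)) :
    |∑ j, quad A j (u k₀) (u k₀) - m| ≤ ε * m := hg.energy

lemma sum_abs_inner_le (hu : Orthonormal ℝ u) (hd : d ≤ 3) (v : EuclideanSpace ℝ (Fin n)) :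
    ∑ k, |inner ℝ (u k) v| ≤ 3 * ‖v‖ := by
  calc ∑ k, |inner ℝ (u k) v| ≤ ∑ _k : Fin d, ‖v‖ :=
        Finset.sum_le_sum fun k _ => abs_inner_frame_le hu k v
    _ = d * ‖v‖ := by simp
    _ ≤ 3 * ‖v‖ := by gcongr; exact_mod_cast hd

/-- The coordinates of the gradient along the frame are close to those of the Hessian at the
solution applied to the error. -/
lemma gradient_frame_coord (hu : Orthonormal ℝ u) (hd : d ≤ 3) (hε : 0 ≤ ε)
    (hg : FrameGood k₀ C ε (frameCoords u A)) {h : EuclideanSpace ℝ (Fin n)}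
    (hh : perp u h = 0) (hh1 : ‖h‖ ≤ 1) (k : Fin d) :
    |∑ j, (quad A j (u k₀ + h) (u k₀ + h) - quad A j (u k₀) (u k₀)) * quad A j (u k₀ + h) (u k) -
      m * ((if k = k₀ then 4 else 1) * inner ℝ (u k) h)| ≤
      m * ((6 * ε + 4 * C * ‖h‖) * ‖h‖) := by
  set x := u k₀ with hx
  have hxp : perp u x = 0 := perp_frame hu k₀
  have hkp : perp u (u k) = 0 := perp_frame hu k
  have hxn : ‖x‖ = 1 := hu.1 k₀
  have hkn : ‖u k‖ = 1 := hu.1 k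
  -- `R` collects the terms of order at least two in `h`.
  set R : Fin m → ℝ := fun j => 2 * quad A j x h * quad A j h (u k) +
    quad A j h h * (quad A j x (u k) + quad A j h (u k)) with hR
  have e1 : ∀ j, (quad A j (x + h) (x + h) - quad A j x x) * quad A j (x + h) (u k) =
      2 * (quad A j x h * quad A j x (u k)) + R j := by
    intro j
    simp only [hR, quad_add_left, quad_add_right, quad_comm A j h x]
    ring
  have e2 : ∀ j, quad A j x h = ∑ l, inner ℝ (u l) h * quad A j x (u l) := by
    intro j
    conv_lhs => rw [eq_proj hh, proj, quad_sum_right]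
    simp only [quad_smul_right]
  have e3 : ∑ j, 2 * (quad A j x h * quad A j x (u k)) =
      2 * ∑ l, inner ℝ (u l) h * ∑ j, quad A j x (u l) * quad A j x (u k) := by
    rw [← Finset.mul_sum]
    simp only [e2, Finset.sum_mul, Finset.mul_sum]
    rw [Finset.sum_comm]
    simp only [mul_assoc]
  -- The Hessian eigenvalues 4 and 1 are twice the covariances 2 and 1/2, which are diagonal in the
  -- frame.
  have e4 : m * ((if k = k₀ then 4 else 1) * inner ℝ (u k) h) =
      2 * ∑ l, inner ℝ (u l) h * (m * (if l = k then (if l = k₀ then 2 else 1 / 2) else 0)) := by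
    rw [Finset.sum_eq_single k (fun l _ hl => by simp [hl]) (by simp), if_pos rfl]
    split_ifs <;> ring
  have b1 : |∑ j, 2 * (quad A j x h * quad A j x (u k)) -
      m * ((if k = k₀ then 4 else 1) * inner ℝ (u k) h)| ≤ m * (6 * ε * ‖h‖) := by
    rw [e3, e4, ← mul_sub, ← Finset.sum_sub_distrib, abs_mul, abs_two]
    simp_rw [← mul_sub]
    calc _ ≤ 2 * ∑ l, |inner ℝ (u l) h| * (ε * m) := by
          gcongr
          refine (Finset.abs_sum_le_sum_abs _ _).trans (Finset.sum_le_sum fun l _ => ?_)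
          rw [abs_mul]
          gcongr
          exact hg.cov_quad l k
      _ = 2 * ((∑ l, |inner ℝ (u l) h|) * (ε * m)) := by rw [Finset.sum_mul]
      _ ≤ 2 * (3 * ‖h‖ * (ε * m)) := by
          gcongr
          exact sum_abs_inner_le hu hd h
      _ = _ := by ring
  have b2 : |∑ j, R j| ≤ m * (4 * C * ‖h‖ * ‖h‖) := by
    calc |∑ j, R j| ≤ ∑ j, |R j| := Finset.abs_sum_le_sum_abs _ _
      _ ≤ ∑ j, blockSq (frameCoords u A) j ^ 2 * (4 * ‖h‖ ^ 2) := by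
          refine Finset.sum_le_sum fun j _ => ?_
          set b := blockSq (frameCoords u A) j
          have hb : 0 ≤ b := blockSq_nonneg _ _
          have q1 := abs_quad_le A hu j hxp hh
          have q2 := abs_quad_le A hu j hh hkp
          have q3 := abs_quad_le A hu j hh hh
          have q4 := abs_quad_le A hu j hxp hkp
          rw [hxn] at q1 q4
          rw [hkn] at q2 q4
          have h0 := norm_nonneg h
          calc |R j| ≤ 2 * |quad A j x h| * |quad A j h (u k)| +
                |quad A j h h| * (|quad A j x (u k)| + |quad A j h (u k)|) := by
                refine (abs_add_le _ _).trans ?_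
                rw [abs_mul, abs_mul, abs_mul, abs_two]
                gcongr
                exact abs_add_le _ _
            _ ≤ 2 * (b * (1 * ‖h‖)) * (b * (‖h‖ * 1)) +
                (b * (‖h‖ * ‖h‖)) * (b * (1 * 1) + b * (‖h‖ * 1)) := by gcongr
            _ ≤ 2 * (b * (1 * ‖h‖)) * (b * (‖h‖ * 1)) +
                (b * (‖h‖ * ‖h‖)) * (b * (1 * 1) + b * (1 * 1)) := by gcongr
            _ = b ^ 2 * (4 * ‖h‖ ^ 2) := by ring
      _ = (∑ j, blockSq (frameCoords u A) j ^ 2) * (4 * ‖h‖ ^ 2) := by rw [Finset.sum_mul]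
      _ ≤ (C * m) * (4 * ‖h‖ ^ 2) := by
          gcongr
          exact hg.sum_le fun j => pow_le_one_add_pow_six (blockSq_nonneg _ _) (by norm_num)
      _ = _ := by ring
  simp_rw [e1]
  rw [Finset.sum_add_distrib, add_sub_right_comm]
  calc _ ≤ _ := abs_add_le _ _
    _ ≤ m * (6 * ε * ‖h‖) + m * (4 * C * ‖h‖ * ‖h‖) := add_le_add b1 b2
    _ = _ := by ring

/-- The gradient step contracts the error when tested against a vector `t` for which the
contribution of the part orthogonal to the frame is small. -/
lemma gradient_step_inner (hu : Orthonormal ℝ u) (hd : d ≤ 3) (hm : 0 < m)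
    (hg : FrameGood k₀ C (1 / 10 ^ 6) (frameCoords u A)) {h : EuclideanSpace ℝ (Fin n)}
    (hh : perp u h = 0) (hh1 : ‖h‖ ≤ 1) (hCh : C * ‖h‖ ≤ 1 / 10 ^ 6) {μ : ℝ}
    (hμ : μ ∈ Set.Ioo 0.3999 0.4001) (t : EuclideanSpace ℝ (Fin n))
    (ht : |∑ j, (quad A j (u k₀ + h) (u k₀ + h) - quad A j (u k₀) (u k₀)) *
      quad A j (u k₀ + h) (perp u t)| ≤ 1 / 10 ^ 6 * m * (‖h‖ * ‖t‖)) :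
    inner ℝ (h - μ • gradient (loss (toComplexRows A)
      (measurements (toComplexRows A) (u k₀))) (u k₀ + h)) t ≤ 0.61 * ‖h‖ * ‖t‖ := by
  have hm' : (0 : ℝ) < m := by exact_mod_cast hm
  set x := u k₀
  set c : Fin m → ℝ := fun j => quad A j (x + h) (x + h) - quad A j x x
  set G : EuclideanSpace ℝ (Fin n) → ℝ := fun v => ∑ j, c j * quad A j (x + h) v with hG
  have hsplit : G t = ∑ k, inner ℝ (u k) t * G (u k) + G (perp u t) := by
    have : ∀ j, c j * quad A j (x + h) t = ∑ k, inner ℝ (u k) t * (c j * quad A j (x + h) (u k)) +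
        c j * quad A j (x + h) (perp u t) := by
      intro j
      conv_lhs => rw [← proj_add_perp (u := u) t, quad_add_right, proj, quad_sum_right]
      simp only [quad_smul_right, mul_add, Finset.mul_sum]
      congr 1
      exact Finset.sum_congr rfl fun k _ => by ring
    simp only [hG, this]
    rw [Finset.sum_add_distrib, Finset.sum_comm]
    simp only [Finset.mul_sum]
  have hGk : ∀ k, |G (u k) - m * ((if k = k₀ then 4 else 1) * inner ℝ (u k) h)| ≤
      m * (1 / 10 ^ 5 * ‖h‖) := by
    intro k
    refine (gradient_frame_coord hu hd (by norm_num) hg hh hh1 k).trans ?_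
    gcongr
    nlinarith
  set lam : Fin d → ℝ := fun k => if k = k₀ then 4 else 1 with hlam
  set E : Fin d → ℝ := fun k => G (u k) - m * (lam k * inner ℝ (u k) h)
  have hGeq : ∀ k, G (u k) = m * (lam k * inner ℝ (u k) h) + E k := fun k => by simp [E]
  have hmain : inner ℝ (h - μ • gradient (loss (toComplexRows A)
      (measurements (toComplexRows A) x)) (x + h)) t =
      ∑ k, (1 - μ * lam k) * (inner ℝ (u k) h * inner ℝ (u k) t) -
        μ / m * (∑ k, inner ℝ (u k) t * E k) - μ / m * G (perp u t) := by
    rw [inner_sub_left, inner_smul_left, inner_gradient_loss, inner_eq_frame hu h t, hh,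
      inner_zero_left, add_zero]
    change _ - _ * (1 / (m : ℝ) * G t) = _
    rw [hsplit]
    simp only [hGeq, sub_mul, one_mul, Finset.sum_sub_distrib, mul_add, Finset.sum_add_distrib]
    have : ∑ k, inner ℝ (u k) t * (m * (lam k * inner ℝ (u k) h)) =
        m * ∑ k, lam k * (inner ℝ (u k) h * inner ℝ (u k) t) := by
      rw [Finset.mul_sum]
      exact Finset.sum_congr rfl fun k _ => by ring
    rw [this]
    have : ∑ k, μ * lam k * (inner ℝ (u k) h * inner ℝ (u k) t) =
        μ * ∑ k, lam k * (inner ℝ (u k) h * inner ℝ (u k) t) := by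
      rw [Finset.mul_sum]
      exact Finset.sum_congr rfl fun k _ => by ring
    rw [this]
    simp only [conj_trivial]
    field_simp
    ring
  -- The value `μ = 0.4` equalises `|1 - 4 μ|` and `|1 - μ|`; the window around it costs only
  -- `0.0004`.
  have hlamb : ∀ k, |1 - μ * lam k| ≤ 0.6004 := by
    intro k
    obtain ⟨h1, h2⟩ := hμ
    simp only [hlam]
    rw [abs_le]
    split_ifs <;> constructor <;> linarith
  have t1 : ∑ k, (1 - μ * lam k) * (inner ℝ (u k) h * inner ℝ (u k) t) ≤ 0.6004 * (‖h‖ * ‖t‖) := by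
    have hc : ∑ k, |inner ℝ (u k) h| * |inner ℝ (u k) t| ≤ ‖h‖ * ‖t‖ := by
      have hcs := Finset.sum_mul_sq_le_sq_mul_sq Finset.univ (fun k => |inner ℝ (u k) h|)
        (fun k => |inner ℝ (u k) t|)
      simp only [sq_abs] at hcs
      apply le_of_sq_le_sq _ (by positivity)
      rw [mul_pow]
      refine hcs.trans (mul_le_mul (sum_inner_sq_le hu h) (sum_inner_sq_le hu t)
        (Finset.sum_nonneg fun _ _ => sq_nonneg _) (sq_nonneg _))
    calc _ ≤ ∑ k, 0.6004 * (|inner ℝ (u k) h| * |inner ℝ (u k) t|) := by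
          refine Finset.sum_le_sum fun k _ => (le_abs_self _).trans ?_
          rw [abs_mul, abs_mul]
          gcongr
          exact hlamb k
      _ = 0.6004 * ∑ k, |inner ℝ (u k) h| * |inner ℝ (u k) t| := by rw [Finset.mul_sum]
      _ ≤ _ := by gcongr
  have t2 : |∑ k, inner ℝ (u k) t * E k| ≤ m * (3 / 10 ^ 5 * (‖h‖ * ‖t‖)) := by
    calc _ ≤ ∑ k, |inner ℝ (u k) t| * (m * (1 / 10 ^ 5 * ‖h‖)) := by
          refine (Finset.abs_sum_le_sum_abs _ _).trans (Finset.sum_le_sum fun k _ => ?_)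
          rw [abs_mul]
          gcongr
          exact hGk k
      _ ≤ 3 * ‖t‖ * (m * (1 / 10 ^ 5 * ‖h‖)) := by
          rw [← Finset.sum_mul]
          gcongr
          exact sum_abs_inner_le hu hd t
      _ = _ := by ring
  have hμm : 0 < μ / m := div_pos (by linarith [hμ.1]) hm'
  have t3 : μ / m * |∑ k, inner ℝ (u k) t * E k| ≤ μ * (3 / 10 ^ 5 * (‖h‖ * ‖t‖)) := by
    calc _ ≤ μ / m * (m * (3 / 10 ^ 5 * (‖h‖ * ‖t‖))) := by gcongr
      _ = _ := by field_simp
  have t4 : μ / m * |G (perp u t)| ≤ μ * (1 / 10 ^ 6 * (‖h‖ * ‖t‖)) := by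
    calc _ ≤ μ / m * (1 / 10 ^ 6 * m * (‖h‖ * ‖t‖)) := by gcongr
      _ = _ := by field_simp
  have p := mul_nonneg (norm_nonneg h) (norm_nonneg t)
  have t5 : μ * (‖h‖ * ‖t‖) ≤ 0.4001 * (‖h‖ * ‖t‖) := by
    gcongr
    exact hμ.2.le
  have t6 := mul_le_mul_of_nonneg_left (neg_abs_le (∑ k, inner ℝ (u k) t * E k)) hμm.le
  have t7 := mul_le_mul_of_nonneg_left (neg_abs_le (G (perp u t))) hμm.le
  rw [hmain]
  nlinarith

end gradient

section threshold
variable {n : ℕ}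

/-- The restriction of a vector to an index set. -/
def restrict (T : Finset (Fin n)) (v : EuclideanSpace ℝ (Fin n)) : EuclideanSpace ℝ (Fin n) :=
  WithLp.toLp 2 fun i => if i ∈ T then v i else 0

lemma restrict_apply (T : Finset (Fin n)) (v : EuclideanSpace ℝ (Fin n)) (i : Fin n) :
    restrict T v i = if i ∈ T then v i else 0 := rfl

lemma mem_supp {v : EuclideanSpace ℝ (Fin n)} {i : Fin n} : i ∈ supp v ↔ v i ≠ 0 := by
  simp [supp]

lemma supp_restrict_subset (T : Finset (Fin n)) (v : EuclideanSpace ℝ (Fin n)) :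
    supp (restrict T v) ⊆ T := by
  intro i hi
  rw [mem_supp, restrict_apply] at hi
  by_contra h
  simp [h] at hi

lemma norm_sq_eq_sum (v : EuclideanSpace ℝ (Fin n)) : ‖v‖ ^ 2 = ∑ i, v i ^ 2 := by
  simp [EuclideanSpace.norm_sq_eq]

lemma inner_restrict_self (T : Finset (Fin n)) (v : EuclideanSpace ℝ (Fin n)) :
    inner ℝ v (restrict T v) = ‖restrict T v‖ ^ 2 := by
  rw [norm_sq_eq_sum, PiLp.inner_apply]
  refine Finset.sum_congr rfl fun i _ => ?_
  rw [restrict_apply]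
  split_ifs <;> simp [sq]

lemma norm_restrict_sq (T : Finset (Fin n)) (v : EuclideanSpace ℝ (Fin n)) :
    ‖restrict T v‖ ^ 2 = ∑ i ∈ T, v i ^ 2 := by
  rw [norm_sq_eq_sum]
  simp only [restrict_apply, ite_pow]
  simp

/-- Hard thresholding error bound: the constant `2.62` exceeds the square of the golden ratio. -/
lemma hardThreshold_error {s : ℕ} {v w x : EuclideanSpace ℝ (Fin n)} {S : Finset (Fin n)}
    (hS : S.card = s) (htop : ∀ i ∈ S, ∀ j ∉ S, |v j| ≤ |v i|)
    (hw : ∀ i, w i = if i ∈ S then v i else 0) (hx : IsSparse s x) :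
    ‖w - x‖ ^ 2 ≤ 2.62 * ‖restrict (S ∪ supp x) (v - x)‖ ^ 2 := by
  classical
  set Y := supp x with hY
  set P := Y \ S
  set Q := S \ Y
  -- Since `|Y| ≤ |S|`, at most as many indices are wrongly dropped (`P`) as wrongly kept (`Q`).
  -- Kept entries are larger, so the dropped mass of `v` is at most its mass on `Q`, which is pure
  -- error because `x` vanishes there.
  have hcard : P.card ≤ Q.card := by
    have h1 : Y.card ≤ S.card := hS ▸ hx
    exact Finset.card_sdiff_le_card_sdiff_iff.2 h1
  have hxY : ∀ i ∉ Y, x i = 0 := fun i hi => by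
    by_contra h
    exact hi (mem_supp.2 h)
  have hPQ : ∑ i ∈ P, v i ^ 2 ≤ ∑ i ∈ Q, v i ^ 2 := by
    rcases Q.eq_empty_or_nonempty with hQ | hQ
    · have : P = ∅ := Finset.card_eq_zero.1 (Nat.le_zero.1 (by simpa [hQ] using hcard))
      simp [this, hQ]
    · obtain ⟨q, hq, hmin⟩ := Finset.exists_min_image Q (fun i => |v i|) hQ
      have hqS : q ∈ S := (Finset.mem_sdiff.1 hq).1
      calc ∑ i ∈ P, v i ^ 2 ≤ ∑ _i ∈ P, v q ^ 2 := Finset.sum_le_sum fun i hi =>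
            sq_le_sq.2 (htop q hqS i (Finset.mem_sdiff.1 hi).2)
        _ = P.card * v q ^ 2 := by simp
        _ ≤ Q.card * v q ^ 2 := by gcongr
        _ = ∑ _i ∈ Q, v q ^ 2 := by simp
        _ ≤ ∑ i ∈ Q, v i ^ 2 := Finset.sum_le_sum fun i hi => sq_le_sq.2 (hmin i hi)
  have hU : S ∪ Y = S ∪ P := by simp [P]
  have hdisj : Disjoint S P := Finset.disjoint_sdiff
  have hleft : ‖w - x‖ ^ 2 = ∑ i ∈ S, (v i - x i) ^ 2 + ∑ i ∈ P, x i ^ 2 := by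
    rw [norm_sq_eq_sum, ← Finset.sum_subset (Finset.subset_univ (S ∪ P)),
      Finset.sum_union hdisj]
    · congr 1
      · refine Finset.sum_congr rfl fun i hi => ?_
        simp [hw, hi]
      · refine Finset.sum_congr rfl fun i hi => ?_
        simp [hw, (Finset.mem_sdiff.1 hi).2]
    · intro i _ hi
      rw [← hU, Finset.mem_union, not_or] at hi
      simp [hw, hi.1, hxY i hi.2]
  have hright : ‖restrict (S ∪ Y) (v - x)‖ ^ 2 =
      ∑ i ∈ S, (v i - x i) ^ 2 + ∑ i ∈ P, (v i - x i) ^ 2 := by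
    rw [norm_restrict_sq, hU, Finset.sum_union hdisj]
    rfl
  have hSQ : ∑ i ∈ Q, v i ^ 2 ≤ ∑ i ∈ S, (v i - x i) ^ 2 := by
    calc ∑ i ∈ Q, v i ^ 2 = ∑ i ∈ Q, (v i - x i) ^ 2 := Finset.sum_congr rfl fun i hi => by
          rw [hxY i (Finset.mem_sdiff.1 hi).2, sub_zero]
      _ ≤ _ := Finset.sum_le_sum_of_subset_of_nonneg Finset.sdiff_subset
          fun _ _ _ => sq_nonneg _
  rw [hleft, hright]
  set a := ∑ i ∈ S, (v i - x i) ^ 2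
  -- Young's inequality with weight near the inverse golden ratio. It balances the coefficients of
  -- the two error sums: `1 + 1.618` on `S` and `1 + 1 / 0.618` on `P`, both below `2.62`.
  have hpx : ∑ i ∈ P, x i ^ 2 ≤ (1 + 0.618) * ∑ i ∈ P, v i ^ 2 +
      (1 + 1 / 0.618) * ∑ i ∈ P, (v i - x i) ^ 2 := by
    rw [Finset.mul_sum, Finset.mul_sum, ← Finset.sum_add_distrib]
    refine Finset.sum_le_sum fun i _ => ?_
    have := sq_nonneg (0.618 * v i + (v i - x i))
    norm_num
    nlinarith
  have h1 : 0 ≤ ∑ i ∈ P, (v i - x i) ^ 2 := Finset.sum_nonneg fun _ _ => sq_nonneg _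
  have h2 : 0 ≤ a := Finset.sum_nonneg fun _ _ => sq_nonneg _
  norm_num at hpx ⊢
  nlinarith

end threshold

end GraHTP

/-! ### Restricted isometry on the light rows and the Gauss–Newton error. -/

namespace GraHTP

section light
variable {n m d : ℕ} {u : Fin d → EuclideanSpace ℝ (Fin n)} {k₀ : Fin d} {C K : ℝ}
  {A : (Fin m × Fin 2) × Fin n → ℝ}

/-- Indicator of the rows whose projections to the frame are bounded by `√K`. -/
noncomputable def lightInd (K : ℝ) (X : (Fin m × Fin 2) × Fin d → ℝ) (j : Fin m) : ℝ :=
  if blockSq X j ≤ K then 1 else 0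

lemma lightInd_eq_zero_or_one (K : ℝ) (X : (Fin m × Fin 2) × Fin d → ℝ) (j : Fin m) :
    lightInd K X j = 0 ∨ lightInd K X j = 1 := by
  unfold lightInd; split_ifs <;> simp

/-- Concentration of the light rows in the directions that are not in the frame. -/
structure LightGood (u : Fin d → EuclideanSpace ℝ (Fin n)) (w : EuclideanSpace ℝ (Fin n))
    (K η : ℝ) (s : ℕ) (A : (Fin m × Fin 2) × Fin n → ℝ) : Prop where
  cross : ∀ k v, (supp v).card ≤ 2 * s → |∑ j, lightInd K (frameCoords u A) j *
    (quad A j w (u k) * quad A j w (perp u v))| ≤ η * m * ‖v‖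
  orth : ∀ (T : Finset (Fin n)), T.card ≤ 2 * s → ∀ v v', supp v ⊆ T → supp v' ⊆ T →
    |∑ j, lightInd K (frameCoords u A) j * (quad A j w (perp u v) * quad A j w (perp u v')) -
      1 / 2 * (∑ j, lightInd K (frameCoords u A) j * quad A j w w) *
        inner ℝ (perp u v) (perp u v')| ≤ η * m * (‖v‖ * ‖v'‖)

/-- Truncation and perturbation cost is measured row by row against `(1 + b)⁶`. A light row only
pays the perturbation `3 e`; a heavy row loses `a₀`, but `b > K` allows one extra power of `b` to be
traded for the factor `1 / K`. -/
lemma light_perturbation (hK : 1 ≤ K) {b a a₀ e : ℝ} {χ : ℝ} (hb : 0 ≤ b) (he : 0 ≤ e)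
    (hχ : χ = if b ≤ K then 1 else 0) {k : ℕ} (hk : k + 1 ≤ 6) (h0 : |a₀| ≤ b ^ k)
    (h : |a - a₀| ≤ 3 * e * b ^ k) : |χ * a - a₀| ≤ (1 + b) ^ 6 * (3 * e + 1 / K) := by
  have hK0 : 0 < K := by linarith
  have h1 := pow_le_one_add_pow_six hb (k := k) (by omega)
  have h2 := pow_le_one_add_pow_six hb hk
  split_ifs at hχ with hbK
  · rw [hχ, one_mul]
    calc |a - a₀| ≤ 3 * e * b ^ k := h
      _ ≤ 3 * e * (1 + b) ^ 6 := by gcongr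
      _ ≤ (1 + b) ^ 6 * (3 * e + 1 / K) := by
          have : 0 ≤ (1 + b) ^ 6 * (1 / K) := by positivity
          linarith
  · rw [hχ, zero_mul, zero_sub, abs_neg]
    push Not at hbK
    calc |a₀| ≤ b ^ k := h0
      _ ≤ b ^ k * (b / K) := le_mul_of_one_le_right (by positivity) ((one_le_div hK0).2 hbK.le)
      _ = b ^ (k + 1) * (1 / K) := by ring
      _ ≤ (1 + b) ^ 6 * (1 / K) := by gcongr
      _ ≤ (1 + b) ^ 6 * (3 * e + 1 / K) := by gcongr; linarith

lemma FrameGood.light_sum {ε : ℝ} {X : (Fin m × Fin 2) × Fin d → ℝ} (hg : FrameGood k₀ C ε X)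
    {f f₀ : Fin m → ℝ} {c : ℝ} (hc : 0 ≤ c)
    (h : ∀ j, |f j - f₀ j| ≤ (1 + blockSq X j) ^ 6 * c) :
    |∑ j, f j - ∑ j, f₀ j| ≤ C * m * c := by
  rw [← Finset.sum_sub_distrib]
  refine (Finset.abs_sum_le_sum_abs _ _).trans ((Finset.sum_le_sum fun j _ => h j).trans ?_)
  rw [← Finset.sum_mul]
  gcongr
  exact hg.moment

lemma light_error_small {c : ℝ} (hC : 1 ≤ C) (hK : 10 ^ 6 * C ≤ K) (hc : C * c ≤ 1 / 10 ^ 6) :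
    C * m * (3 * c + 1 / K) ≤ 4 / 10 ^ 6 * m := by
  have : C * (1 / K) ≤ 1 / 10 ^ 6 := by
    rw [mul_one_div, div_le_div_iff₀ (by linarith) (by norm_num)]
    linarith
  have : C * (3 * c + 1 / K) ≤ 4 / 10 ^ 6 := by linarith
  calc _ = m * (C * (3 * c + 1 / K)) := by ring
    _ ≤ m * (4 / 10 ^ 6) := by gcongr
    _ = _ := by ring

/-- Moving from `x` to `w` and discarding the heavy rows changes the empirical covariance by at most
`4 / 10⁶`, because `C ‖x - w‖` and `C / K` are both at most `1 / 10⁶`; the law of large numbers for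
`x` adds the last `1 / 10⁶`. -/
lemma light_frame_cov (hu : Orthonormal ℝ u) (hC : 1 ≤ C) (hK : 10 ^ 6 * C ≤ K)
    (hg : FrameGood k₀ C (1 / 10 ^ 6) (frameCoords u A)) {w : EuclideanSpace ℝ (Fin n)}
    (hw : perp u w = 0) (hCe : C * ‖u k₀ - w‖ ≤ 1 / 10 ^ 6) (k l : Fin d) :
    |∑ j, lightInd K (frameCoords u A) j * (quad A j w (u k) * quad A j w (u l)) -
      m * (if k = l then (if k = k₀ then 2 else 1 / 2) else 0)| ≤ 5 / 10 ^ 6 * m := by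
  set x := u k₀ with hx
  set e := x - w with he
  have hxp : perp u x = 0 := perp_frame hu k₀
  have hep : perp u e = 0 := by rw [he, perp_sub, hxp, hw, sub_zero]
  have hxn : ‖x‖ = 1 := hu.1 k₀
  have he0 := norm_nonneg e
  have he1 : ‖e‖ ≤ 1 := by nlinarith
  have hK1 : 1 ≤ K := by linarith
  have hwe : w = x - e := by simp [he]
  set X := frameCoords u A with hX
  set χ := lightInd K X with hχ
  have hsmall := light_error_small (m := m) hC hK hCe
  have h1 := hg.light_sum (f := fun j => χ j * (quad A j w (u k) * quad A j w (u l)))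
    (f₀ := fun j => quad A j x (u k) * quad A j x (u l)) (c := 3 * ‖e‖ + 1 / K)
    (by positivity) (fun j => by
      set b := blockSq X j with hb
      have hb0 : 0 ≤ b := blockSq_nonneg _ _
      have q : ∀ a : EuclideanSpace ℝ (Fin n), perp u a = 0 → ∀ k, |quad A j a (u k)| ≤ b * ‖a‖ :=
        fun a ha k => by
          have := abs_quad_le A hu j ha (perp_frame hu k)
          rwa [hu.1 k, mul_one] at this
      have qx := fun k => q x hxp k
      rw [hxn, mul_one] at qx
      refine light_perturbation hK1 hb0 he0 rfl (k := 2) (by norm_num) ?_ ?_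
      · rw [abs_mul, sq]
        exact mul_le_mul (qx k) (qx l) (abs_nonneg _) hb0
      · rw [hwe]
        simp only [quad_sub_left]
        have : (quad A j x (u k) - quad A j e (u k)) * (quad A j x (u l) - quad A j e (u l)) -
            quad A j x (u k) * quad A j x (u l) = -(quad A j e (u k) * quad A j x (u l)) -
            quad A j x (u k) * quad A j e (u l) + quad A j e (u k) * quad A j e (u l) := by ring
        rw [this]
        have a1 : |quad A j e (u k) * quad A j x (u l)| ≤ (b * ‖e‖) * b := by
          rw [abs_mul]; exact mul_le_mul (q e hep k) (qx l) (abs_nonneg _) (by positivity)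
        have a2 : |quad A j x (u k) * quad A j e (u l)| ≤ b * (b * ‖e‖) := by
          rw [abs_mul]; exact mul_le_mul (qx k) (q e hep l) (abs_nonneg _) hb0
        have a3 : |quad A j e (u k) * quad A j e (u l)| ≤ (b * ‖e‖) * (b * 1) := by
          rw [abs_mul]
          exact mul_le_mul (q e hep k) ((q e hep l).trans (by gcongr)) (abs_nonneg _)
            (by positivity)
        rw [abs_le] at *
        constructor <;> nlinarith)
  have h2 := hg.cov_quad k l
  have := (abs_sub_le _ (∑ j, quad A j x (u k) * quad A j x (u l))
    (m * (if k = l then (if k = k₀ then 2 else 1 / 2) else 0))).trans (add_le_add h1 h2)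
  refine this.trans ?_
  linarith

lemma light_energy (hu : Orthonormal ℝ u) (hC : 1 ≤ C) (hK : 10 ^ 6 * C ≤ K)
    (hg : FrameGood k₀ C (1 / 10 ^ 6) (frameCoords u A)) {w : EuclideanSpace ℝ (Fin n)}
    (hw : perp u w = 0) (hCe : C * ‖u k₀ - w‖ ≤ 1 / 10 ^ 6) :
    |∑ j, lightInd K (frameCoords u A) j * quad A j w w - m| ≤ 5 / 10 ^ 6 * m := by
  set x := u k₀ with hx
  set e := x - w with he
  have hxp : perp u x = 0 := perp_frame hu k₀
  have hep : perp u e = 0 := by rw [he, perp_sub, hxp, hw, sub_zero]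
  have hxn : ‖x‖ = 1 := hu.1 k₀
  have he0 := norm_nonneg e
  have he1 : ‖e‖ ≤ 1 := by nlinarith
  have hK1 : 1 ≤ K := by linarith
  have hwe : w = x - e := by simp [he]
  set X := frameCoords u A with hX
  set χ := lightInd K X with hχ
  have hsmall := light_error_small (m := m) hC hK hCe
  have h1 := hg.light_sum (f := fun j => χ j * quad A j w w)
    (f₀ := fun j => quad A j x x) (c := 3 * ‖e‖ + 1 / K)
    (by positivity) (fun j => by
      set b := blockSq X j with hb
      have hb0 : 0 ≤ b := blockSq_nonneg _ _
      have q1 := abs_quad_le A hu j hxp hxp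
      have q2 := abs_quad_le A hu j hxp hep
      have q3 := abs_quad_le A hu j hep hep
      rw [hxn] at q1 q2
      refine light_perturbation hK1 hb0 he0 rfl (k := 1) (by norm_num) ?_ ?_
      · simpa using q1
      · rw [hwe]
        simp only [quad_sub_left, quad_sub_right, quad_comm A j e x]
        have h3 : b * (‖e‖ * ‖e‖) ≤ b * (‖e‖ * 1) := by gcongr
        change |quad A j e e| ≤ b * _ at q3
        change |quad A j x e| ≤ b * _ at q2
        rw [abs_le] at *
        constructor <;> nlinarith)
  have h2 := hg.energy_quad
  have := (abs_sub_le _ (∑ j, quad A j x x) (m : ℝ)).trans (add_le_add h1 h2)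
  refine this.trans ?_
  linarith

lemma sum_bilinear {κ ι : Type*} [Fintype κ] [Fintype ι] (χ : ι → ℝ) (a b : κ → ℝ)
    (p : ι → κ → ℝ) :
    ∑ k, ∑ l, a k * b l * ∑ j, χ j * (p j k * p j l) =
      ∑ j, χ j * ((∑ k, a k * p j k) * ∑ l, b l * p j l) := by
  simp_rw [Finset.sum_mul_sum, Finset.mul_sum]
  rw [Finset.sum_comm' (s' := fun _ => Finset.univ) (t' := Finset.univ) (by simp)]
  conv_lhs => enter [2, l]; rw [Finset.sum_comm]
  rw [Finset.sum_comm]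
  refine Finset.sum_congr rfl fun j _ => ?_
  rw [Finset.sum_comm]
  exact Finset.sum_congr rfl fun k _ => Finset.sum_congr rfl fun l _ => by ring

/-- Restricted isometry of the light rows of the Gauss-Newton matrix. -/
lemma light_rip {s : ℕ} (hu : Orthonormal ℝ u) (hd : d ≤ 3) (hC : 1 ≤ C) (hK : 10 ^ 6 * C ≤ K)
    (hg : FrameGood k₀ C (1 / 10 ^ 6) (frameCoords u A)) {w : EuclideanSpace ℝ (Fin n)}
    (hw : perp u w = 0) (hCe : C * ‖u k₀ - w‖ ≤ 1 / 10 ^ 6)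
    (hL : LightGood u w K (1 / 10 ^ 6) s A) {T : Finset (Fin n)} (hT : T.card ≤ 2 * s)
    {v v' : EuclideanSpace ℝ (Fin n)} (hv : supp v ⊆ T) (hv' : supp v' ⊆ T) :
    |∑ j, lightInd K (frameCoords u A) j * (quad A j w v * quad A j w v') -
      m * (1 / 2 * inner ℝ v v' + 3 / 2 * (inner ℝ (u k₀) v * inner ℝ (u k₀) v'))| ≤
      1 / 10 ^ 4 * m * (‖v‖ * ‖v'‖) := by
  have hm0 : (0 : ℝ) ≤ m := Nat.cast_nonneg m
  have hEE := light_frame_cov hu hC hK hg hw hCe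
  have hτ := light_energy hu hC hK hg hw hCe
  set x := u k₀ with hx
  set X := frameCoords u A with hX
  set χ := lightInd K X with hχ
  set a : Fin d → ℝ := fun k => inner ℝ (u k) v with ha
  set a' : Fin d → ℝ := fun k => inner ℝ (u k) v' with ha'
  have sa : ∑ k, |a k| ≤ 3 * ‖v‖ := sum_abs_inner_le hu hd v
  have sa' : ∑ k, |a' k| ≤ 3 * ‖v'‖ := sum_abs_inner_le hu hd v'
  have qexp : ∀ j (v : EuclideanSpace ℝ (Fin n)), quad A j w v =
      ∑ k, inner ℝ (u k) v * quad A j w (u k) + quad A j w (perp u v) := by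
    intro j v
    conv_lhs => rw [← proj_add_perp (u := u) v, quad_add_right, proj, quad_sum_right]
    simp only [quad_smul_right]
  -- Four terms: frame–frame, governed by the law of large numbers; two cross terms, governed by
  -- `cross`; and orthogonal–orthogonal, governed by `orth`.
  have hexp : ∑ j, χ j * (quad A j w v * quad A j w v') =
      ∑ k, ∑ l, a k * a' l * ∑ j, χ j * (quad A j w (u k) * quad A j w (u l)) +
      ∑ k, a k * ∑ j, χ j * (quad A j w (u k) * quad A j w (perp u v')) +
      ∑ k, a' k * ∑ j, χ j * (quad A j w (u k) * quad A j w (perp u v)) +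
      ∑ j, χ j * (quad A j w (perp u v) * quad A j w (perp u v')) := by
    have e1 := sum_bilinear χ a a' fun j k => quad A j w (u k)
    have e2 : ∀ (a : Fin d → ℝ) (y : EuclideanSpace ℝ (Fin n)),
        ∑ k, a k * ∑ j, χ j * (quad A j w (u k) * quad A j w y) =
        ∑ j, χ j * ((∑ k, a k * quad A j w (u k)) * quad A j w y) := by
      intro a y
      simp only [Finset.sum_mul, Finset.mul_sum]
      rw [Finset.sum_comm]
      refine Finset.sum_congr rfl fun k _ => Finset.sum_congr rfl fun j _ => by ring
    rw [e1, e2, e2, ← Finset.sum_add_distrib, ← Finset.sum_add_distrib, ← Finset.sum_add_distrib]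
    refine Finset.sum_congr rfl fun j _ => ?_
    rw [qexp j v, qexp j v']
    ring
  have hinner : inner ℝ v v' = ∑ k, a k * a' k + inner ℝ (perp u v) (perp u v') :=
    inner_eq_frame hu v v'
  have hdiag : ∑ k, ∑ l, a k * a' l * (m * (if k = l then (if k = k₀ then 2 else 1 / 2) else 0)) =
      m * (1 / 2 * ∑ k, a k * a' k + 3 / 2 * (a k₀ * a' k₀)) := by
    have : ∀ k, ∑ l, a k * a' l * (m * (if k = l then (if k = k₀ then 2 else 1 / 2) else 0)) =
        m * (1 / 2 * (a k * a' k)) + if k = k₀ then m * (3 / 2 * (a k * a' k)) else 0 := by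
      intro k
      rw [Finset.sum_eq_single k (fun l _ hl => by simp [Ne.symm hl]) (by simp), if_pos rfl]
      split_ifs <;> ring
    simp_rw [this]
    rw [Finset.sum_add_distrib, Finset.sum_ite_eq' Finset.univ k₀, if_pos (Finset.mem_univ _),
      ← Finset.mul_sum, ← Finset.mul_sum]
    ring
  have c1 : |∑ k, ∑ l, a k * a' l * ∑ j, χ j * (quad A j w (u k) * quad A j w (u l)) -
      m * (1 / 2 * ∑ k, a k * a' k + 3 / 2 * (a k₀ * a' k₀))| ≤
      45 / 10 ^ 6 * m * (‖v‖ * ‖v'‖) := by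
    rw [← hdiag, ← Finset.sum_sub_distrib]
    simp_rw [← Finset.sum_sub_distrib, ← mul_sub]
    calc _ ≤ ∑ k, ∑ l, |a k| * |a' l| * (5 / 10 ^ 6 * m) := by
          refine (Finset.abs_sum_le_sum_abs _ _).trans (Finset.sum_le_sum fun k _ =>
            (Finset.abs_sum_le_sum_abs _ _).trans (Finset.sum_le_sum fun l _ => ?_))
          rw [abs_mul, abs_mul]
          gcongr
          exact hEE k l
      _ = (∑ k, |a k|) * (∑ l, |a' l|) * (5 / 10 ^ 6 * m) := by
          rw [Finset.sum_mul_sum, Finset.sum_mul]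
          refine Finset.sum_congr rfl fun k _ => ?_
          rw [Finset.sum_mul]
      _ ≤ (3 * ‖v‖) * (3 * ‖v'‖) * (5 / 10 ^ 6 * m) := by gcongr
      _ = _ := by ring
  have cross : ∀ (a : Fin d → ℝ) (y y' : EuclideanSpace ℝ (Fin n)), ∑ k, |a k| ≤ 3 * ‖y‖ →
      supp y' ⊆ T → |∑ k, a k * ∑ j, χ j * (quad A j w (u k) * quad A j w (perp u y'))| ≤
      3 / 10 ^ 6 * m * (‖y‖ * ‖y'‖) := by
    intro a y y' hay hy'
    calc _ ≤ ∑ k, |a k| * (1 / 10 ^ 6 * m * ‖y'‖) := by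
          refine (Finset.abs_sum_le_sum_abs _ _).trans (Finset.sum_le_sum fun k _ => ?_)
          rw [abs_mul]
          gcongr
          exact hL.cross k y' ((Finset.card_le_card hy').trans hT)
      _ ≤ (3 * ‖y‖) * (1 / 10 ^ 6 * m * ‖y'‖) := by
          rw [← Finset.sum_mul]; gcongr
      _ = _ := by ring
  have c2 := cross a v v' sa hv'
  have c3 := cross a' v' v sa' hv
  have c4 := hL.orth T hT v v' hv hv'
  have c5 : |1 / 2 * (∑ j, χ j * quad A j w w) * inner ℝ (perp u v) (perp u v') -
      m * (1 / 2 * inner ℝ (perp u v) (perp u v'))| ≤ 3 / 10 ^ 6 * m * (‖v‖ * ‖v'‖) := by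
    have : 1 / 2 * (∑ j, χ j * quad A j w w) * inner ℝ (perp u v) (perp u v') -
      m * (1 / 2 * inner ℝ (perp u v) (perp u v')) =
      1 / 2 * (∑ j, χ j * quad A j w w - m) * inner ℝ (perp u v) (perp u v') := by ring
    rw [this, abs_mul, abs_mul, abs_of_pos (by norm_num : (0 : ℝ) < 1 / 2)]
    calc _ ≤ 1 / 2 * (5 / 10 ^ 6 * m) * (‖v‖ * ‖v'‖) := by
          gcongr
          exact (abs_real_inner_le_norm _ _).trans
            (mul_le_mul (norm_perp_le hu v) (norm_perp_le hu v') (norm_nonneg _) (norm_nonneg _))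
      _ ≤ _ := by
          have : 0 ≤ m * (‖v‖ * ‖v'‖) := by positivity
          linarith
  -- The errors add up to `(45 + 3 + 3 + 1 + 3) / 10⁶`, within the claimed `1 / 10⁴`.
  rw [hexp, hinner]
  have p : 0 ≤ m * (‖v‖ * ‖v'‖) := by positivity
  rw [abs_le] at *
  constructor <;> linarith [c1.1, c1.2, c2.1, c2.2, c3.1, c3.2, c4.1, c4.2, c5.1, c5.2]

end light

section gaussNewton
variable {n m d : ℕ} {u : Fin d → EuclideanSpace ℝ (Fin n)} {k₀ : Fin d} {C K : ℝ}
  {A : (Fin m × Fin 2) × Fin n → ℝ}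

/-- First-order optimality without derivatives: test with `t = P / (Q + 1)`, where the `+ 1` covers
`Q = 0`. -/
lemma first_order_opt {P Q : ℝ} (hQ : 0 ≤ Q) (h : ∀ t : ℝ, 2 * t * P ≤ t ^ 2 * Q) : P ≤ 0 := by
  by_contra hP
  push Not at hP
  have := h (P / (Q + 1))
  have hQ1 : 0 < Q + 1 := by linarith
  rw [div_pow, ← sub_nonneg] at this
  have h2 : (P ^ 2 / (Q + 1) ^ 2 * Q - 2 * (P / (Q + 1)) * P) * (Q + 1) ^ 2 =
      P ^ 2 * Q - 2 * P ^ 2 * (Q + 1) := by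
    field_simp
  have h3 := mul_nonneg this (sq_nonneg (Q + 1))
  rw [h2] at h3
  nlinarith [mul_pos hP hP]

/-- Normal equations of a Gauss-Newton step, tested against the error on the index set. -/
lemma gaussNewton_normal (hm : 0 < m) {S : Finset (Fin n)} {x w z' : EuclideanSpace ℝ (Fin n)}
    (h : IsGaussNewtonStep (toComplexRows A) (measurements (toComplexRows A) x) S w z') :
    ∑ j, quad A j w (z' - restrict S x) * (quad A j w (z' - restrict S x) -
      (quad A j w (x - restrict S x) + 1 / 2 * quad A j (x - w) (x - w))) ≤ 0 := by
  have hm' : (0 : ℝ) < m := by exact_mod_cast hm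
  set dd := z' - restrict S x with hdd
  set p : Fin m → ℝ := fun j => quad A j w dd
  set r : Fin m → ℝ := fun j =>
    quad A j w (x - restrict S x) + 1 / 2 * quad A j (x - w) (x - w)
  -- Taylor expansion at `w` is exact up to the quadratic term: the linearised residual at `v` is
  -- `⟨w, v - x⟩ - (1/2)⟨x - w, x - w⟩` in the form `quad`, up to the factor `1 / √m`. Splitting `z'
  -- - x` into its part `dd` on `S` and the missed part of `x` gives `p - r`.
  have entry : ∀ t : ℝ, ∀ j, (jacobian (toComplexRows A) w).mulVec
      (z' - t • dd - w).ofLp j + resid (toComplexRows A) (measurements (toComplexRows A) x) w j =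
      1 / √m * ((1 - t) * p j - r j) := by
    intro t j
    rw [jacobian_mulVec, resid_eq]
    have : z' = dd + restrict S x := by simp [hdd]
    rw [this]
    simp only [p, r, quad_sub_right, quad_sub_left, quad_add_right, quad_smul_right,
      quad_comm A j w x]
    have h2 : 1 / (2 * √(m : ℝ)) = 1 / √m * (1 / 2) := by ring
    rw [h2]
    ring
  refine first_order_opt (Q := ∑ j, p j ^ 2) (Finset.sum_nonneg fun _ _ => sq_nonneg _) fun t => ?_
  have hsupp : supp (z' - t • dd) ⊆ S := by
    intro i hi
    by_contra hiS
    rw [mem_supp] at hi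
    have h1 : z' i = 0 := by
      by_contra h0
      exact hiS (h.1 (mem_supp.2 h0))
    have h2 : restrict S x i = 0 := by simp [restrict_apply, hiS]
    apply hi
    simp [hdd, h1, h2]
  have key := h.2 (z' - t • dd) hsupp
  have e0 := entry 0
  simp only [zero_smul, sub_zero, one_mul] at e0
  simp only [entry, e0, mul_pow, ← Finset.mul_sum] at key
  have hpos : 0 < (1 / √(m : ℝ)) ^ 2 := by positivity
  have key2 := le_of_mul_le_mul_left key hpos
  have hexp : ∑ j, ((1 - t) * p j - r j) ^ 2 =
      ∑ j, (p j - r j) ^ 2 - 2 * t * ∑ j, p j * (p j - r j) + t ^ 2 * ∑ j, p j ^ 2 := by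
    simp only [Finset.mul_sum]
    rw [← Finset.sum_sub_distrib, ← Finset.sum_add_distrib]
    exact Finset.sum_congr rfl fun j _ => by ring
  rw [hexp] at key2
  change 2 * t * ∑ j, p j * (p j - r j) ≤ _
  linarith

set_option maxHeartbeats 1000000 in
/-- Error bound for a Gauss-Newton step on a given index set. -/
lemma gaussNewton_error {s : ℕ} (hu : Orthonormal ℝ u) (hd : d ≤ 3) (hm : 0 < m) (hC : 1 ≤ C)
    (hK : 10 ^ 6 * C ≤ K) (hg : FrameGood k₀ C (1 / 10 ^ 6) (frameCoords u A))
    {w : EuclideanSpace ℝ (Fin n)} (hw : perp u w = 0) (hCe : C * ‖u k₀ - w‖ ≤ 1 / 10 ^ 6)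
    (hL : LightGood u w K (1 / 10 ^ 6) s A) {S : Finset (Fin n)} (hS : S.card ≤ s)
    (hx : IsSparse s (u k₀)) (hwS : supp w ⊆ S)
    (hheavy : ∑ j, (1 - lightInd K (frameCoords u A) j) *
      quad A j w (u k₀ - restrict S (u k₀)) ^ 2 ≤
      1 / 10 ^ 4 * m * ‖u k₀ - restrict S (u k₀)‖ ^ 2) {z' : EuclideanSpace ℝ (Fin n)}
    (h : IsGaussNewtonStep (toComplexRows A) (measurements (toComplexRows A) (u k₀)) S w z') :
    ‖z' - u k₀‖ ^ 2 ≤ 1.01 * ‖u k₀ - restrict S (u k₀)‖ ^ 2 + 2 * C * ‖u k₀ - w‖ ^ 4 := by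
  have hm' : (0 : ℝ) < m := by exact_mod_cast hm
  set x := u k₀ with hx0
  set y := x - restrict S x with hy
  set e := x - w with he
  set dd := z' - restrict S x with hdd
  set χ := lightInd K (frameCoords u A) with hχ
  have hyi : ∀ i, y i = if i ∈ S then 0 else x i := by
    intro i
    simp only [hy, PiLp.sub_apply, restrict_apply]
    split_ifs <;> simp
  have hdi : ∀ i ∉ S, dd i = 0 := by
    intro i hi
    have h1 : z' i = 0 := by
      by_contra h0
      exact hi (h.1 (mem_supp.2 h0))
    simp [hdd, restrict_apply, hi, h1]
  have hwi : ∀ i ∉ S, w i = 0 := by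
    intro i hi
    by_contra h0
    exact hi (hwS (mem_supp.2 h0))
  have orth : ∀ v : EuclideanSpace ℝ (Fin n), (∀ i ∉ S, v i = 0) → inner ℝ v y = 0 := by
    intro v hv
    rw [PiLp.inner_apply]
    refine Finset.sum_eq_zero fun i _ => ?_
    rw [hyi]
    by_cases hi : i ∈ S <;> simp [hi, hv]
  -- The vectors `dd` and `w` live on `S`, and `y` lives off `S`.
  have hdy : inner ℝ dd y = 0 := orth dd hdi
  have hwy : inner ℝ w y = 0 := orth w hwi
  have hT : (S ∪ supp x).card ≤ 2 * s := by
    have := Finset.card_union_le S (supp x)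
    have h2 : (supp x).card ≤ s := hx
    omega
  have hdT : supp dd ⊆ S ∪ supp x := by
    intro i hi
    by_contra hc
    rw [Finset.mem_union, not_or] at hc
    exact mem_supp.1 hi (hdi i hc.1)
  have hyT : supp y ⊆ S ∪ supp x := by
    intro i hi
    by_contra hc
    rw [Finset.mem_union, not_or] at hc
    refine mem_supp.1 hi ?_
    rw [hyi, if_neg hc.1]
    by_contra h0
    exact hc.2 (mem_supp.2 h0)
  have rip1 := light_rip hu hd hC hK hg hw hCe hL hT hdT hdT
  have rip2 := light_rip hu hd hC hK hg hw hCe hL hT hdT hyT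
  rw [hdy] at rip2
  rw [real_inner_self_eq_norm_sq] at rip1
  have hxn : ‖x‖ = 1 := hu.1 k₀
  have hxy : inner ℝ x y = inner ℝ e y := by rw [he, inner_sub_left, hwy, sub_zero]
  have hep : perp u e = 0 := by rw [he, perp_sub, perp_frame hu, hw, sub_zero]
  have hqe : ∑ j, quad A j e e ^ 2 ≤ C * m * ‖e‖ ^ 4 := by
    calc ∑ j, quad A j e e ^ 2 ≤ ∑ j, blockSq (frameCoords u A) j ^ 2 * ‖e‖ ^ 4 := by
          refine Finset.sum_le_sum fun j _ => ?_
          have h1 := quad_self_le A hu j hep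
          have h2 := quad_self_nonneg A j e
          calc quad A j e e ^ 2 ≤ (blockSq (frameCoords u A) j * ‖e‖ ^ 2) ^ 2 := by gcongr
            _ = _ := by ring
      _ ≤ C * m * ‖e‖ ^ 4 := by
          rw [← Finset.sum_mul]
          gcongr
          exact hg.sum_le fun j => pow_le_one_add_pow_six (blockSq_nonneg _ _) (by norm_num)
  have normal := gaussNewton_normal hm h
  -- Light rows keep their quadratic term in `dd`, apart from a quarter spent on the remainder. On
  -- heavy rows the square in `dd` is completed and dropped, so no upper bound involving `dd` is
  -- needed there; what remains is their action on `y`, assumed small in `hheavy`, and the remainder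
  -- `quad A j e e`.
  have pointwise : ∀ j, 3 / 4 * (χ j * (quad A j w dd * quad A j w dd)) -
      χ j * (quad A j w dd * quad A j w y) - 1 / 2 * ((1 - χ j) * quad A j w y ^ 2) -
      1 / 4 * quad A j e e ^ 2 ≤
      quad A j w dd * (quad A j w dd - (quad A j w y + 1 / 2 * quad A j e e)) := by
    intro j
    rcases lightInd_eq_zero_or_one K (frameCoords u A) j with h0 | h0 <;>
    simp only [hχ, h0]
    · nlinarith [sq_nonneg (2 * quad A j w dd - (quad A j w y + 1 / 2 * quad A j e e)),
        sq_nonneg (quad A j w y - 1 / 2 * quad A j e e), sq_nonneg (quad A j e e)]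
    · nlinarith [sq_nonneg (quad A j w dd - quad A j e e)]
  have total : 3 / 4 * (∑ j, χ j * (quad A j w dd * quad A j w dd)) -
      ∑ j, χ j * (quad A j w dd * quad A j w y) -
      1 / 2 * (∑ j, (1 - χ j) * quad A j w y ^ 2) - 1 / 4 * ∑ j, quad A j e e ^ 2 ≤ 0 := by
    refine le_trans ?_ normal
    simp only [Finset.mul_sum]
    rw [← Finset.sum_sub_distrib, ← Finset.sum_sub_distrib, ← Finset.sum_sub_distrib]
    exact Finset.sum_le_sum fun j _ => by simpa only [Finset.mul_sum] using pointwise j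
  have hd0 := norm_nonneg dd
  have hy0 := norm_nonneg y
  have he0 := norm_nonneg e
  have hem : ‖e‖ ≤ 1 / 10 ^ 6 := by nlinarith
  -- The rank-one part of the mean couples `dd` and `y`, but weakly: `w` is orthogonal to `y`, so
  -- `⟨x, y⟩ = ⟨x - w, y⟩`.
  have hprod : |inner ℝ x dd * inner ℝ x y| ≤ 1 / 10 ^ 6 * (‖dd‖ * ‖y‖) := by
    rw [hxy, abs_mul]
    calc _ ≤ (‖x‖ * ‖dd‖) * (‖e‖ * ‖y‖) := mul_le_mul (abs_real_inner_le_norm _ _)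
          (abs_real_inner_le_norm _ _) (abs_nonneg _) (by positivity)
      _ ≤ (‖x‖ * ‖dd‖) * (1 / 10 ^ 6 * ‖y‖) := by gcongr
      _ = _ := by rw [hxn]; ring
  have l1 : m * (0.4999 * ‖dd‖ ^ 2) ≤ ∑ j, χ j * (quad A j w dd * quad A j w dd) := by
    have := (abs_le.1 rip1).1
    have h2 : 0 ≤ m * (inner ℝ x dd * inner ℝ x dd) := mul_nonneg hm'.le (mul_self_nonneg _)
    nlinarith
  have l2 : ∑ j, χ j * (quad A j w dd * quad A j w y) ≤ m * (2 / 10 ^ 4 * (‖dd‖ * ‖y‖)) := by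
    have h1 := (abs_le.1 rip2).2
    have h2 := mul_le_mul_of_nonneg_left (abs_le.1 hprod).2 hm'.le
    have p : 0 ≤ m * (‖dd‖ * ‖y‖) := by positivity
    linarith
  have hbound : ‖dd‖ ^ 2 ≤ 0.01 * ‖y‖ ^ 2 + 2 * C * ‖e‖ ^ 4 := by
    have h1 : m * (3 / 4 * (0.4999 * ‖dd‖ ^ 2)) ≤ m * (2 / 10 ^ 4 * (‖dd‖ * ‖y‖) +
        1 / 2 * (1 / 10 ^ 4 * ‖y‖ ^ 2) + 1 / 4 * (C * ‖e‖ ^ 4)) := by linarith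
    have h2 := le_of_mul_le_mul_left h1 hm'
    have h3 : 0 ≤ C * ‖e‖ ^ 4 := by positivity
    nlinarith [sq_nonneg (‖dd‖ - ‖y‖), sq_nonneg ‖dd‖, sq_nonneg ‖y‖]
  have hpyth : ‖z' - x‖ ^ 2 = ‖dd‖ ^ 2 + ‖y‖ ^ 2 := by
    have : z' - x = dd - y := by simp [hdd, hy]
    rw [this, norm_sub_sq_real, hdy]
    ring
  rw [hpyth]
  linarith

end gaussNewton

end GraHTP

/-! ### Measure-preserving maps that make the conditioning explicit. -/

namespace GraHTP

section rows

lemma measurePreserving_of_rows {κ κ' : Type*} [Fintype κ] [Fintype κ'] [DecidableEq κ]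
    (M : κ → κ' → ℝ) (h : ∀ a a', ∑ b, M a b * M a' b = if a = a' then 1 else 0) :
    MeasurePreserving (fun (x : κ' → ℝ) a => ∑ b, M a b * x b) (gv κ') (gv κ) :=
  measurePreserving_mulVec (Matrix.of M) (by
    ext a a'
    simp [Matrix.mul_apply, h, Matrix.one_apply])

lemma measurePreserving_of_rows_add {κ κ₁ κ₂ : Type*} [Fintype κ] [Fintype κ₁] [Fintype κ₂]
    [DecidableEq κ] (M : κ → κ₁ → ℝ) (N : κ → κ₂ → ℝ)
    (h : ∀ a a', ∑ b, M a b * M a' b + ∑ c, N a c * N a' c = if a = a' then 1 else 0) :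
    MeasurePreserving (fun (p : (κ₁ → ℝ) × (κ₂ → ℝ)) a => ∑ b, M a b * p.1 b + ∑ c, N a c * p.2 c)
      ((gv κ₁).prod (gv κ₂)) (gv κ) :=
  measurePreserving_mulVec_add (Matrix.of M) (Matrix.of N) (by
    ext a a'
    simp [Matrix.mul_apply, h, Matrix.one_apply])

/-- Normalisation that also covers `x = 0`, where any unit vector will do; later uses need no case
distinction. -/
lemma exists_unit_smul {κ : Type*} [Fintype κ] [Nonempty κ] (x : κ → ℝ) :
    ∃ p : κ → ℝ, ∑ i, p i ^ 2 = 1 ∧ ∀ i, x i = √(∑ i, x i ^ 2) * p i := by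
  classical
  have h0 : 0 ≤ ∑ i, x i ^ 2 := Finset.sum_nonneg fun _ _ => sq_nonneg _
  rcases h0.eq_or_lt with h | h
  · obtain ⟨i₀⟩ := ‹Nonempty κ›
    refine ⟨fun i => if i = i₀ then 1 else 0, by simp, fun i => ?_⟩
    rw [← h, Real.sqrt_zero, zero_mul]
    have := (Finset.sum_eq_zero_iff_of_nonneg fun i _ => sq_nonneg (x i)).1 h.symm i
      (Finset.mem_univ i)
    exact pow_eq_zero_iff (two_ne_zero) |>.1 this
  · have hs : 0 < √(∑ i, x i ^ 2) := Real.sqrt_pos.2 h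
    refine ⟨fun i => x i / √(∑ i, x i ^ 2), ?_, fun i => by field_simp⟩
    simp_rw [div_pow]
    rw [← Finset.sum_div, Real.sq_sqrt h0, div_self h.ne']

variable {n m d : ℕ}

/-- Linear combinations of the rows with unit coefficients. -/
lemma measurePreserving_row_comb {R : Type*} [Fintype R] {θ : R → ℝ} (hθ : ∑ r, θ r ^ 2 = 1) :
    MeasurePreserving (fun (G : R × Fin n → ℝ) i => ∑ r, θ r * G (r, i)) (gv (R × Fin n))
      (gv (Fin n)) := by
  convert measurePreserving_of_rows
    (fun (i : Fin n) (p : R × Fin n) => if i = p.2 then θ p.1 else 0) ?_ using 1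
  · ext G i
    rw [Fintype.sum_prod_type]
    simp
  · intro i i'
    rw [Fintype.sum_prod_type]
    simp only [ite_mul, zero_mul, Finset.sum_ite_eq, Finset.mem_univ, if_true]
    split_ifs with h1 h2 <;> simp_all [← sq]

/-- Pairings of the rows with a unit vector. -/
lemma measurePreserving_row_dot {R : Type*} [Fintype R] [DecidableEq R] {p : Fin n → ℝ}
    (hp : ∑ i, p i ^ 2 = 1) :
    MeasurePreserving (fun (G : R × Fin n → ℝ) r => ∑ i, G (r, i) * p i) (gv (R × Fin n))
      (gv R) := by
  convert measurePreserving_of_rows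
    (fun (r : R) (q : R × Fin n) => if r = q.1 then p q.2 else 0) ?_ using 1
  · ext G r
    rw [Fintype.sum_prod_type, Finset.sum_comm]
    simp [mul_comm]
  · intro r r'
    rw [Fintype.sum_prod_type, Finset.sum_comm]
    simp only [ite_mul, zero_mul, Finset.sum_ite_eq, Finset.mem_univ, if_true]
    split_ifs with h1 h2 <;> simp_all [← sq]

/-- Unit combinations of the entries of each block. -/
lemma measurePreserving_block_comb {β : Fin m → Fin 2 → ℝ} (hβ : ∀ j, ∑ σ, β j σ ^ 2 = 1) :
    MeasurePreserving (fun (g : Fin m × Fin 2 → ℝ) j => ∑ σ, β j σ * g (j, σ))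
      (gv (Fin m × Fin 2)) (gv (Fin m)) := by
  convert measurePreserving_of_rows
    (fun (j : Fin m) (q : Fin m × Fin 2) => if j = q.1 then β j q.2 else 0) ?_ using 1
  · ext G r
    rw [Fintype.sum_prod_type, Finset.sum_comm]
    simp
  · intro j j'
    rw [Fintype.sum_prod_type, Finset.sum_comm]
    by_cases h : j = j'
    · subst h
      simpa [← sq] using hβ j
    · simp [h]

/-- Replacing the combination of the rows in a direction `θ` by an independent vector. -/
def replaceComb {R : Type*} [Fintype R] (θ : R → ℝ) (γ : Fin n → ℝ) (B : R × Fin n → ℝ) :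
    R × Fin n → ℝ :=
  fun p => θ p.1 * γ p.2 + (B p - θ p.1 * ∑ r, θ r * B (r, p.2))

/-- The covariance is `θ θᵀ + (1 - θ θᵀ) = 1` across rows: the combination of the rows along `θ` is
independent of what remains, so it may be resampled. -/
lemma measurePreserving_replaceComb {R : Type*} [Fintype R] [DecidableEq R] {θ : R → ℝ}
    (hθ : ∑ r, θ r ^ 2 = 1 ∨ θ = 0) :
    MeasurePreserving (fun p : (Fin n → ℝ) × (R × Fin n → ℝ) => replaceComb θ p.1 p.2)
      ((gv (Fin n)).prod (gv (R × Fin n))) (gv (R × Fin n)) := by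
  convert measurePreserving_of_rows_add
    (fun (p : R × Fin n) (i : Fin n) => if p.2 = i then θ p.1 else 0)
    (fun (p q : R × Fin n) =>
      if p.2 = q.2 then (if p.1 = q.1 then 1 else 0) - θ p.1 * θ q.1 else 0) ?_ using 1
  · ext q ⟨r, i⟩
    rw [Fintype.sum_prod_type]
    simp [replaceComb, sub_mul, Finset.sum_sub_distrib, Finset.mul_sum, mul_assoc]
  · rintro ⟨r, i⟩ ⟨r', i'⟩
    rw [Fintype.sum_prod_type]
    simp only [ite_mul, zero_mul, Finset.sum_ite_eq, Finset.mem_univ, if_true, Prod.mk.injEq]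
    by_cases hi : i = i'
    · subst hi
      simp only [if_true, sub_mul, mul_sub, Finset.sum_sub_distrib, ite_mul, one_mul, zero_mul,
        mul_ite, mul_one, mul_zero, Finset.sum_ite_eq, Finset.mem_univ, and_true]
      have : ∑ s, θ r * θ s * (θ r' * θ s) = θ r * θ r' * ∑ s, θ s ^ 2 := by
        rw [Finset.mul_sum]; exact Finset.sum_congr rfl fun s _ => by ring
      rw [this]
      rcases hθ with h | h
      · rw [h]
        split_ifs <;> simp_all <;> ring
      · simp [h, eq_comm]
    · simp [hi, Ne.symm hi]

/-- The array with given coordinates in a frame and given rows orthogonally to it. -/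
noncomputable def frameArray (u : Fin d → EuclideanSpace ℝ (Fin n))
    (X : (Fin m × Fin 2) × Fin d → ℝ) (G : (Fin m × Fin 2) × Fin n → ℝ) :
    (Fin m × Fin 2) × Fin n → ℝ :=
  fun p => ∑ k, u k p.2 * X (p.1, k) + ∑ i, perp u (EuclideanSpace.single p.2 1) i * G (p.1, i)

variable {u : Fin d → EuclideanSpace ℝ (Fin n)}

/-- The projection to the frame and its complement add up to the identity, written in coordinates.
This is the row condition under which `frameArray` preserves the Gaussian law. -/
lemma inner_single_perp (hu : Orthonormal ℝ u) (i j : Fin n) :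
    ∑ k, u k i * u k j + ∑ l, perp u (EuclideanSpace.single i 1) l *
      perp u (EuclideanSpace.single j 1) l = if i = j then 1 else 0 := by
  have hs : ∀ (v : EuclideanSpace ℝ (Fin n)) i,
      inner ℝ v (EuclideanSpace.single i (1 : ℝ)) = v i := fun v i => by
    rw [EuclideanSpace.inner_single_right]; simp
  have h := inner_eq_frame hu (EuclideanSpace.single i (1 : ℝ)) (EuclideanSpace.single j 1)
  simp only [hs] at h
  rw [PiLp.inner_apply] at h
  simp only [RCLike.inner_apply, conj_trivial, PiLp.single_apply] at h
  simp only [mul_comm (perp u (EuclideanSpace.single j 1) _)] at h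
  rw [← h]
  rcases eq_or_ne i j with rfl | hij
  · rfl
  · simp [hij, hij.symm]

lemma measurePreserving_frameArray (hu : Orthonormal ℝ u) :
    MeasurePreserving (fun p : ((Fin m × Fin 2) × Fin d → ℝ) × ((Fin m × Fin 2) × Fin n → ℝ) =>
      frameArray u p.1 p.2) ((gv ((Fin m × Fin 2) × Fin d)).prod (gv ((Fin m × Fin 2) × Fin n)))
      (gv ((Fin m × Fin 2) × Fin n)) := by
  convert measurePreserving_of_rows_add
    (fun (p : (Fin m × Fin 2) × Fin n) (q : (Fin m × Fin 2) × Fin d) =>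
      if p.1 = q.1 then u q.2 p.2 else 0)
    (fun (p q : (Fin m × Fin 2) × Fin n) =>
      if p.1 = q.1 then perp u (EuclideanSpace.single p.2 1) q.2 else 0) ?_ using 1
  · ext q ⟨r, i⟩
    rw [Fintype.sum_prod_type, Finset.sum_comm, Fintype.sum_prod_type (f := fun c => _ * q.2 c),
      Finset.sum_comm (s := (Finset.univ : Finset (Fin m × Fin 2)))]
    simp [frameArray]
  · rintro ⟨r, i⟩ ⟨r', i'⟩
    rw [Fintype.sum_prod_type, Finset.sum_comm, Fintype.sum_prod_type, 
      Finset.sum_comm (s := (Finset.univ : Finset (Fin m × Fin 2)))]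
    simp only [ite_mul, zero_mul, Finset.sum_ite_eq, Finset.mem_univ, if_true, Prod.mk.injEq]
    by_cases hr : r = r'
    · subst hr
      simpa using inner_single_perp hu i i'
    · simp [hr, Ne.symm hr]

end rows

end GraHTP

/-! ### Conditioning on the frame and noise bounds on sparse supports. -/

namespace GraHTP

variable {n m d : ℕ} {u : Fin d → EuclideanSpace ℝ (Fin n)}

lemma inner_eq_sum (v v' : EuclideanSpace ℝ (Fin n)) : inner ℝ v v' = ∑ i, v i * v' i := by
  rw [PiLp.inner_apply]
  exact Finset.sum_congr rfl fun i _ => by simp [mul_comm]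

lemma eq_sum_single (v : EuclideanSpace ℝ (Fin n)) :
    v = ∑ i, v i • EuclideanSpace.single i (1 : ℝ) := by
  ext j
  simp [Pi.single_apply]

lemma sum_smul_perp_single (v : EuclideanSpace ℝ (Fin n)) :
    ∑ i, v i • perp u (EuclideanSpace.single i 1) = perp u v := by
  have h : ∀ s : Finset (Fin n), ∑ i ∈ s, v i • perp u (EuclideanSpace.single i 1) =
      perp u (∑ i ∈ s, v i • EuclideanSpace.single i (1 : ℝ)) := by
    classical
    intro s
    induction s using Finset.induction_on with
    | empty => simp [perp, proj]
    | insert a s ha ih =>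
      rw [Finset.sum_insert ha, Finset.sum_insert ha, perp_add, perp_smul, ih]
  rw [h, ← eq_sum_single]

lemma rdot_frameArray (X : (Fin m × Fin 2) × Fin d → ℝ) (G : (Fin m × Fin 2) × Fin n → ℝ)
    (r : Fin m × Fin 2) (v : EuclideanSpace ℝ (Fin n)) :
    rdot (frameArray u X G) r v = ∑ k, inner ℝ (u k) v * X (r, k) + rdot G r (perp u v) := by
  have h1 : ∀ i, frameArray u X G (r, i) =
      ∑ k, u k i * X (r, k) + rdot G r (perp u (EuclideanSpace.single i 1)) := by
    intro i
    simp [frameArray, rdot, mul_comm]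
  simp only [rdot.eq_1 (frameArray u X G), h1, add_mul, Finset.sum_add_distrib]
  congr 1
  · simp_rw [Finset.sum_mul, inner_eq_sum]
    rw [Finset.sum_comm]
    simp_rw [Finset.sum_mul]
    exact Finset.sum_congr rfl fun k _ => Finset.sum_congr rfl fun i _ => by ring
  · rw [← sum_smul_perp_single, rdot_sum]
    exact Finset.sum_congr rfl fun i _ => by rw [rdot_smul, mul_comm]

lemma perp_perp (hu : Orthonormal ℝ u) (v : EuclideanSpace ℝ (Fin n)) :
    perp u (perp u v) = perp u v := by
  conv_lhs => rw [perp]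
  simp [proj, inner_frame_perp hu]

lemma frameCoords_frameArray (hu : Orthonormal ℝ u) (X : (Fin m × Fin 2) × Fin d → ℝ)
    (G : (Fin m × Fin 2) × Fin n → ℝ) : frameCoords u (frameArray u X G) = X := by
  classical
  ext ⟨r, k⟩
  rw [frameCoords, rdot_frameArray, perp_frame hu, rdot_zero, add_zero]
  simp [orthonormal_iff_ite.1 hu]

lemma rdot_frameArray_perp (hu : Orthonormal ℝ u) (X : (Fin m × Fin 2) × Fin d → ℝ)
    (G : (Fin m × Fin 2) × Fin n → ℝ) (r : Fin m × Fin 2) (v : EuclideanSpace ℝ (Fin n)) :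
    rdot (frameArray u X G) r (perp u v) = rdot G r (perp u v) := by
  rw [rdot_frameArray, perp_perp hu]
  simp [inner_frame_perp hu]

/-- Conditioning on the coordinates of the rows in a frame. -/
lemma gv_le_of_frame (hu : Orthonormal ℝ u) {W : Set ((Fin m × Fin 2) × Fin n → ℝ)}
    (hW : MeasurableSet W) (B : Set ((Fin m × Fin 2) × Fin d → ℝ)) {b : ENNReal}
    (h : ∀ X ∉ B, gv ((Fin m × Fin 2) × Fin n) {G | frameArray u X G ∈ W} ≤ b) :
    gv ((Fin m × Fin 2) × Fin n) W ≤ gv ((Fin m × Fin 2) × Fin d) B + b := by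
  have hmp := measurePreserving_frameArray (m := m) hu
  rw [← hmp.measure_preimage hW.nullMeasurableSet]
  exact prod_measure_le _ _ (hmp.measurable hW) B h

/-- Conditioning on the combination of the rows in a direction `θ`. -/
lemma gv_le_of_comb {R : Type*} [Fintype R] {θ : R → ℝ}
    (hθ : ∑ r, θ r ^ 2 = 1 ∨ θ = 0) {W : Set (R × Fin n → ℝ)}
    (hW : MeasurableSet W) (B : Set (Fin n → ℝ)) {b : ENNReal}
    (h : ∀ γ ∉ B, gv (R × Fin n) {G | replaceComb θ γ G ∈ W} ≤ b) :
    gv (R × Fin n) W ≤ gv (Fin n) B + b := by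
  classical
  have hmp := measurePreserving_replaceComb (n := n) hθ
  rw [← hmp.measure_preimage hW.nullMeasurableSet]
  exact prod_measure_le _ _ (hmp.measurable hW) B h

/-- It gives `s ≤ 2 s log (n / s)`, which absorbs every term linear in `s` into the sample-size
condition. -/
lemma log_ratio_ge {s : ℕ} (hs : 0 < s) (hsn : 2 * s ≤ n) :
    1 / 2 ≤ Real.log ((n : ℝ) / s) := by
  have h0 : (0 : ℝ) < s := by exact_mod_cast hs
  have h1 : (2 : ℝ) ≤ n / s := by
    rw [le_div_iff₀ h0]
    exact_mod_cast hsn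
  have := Real.log_le_log (by norm_num) h1
  have h2 := Real.log_two_gt_d9
  linarith

/-- Entropy bound for the number of index sets. -/
lemma choose_le_exp {s : ℕ} (hs : 0 < s) (hsn : 2 * s ≤ n) :
    (n.choose (2 * s) : ℝ) ≤ Real.exp (6 * s * Real.log ((n : ℝ) / s)) := by
  have h0 : (0 : ℝ) < s := by exact_mod_cast hs
  have hn : (0 : ℝ) < n := by
    have : 0 < n := by omega
    exact_mod_cast this
  have hlog := log_ratio_ge hs hsn
  have h1 := Nat.choose_le_pow_div (α := ℝ) (2 * s) n
  have h2 := Real.pow_div_factorial_le_exp (x := 2 * s) (by positivity) (2 * s)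
  have hf : (0 : ℝ) < (2 * s).factorial := by exact_mod_cast Nat.factorial_pos _
  -- With `k = 2 s` this is the bound `(n / k)ᵏ · eᵏ`, from `kᵏ / k! ≤ eᵏ`; the factor `e^(2 s)` is
  -- absorbed because the logarithm is at least `1/2`.
  have e : (n : ℝ) ^ (2 * s) / (2 * s).factorial =
      ((n : ℝ) / (2 * s)) ^ (2 * s) * ((2 * s : ℝ) ^ (2 * s) / (2 * s).factorial) := by
    rw [div_pow]; field_simp
  have h3 : ((n : ℝ) / (2 * s)) ^ (2 * s) ≤ Real.exp (2 * s * Real.log ((n : ℝ) / s)) := by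
    have : Real.exp (2 * s * Real.log ((n : ℝ) / s)) = ((n : ℝ) / s) ^ (2 * s) := by
      rw [mul_comm, Real.exp_mul, Real.exp_log (by positivity)]
      exact_mod_cast Real.rpow_natCast _ (2 * s)
    rw [this]
    gcongr
    linarith
  calc (n.choose (2 * s) : ℝ) ≤ (n : ℝ) ^ (2 * s) / (2 * s).factorial := h1
    _ = _ := e
    _ ≤ Real.exp (2 * s * Real.log ((n : ℝ) / s)) * Real.exp (2 * s) := by gcongr
    _ = Real.exp (2 * s * Real.log ((n : ℝ) / s) + 2 * s) := by rw [Real.exp_add]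
    _ ≤ _ := by
        apply Real.exp_le_exp.2
        nlinarith

/-- Exponential tails are weakened to `O(1/m)`, the order already imposed by Chebyshev in the frame.
-/
lemma exp_neg_le_inv {c M : ℝ} (hc : 0 < c) (hM : 0 < M) : Real.exp (-(c * M)) ≤ 1 / c / M := by
  rw [Real.exp_neg, div_div, one_div]
  apply inv_anti₀ (by positivity)
  linarith [Real.add_one_le_exp (c * M)]

/-- A Gaussian vector projected orthogonally to a frame is small on all sparse index sets. -/
lemma sparse_gauss_tail (hu : Orthonormal ℝ u) (hd : d ≤ 3) {s : ℕ} (hs : 0 < s)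
    (hsn : 2 * s ≤ n) {η : ℝ} (hη : 0 < η) (hm : 0 < m)
    (hms : 200 / η * s * Real.log ((n : ℝ) / s) ≤ m) :
    gv (Fin n) {γ | ∃ T : Finset (Fin n), T.card = 2 * s ∧
      η * m ≤ ∑ i ∈ T, (perp u (WithLp.toLp 2 γ) i) ^ 2} ≤ ENNReal.ofReal (400 / η / m) := by
  classical
  have hm' : (0 : ℝ) < m := by exact_mod_cast hm
  have hlog := log_ratio_ge hs hsn
  have h0 : (0 : ℝ) < s := by exact_mod_cast hs
  set Λ := (s : ℝ) * Real.log ((n : ℝ) / s) with hΛ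
  have hsΛ : (s : ℝ) ≤ 2 * Λ := by rw [hΛ]; nlinarith
  have hΛm : Λ ≤ η / 200 * m := by
    have h1 : 200 / η * Λ ≤ m := by rw [hΛ, ← mul_assoc]; exact hms
    calc Λ = η / 200 * (200 / η * Λ) := by field_simp
      _ ≤ _ := by gcongr
  set B₁ : Finset (Fin n) → Set (Fin n → ℝ) := fun T => {γ | η * m / 4 ≤ ∑ i ∈ T, γ i ^ 2}
  set B₂ : Set (Fin n → ℝ) := {γ | η * m / 4 ≤ ∑ k, inner ℝ (u k) (WithLp.toLp 2 γ) ^ 2}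
  -- On `T`, `(a - b)² ≤ 2 a² + 2 b²` separates the raw vector, handled by a union over supports,
  -- from its projection to the frame, which has at most three Gaussian coordinates and needs no
  -- union.
  have hsub : {γ : Fin n → ℝ | ∃ T : Finset (Fin n), T.card = 2 * s ∧
      η * m ≤ ∑ i ∈ T, (perp u (WithLp.toLp 2 γ) i) ^ 2} ⊆
      (⋃ T ∈ Finset.powersetCard (2 * s) Finset.univ, B₁ T) ∪ B₂ := by
    rintro γ ⟨T, hT, h⟩
    by_contra hc
    simp only [Set.mem_union, Set.mem_iUnion, Finset.mem_powersetCard_univ, not_or, not_exists,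
      B₁, B₂, Set.mem_ofPred_eq, not_le] at hc
    have c1 := hc.1 T hT
    have c2 := hc.2
    have e1 : ∑ i ∈ T, (perp u (WithLp.toLp 2 γ) i) ^ 2 ≤
        2 * ∑ i ∈ T, γ i ^ 2 + 2 * ∑ i, (proj u (WithLp.toLp 2 γ) i) ^ 2 := by
      have : ∑ i ∈ T, (proj u (WithLp.toLp 2 γ) i) ^ 2 ≤
          ∑ i, (proj u (WithLp.toLp 2 γ) i) ^ 2 :=
        Finset.sum_le_sum_of_subset_of_nonneg (Finset.subset_univ _) fun _ _ _ => sq_nonneg _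
      refine le_trans ?_ (add_le_add le_rfl (mul_le_mul_of_nonneg_left this (by norm_num)))
      rw [Finset.mul_sum, Finset.mul_sum, ← Finset.sum_add_distrib]
      refine Finset.sum_le_sum fun i _ => ?_
      have : perp u (WithLp.toLp 2 γ) i = γ i - proj u (WithLp.toLp 2 γ) i := rfl
      rw [this]
      nlinarith [sq_nonneg (γ i + proj u (WithLp.toLp 2 γ) i)]
    have e2 : ∑ i, (proj u (WithLp.toLp 2 γ) i) ^ 2 =
        ∑ k, inner ℝ (u k) (WithLp.toLp 2 γ) ^ 2 := by
      rw [← norm_sq_eq_sum, ← real_inner_self_eq_norm_sq, inner_proj_proj hu]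
      simp [sq]
    linarith
  refine (measure_mono hsub).trans ((measure_union_le _ _).trans ?_)
  have p1 : gv (Fin n) (⋃ T ∈ Finset.powersetCard (2 * s) Finset.univ, B₁ T) ≤
      ENNReal.ofReal (Real.exp (-(η / 16 * m))) := by
    refine (measure_biUnion_finset_le _ _).trans ?_
    calc _ ≤ ∑ T ∈ Finset.powersetCard (2 * s) (Finset.univ : Finset (Fin n)),
          ENNReal.ofReal (Real.exp (4 * Λ - η / 8 * m)) := by
          refine Finset.sum_le_sum fun T hT => ?_
          refine (chiSq_tail T (η * m / 4)).trans (ENNReal.ofReal_le_ofReal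
            (Real.exp_le_exp.2 ?_))
          rw [(Finset.mem_powersetCard_univ).1 hT]
          push_cast
          linarith
      _ = ENNReal.ofReal (n.choose (2 * s) * Real.exp (4 * Λ - η / 8 * m)) := by
          rw [Finset.sum_const, Finset.card_powersetCard, Finset.card_univ, Fintype.card_fin,
            nsmul_eq_mul, ENNReal.ofReal_mul (by positivity), ENNReal.ofReal_natCast]
      _ ≤ ENNReal.ofReal (Real.exp (6 * Λ) * Real.exp (4 * Λ - η / 8 * m)) := by
          apply ENNReal.ofReal_le_ofReal
          gcongr
          have := choose_le_exp hs hsn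
          rwa [mul_assoc] at this
      _ ≤ _ := by
          apply ENNReal.ofReal_le_ofReal
          rw [← Real.exp_add]
          apply Real.exp_le_exp.2
          -- The exponent is entropy `6 Λ`, plus `2 s ≤ 4 Λ` from the chi-square bound, minus `η m /
          -- 8`; here `10 Λ ≤ η m / 20`.
          linarith
  have p2 : gv (Fin n) B₂ ≤ ENNReal.ofReal (Real.exp (3 - η / 8 * m)) := by
    have hmp := measurePreserving_of_rows (fun (k : Fin d) (i : Fin n) => u k i) (by
      intro k l
      have := orthonormal_iff_ite.1 hu k l
      rwa [inner_eq_sum] at this)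
    have h1 := chiSq_tail (Finset.univ : Finset (Fin d)) (η * m / 4)
    rw [← hmp.map_eq] at h1
    have h2 := (Measure.le_map_apply hmp.measurable.aemeasurable _).trans h1
    have h3 : B₂ = (fun (x : Fin n → ℝ) (k : Fin d) => ∑ i, u k i * x i) ⁻¹'
        {g | η * m / 4 ≤ ∑ k, g k ^ 2} := by
      ext γ
      simp [B₂, inner_eq_sum]
    rw [h3]
    refine h2.trans (ENNReal.ofReal_le_ofReal (Real.exp_le_exp.2 ?_))
    have : (d : ℝ) ≤ 3 := by exact_mod_cast hd
    simp only [Finset.card_univ, Fintype.card_fin]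
    linarith
  refine (add_le_add p1 p2).trans ?_
  rw [← ENNReal.ofReal_add (Real.exp_pos _).le (Real.exp_pos _).le]
  apply ENNReal.ofReal_le_ofReal
  have e1 := exp_neg_le_inv (c := η / 16) (by positivity) hm'
  have e2 : Real.exp (3 - η / 8 * m) ≤ 21 * Real.exp (-(η / 16 * m)) := by
    have h3 : Real.exp 3 ≤ 21 := by
      have h1 := Real.exp_one_lt_d9
      have h2 : Real.exp 3 = Real.exp 1 ^ 3 := by rw [← Real.exp_nat_mul]; norm_num
      rw [h2]
      have h5 : Real.exp 1 ≤ 2.72 := by linarith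
      calc Real.exp 1 ^ 3 ≤ 2.72 ^ 3 := by gcongr
        _ ≤ 21 := by norm_num
    calc Real.exp (3 - η / 8 * m) ≤ Real.exp (3 + -(η / 16 * m)) := by
          apply Real.exp_le_exp.2
          have : 0 < η * m := by positivity
          linarith
      _ = Real.exp 3 * Real.exp (-(η / 16 * m)) := Real.exp_add _ _
      _ ≤ _ := by gcongr
  have e3 : 22 * (1 / (η / 16) / m) ≤ 400 / η / m := by
    have : 22 * (1 / (η / 16) / (m : ℝ)) = 352 / η / m := by field_simp; norm_num
    rw [this]
    gcongr
    norm_num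
  linarith

lemma measurable_rdot (r : Fin m × Fin 2) (v : EuclideanSpace ℝ (Fin n)) :
    Measurable fun A : (Fin m × Fin 2) × Fin n → ℝ => rdot A r v := by
  unfold rdot; fun_prop

lemma measurable_quad (j : Fin m) (v v' : EuclideanSpace ℝ (Fin n)) :
    Measurable fun A : (Fin m × Fin 2) × Fin n → ℝ => quad A j v v' :=
  Finset.measurable_sum _ fun _ _ => (measurable_rdot _ _).mul (measurable_rdot _ _)

lemma measurable_frameCoords :
    Measurable fun A : (Fin m × Fin 2) × Fin n → ℝ => frameCoords u A :=
  measurable_pi_lambda _ fun _ => measurable_rdot _ _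

/-- Noise generated by weights depending only on the frame coordinates. -/
lemma noise_tail (hu : Orthonormal ℝ u) (hd : d ≤ 3) {s : ℕ} (hs : 0 < s)
    (hsn : 2 * s ≤ n) {η V : ℝ} (hη : 0 < η) (hV : 0 < V) (hm : 0 < m)
    (hms : 200 / η * s * Real.log ((n : ℝ) / s) ≤ m)
    (κ : ((Fin m × Fin 2) × Fin d → ℝ) → Fin m × Fin 2 → ℝ) (hκ : ∀ r, Measurable fun X => κ X r) :
    gv ((Fin m × Fin 2) × Fin n) {A | ∑ r, κ (frameCoords u A) r ^ 2 ≤ V * m ∧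
      ∃ T : Finset (Fin n), T.card = 2 * s ∧ η * m * (V * m) ≤
        ∑ i ∈ T, (∑ r, κ (frameCoords u A) r * rdot A r (perp u (EuclideanSpace.single i 1))) ^ 2} ≤
      ENNReal.ofReal (400 / η / m) := by
  have hm' : (0 : ℝ) < m := by exact_mod_cast hm
  have hκA : ∀ r, Measurable fun A : (Fin m × Fin 2) × Fin n → ℝ => κ (frameCoords u A) r :=
    fun r => (hκ r).comp measurable_frameCoords
  have hmeas : MeasurableSet {A : (Fin m × Fin 2) × Fin n → ℝ |
      ∑ r, κ (frameCoords u A) r ^ 2 ≤ V * m ∧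
      ∃ T : Finset (Fin n), T.card = 2 * s ∧ η * m * (V * m) ≤ ∑ i ∈ T,
        (∑ r, κ (frameCoords u A) r * rdot A r (perp u (EuclideanSpace.single i 1))) ^ 2} := by
    refine measurableSet_setOfPred.2 (Measurable.and (measurableSet_setOfPred.1 ?_)
      (Measurable.exists fun T => measurable_const.and (measurableSet_setOfPred.1 ?_)))
    · exact measurableSet_le (Finset.measurable_sum _ fun r _ => (hκA r).pow_const 2)
        measurable_const
    · refine measurableSet_le measurable_const (Finset.measurable_sum _ fun i _ => ?_)
      exact (Finset.measurable_sum _ fun r _ => (hκA r).mul (measurable_rdot _ _)).pow_const 2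
  have key := gv_le_of_frame hu hmeas ∅ (b := ENNReal.ofReal (400 / η / m)) (fun X _ => ?_)
  · simpa using key
  have : Nonempty (Fin m × Fin 2) := ⟨(⟨0, hm⟩, 0)⟩
  -- With the frame coordinates fixed the weights are constants, so the weighted sum of rows is `‖κ
  -- X‖` times a single Gaussian vector `γ`, whatever the number of rows.
  obtain ⟨θ, hθ1, hθ⟩ := exists_unit_smul (κ X)
  have hmp := measurePreserving_row_comb (n := n) hθ1
  have h1 := sparse_gauss_tail hu hd hs hsn hη hm hms
  rw [← hmp.map_eq] at h1
  refine le_trans (measure_mono ?_) ((Measure.le_map_apply hmp.measurable.aemeasurable _).trans h1)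
  rintro G ⟨hV2, T, hT, hle⟩
  refine ⟨T, hT, ?_⟩
  rw [frameCoords_frameArray hu] at hV2
  simp only [frameCoords_frameArray hu, rdot_frameArray_perp hu] at hle
  set γ : Fin n → ℝ := fun i => ∑ r, θ r * G (r, i)
  have hcomb : ∀ i, ∑ r, κ X r * rdot G r (perp u (EuclideanSpace.single i 1)) =
      √(∑ r, κ X r ^ 2) * perp u (WithLp.toLp 2 γ) i := by
    intro i
    have e1 : perp u (WithLp.toLp 2 γ) i = inner ℝ (WithLp.toLp 2 γ)
        (perp u (EuclideanSpace.single i 1)) := by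
      have a1 : inner ℝ (perp u (WithLp.toLp 2 γ)) (EuclideanSpace.single i (1 : ℝ)) =
          perp u (WithLp.toLp 2 γ) i := by
        rw [EuclideanSpace.inner_single_right]; simp
      rw [← a1]
      have h2 := inner_eq_frame hu (perp u (WithLp.toLp 2 γ)) (EuclideanSpace.single i (1 : ℝ))
      have h3 := inner_eq_frame hu (WithLp.toLp 2 γ) (perp u (EuclideanSpace.single i (1 : ℝ)))
      rw [h2, h3]
      simp [inner_frame_perp hu, perp_perp hu]
    rw [e1, inner_eq_sum, Finset.mul_sum]
    simp only [rdot, Finset.mul_sum, γ, Finset.sum_mul]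
    rw [Finset.sum_comm]
    refine Finset.sum_congr rfl fun l _ => Finset.sum_congr rfl fun r _ => ?_
    rw [hθ r]
    ring
  simp only [hcomb, mul_pow, ← Finset.mul_sum] at hle
  rw [Real.sq_sqrt (Finset.sum_nonneg fun _ _ => sq_nonneg _)] at hle
  have hnn : 0 ≤ ∑ i ∈ T, perp u (WithLp.toLp 2 γ) i ^ 2 :=
    Finset.sum_nonneg fun _ _ => sq_nonneg _
  have hVm : 0 < V * m := by positivity
  have := hle.trans (mul_le_mul_of_nonneg_right hV2 hnn)
  rw [mul_comm (V * (m : ℝ))] at this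
  exact le_of_mul_le_mul_right this hVm

/-- Bound for sparse test vectors from the bound on index sets. -/
lemma sparse_test {s : ℕ} (hsn : 2 * s ≤ n) {L : EuclideanSpace ℝ (Fin n) →ₗ[ℝ] ℝ} {c : ℝ}
    (hc : 0 ≤ c)
    (h : ∀ T : Finset (Fin n), T.card = 2 * s →
      ∑ i ∈ T, (L (EuclideanSpace.single i 1)) ^ 2 ≤ c ^ 2)
    {v : EuclideanSpace ℝ (Fin n)} (hv : (supp v).card ≤ 2 * s) : |L v| ≤ c * ‖v‖ := by
  obtain ⟨T, hsub, hT⟩ := Finset.exists_superset_card_eq hv (by simpa using hsn)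
  have h1 : L v = ∑ i ∈ T, v i * L (EuclideanSpace.single i 1) := by
    conv_lhs => rw [eq_sum_single v]
    rw [map_sum, ← Finset.sum_subset (Finset.subset_univ T)]
    · simp
    · intro i _ hi
      have : v i = 0 := by
        by_contra h0
        exact hi (hsub (mem_supp.2 h0))
      simp [this]
  apply abs_le_of_sq_le_sq _ (by positivity)
  rw [h1]
  calc _ ≤ (∑ i ∈ T, v i ^ 2) * ∑ i ∈ T, L (EuclideanSpace.single i 1) ^ 2 :=
        Finset.sum_mul_sq_le_sq_mul_sq _ _ _
    _ ≤ ‖v‖ ^ 2 * c ^ 2 := by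
        refine mul_le_mul ?_ (h T hT) (Finset.sum_nonneg fun _ _ => sq_nonneg _) (sq_nonneg _)
        rw [norm_sq_eq_sum]
        exact Finset.sum_le_sum_of_subset_of_nonneg (Finset.subset_univ _) fun _ _ _ => sq_nonneg _
    _ = _ := by ring

end GraHTP

/-! ### Nets and uniform concentration of the light rows. -/

namespace GraHTP

section net

/-- A `1/2`-net of the unit ball of a finite-dimensional space. -/
lemma exists_net (E : Type*) [NormedAddCommGroup E] [NormedSpace ℝ E] [FiniteDimensional ℝ E] :
    ∃ F : Finset E, F.card ≤ 5 ^ Module.finrank ℝ E ∧ (∀ p ∈ F, ‖p‖ ≤ 1) ∧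
      ∀ v, ‖v‖ ≤ 1 → ∃ p ∈ F, ‖v - p‖ ≤ 1 / 2 := by
  classical
  -- A maximal 1-separated set in the ball of radius 2, scaled by one half, is the net. This scale
  -- is the one of the packing bound `5 ^ dim` of `Besicovitch.card_le_of_separated`.
  set Q : Finset E → Prop := fun s => (∀ c ∈ s, ‖c‖ ≤ 2) ∧
    ∀ c ∈ s, ∀ d ∈ s, c ≠ d → 1 ≤ ‖c - d‖ with hQ
  have hbound : ∀ s, Q s → s.card ≤ 5 ^ Module.finrank ℝ E := fun s hs =>
    Besicovitch.card_le_of_separated s hs.1 hs.2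
  set N := sSup {k | ∃ s, Q s ∧ s.card = k} with hN
  have hbdd : BddAbove {k | ∃ s, Q s ∧ s.card = k} :=
    ⟨_, by rintro k ⟨s, hs, rfl⟩; exact hbound s hs⟩
  obtain ⟨s, hs, hsN⟩ : N ∈ {k | ∃ s, Q s ∧ s.card = k} :=
    Nat.sSup_mem ⟨0, ∅, by simp [hQ], rfl⟩ hbdd
  refine ⟨s.image fun c => (1 / 2 : ℝ) • c, Finset.card_image_le.trans (hbound s hs), ?_, ?_⟩
  · intro p hp
    obtain ⟨c, hc, rfl⟩ := Finset.mem_image.1 hp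
    rw [norm_smul]
    have := hs.1 c hc
    norm_num
    linarith
  · intro v hv
    have key : ∃ c ∈ s, ‖(2 : ℝ) • v - c‖ < 1 := by
      by_contra! h
      have hv2 : ‖(2 : ℝ) • v‖ ≤ 2 := by rw [norm_smul]; norm_num; linarith
      have hnot : (2 : ℝ) • v ∉ s := fun hm => by
        have := h _ hm
        simp at this
        linarith
      have hins : Q (insert ((2 : ℝ) • v) s) := by
        refine ⟨?_, ?_⟩
        · intro c hc
          rcases Finset.mem_insert.1 hc with rfl | hc
          · exact hv2
          · exact hs.1 c hc
        · intro c hc d hd hcd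
          rcases Finset.mem_insert.1 hc with rfl | hc <;>
            rcases Finset.mem_insert.1 hd with rfl | hd
          · exact absurd rfl hcd
          · exact h d hd
          · rw [norm_sub_rev]; exact h c hc
          · exact hs.2 c hc d hd hcd
      have := le_csSup hbdd ⟨_, hins, rfl⟩
      rw [Finset.card_insert_of_notMem hnot] at this
      omega
    obtain ⟨c, hc, hlt⟩ := key
    refine ⟨_, Finset.mem_image_of_mem _ hc, ?_⟩
    have : v - (1 / 2 : ℝ) • c = (1 / 2 : ℝ) • ((2 : ℝ) • v - c) := by
      rw [smul_sub, smul_smul]; norm_num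
    rw [this, norm_smul]
    norm_num
    linarith

/-- A linear functional is controlled by its values on a `1/2`-net. -/
lemma abs_le_of_net {E : Type*} [NormedAddCommGroup E] [NormedSpace ℝ E] [FiniteDimensional ℝ E]
    {F : Finset E} (hF : ∀ v, ‖v‖ ≤ 1 → ∃ p ∈ F, ‖v - p‖ ≤ 1 / 2) (L : E →ₗ[ℝ] ℝ) {b : ℝ}
    (h : ∀ p ∈ F, |L p| ≤ b) (v : E) : |L v| ≤ 2 * b * ‖v‖ := by
  set L' := LinearMap.toContinuousLinearMap L with hL'
  have hb : 0 ≤ b := by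
    obtain ⟨p, hp, -⟩ := hF 0 (by simp)
    exact (abs_nonneg _).trans (h p hp)
  have key : ∀ w : E, ‖w‖ = 1 → ‖L' w‖ ≤ b + ‖L'‖ / 2 := by
    intro w hw
    obtain ⟨p, hp, hpw⟩ := hF w hw.le
    have e : L' w = L p + L' (w - p) := by simp [hL']
    rw [e]
    refine (norm_add_le _ _).trans (add_le_add (h p hp) ?_)
    refine (L'.le_opNorm _).trans ?_
    have := norm_nonneg L'
    nlinarith
  -- The error of approximating by the net is half the norm itself, hence `‖L'‖ ≤ 2 b`.
  have h1 : ‖L'‖ ≤ b + ‖L'‖ / 2 :=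
    ContinuousLinearMap.opNorm_le_of_unit_norm (by positivity) key
  have h2 := L'.le_opNorm v
  calc |L v| = ‖L' v‖ := rfl
    _ ≤ ‖L'‖ * ‖v‖ := h2
    _ ≤ _ := by gcongr; linarith

variable {n : ℕ}

lemma supp_subset_iff {T : Finset (Fin n)} {v : EuclideanSpace ℝ (Fin n)} :
    supp v ⊆ T ↔ ∀ i ∉ T, v i = 0 := by
  constructor
  · intro h i hi
    by_contra h0
    exact hi (h (mem_supp.2 h0))
  · intro h i hi
    by_contra h0
    exact mem_supp.1 hi (h i h0)

/-- The vectors supported on an index set. -/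
def suppSubmodule (T : Finset (Fin n)) : Submodule ℝ (EuclideanSpace ℝ (Fin n)) where
  carrier := {v | supp v ⊆ T}
  add_mem' {v v'} h h' := supp_subset_iff.2 fun i hi => by
    simp [supp_subset_iff.1 h i hi, supp_subset_iff.1 h' i hi]
  zero_mem' := supp_subset_iff.2 fun i _ => by simp
  smul_mem' c v h := supp_subset_iff.2 fun i hi => by
    simp [supp_subset_iff.1 h i hi]

lemma finrank_suppSubmodule_le (T : Finset (Fin n)) :
    Module.finrank ℝ (suppSubmodule T) ≤ T.card := by
  classical
  set B : Finset (EuclideanSpace ℝ (Fin n)) := T.image fun i => EuclideanSpace.single i (1 : ℝ)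
  have h : suppSubmodule T ≤ Submodule.span ℝ (B : Set (EuclideanSpace ℝ (Fin n))) := by
    intro v hv
    rw [eq_sum_single v]
    refine Submodule.sum_mem _ fun i _ => ?_
    by_cases hi : i ∈ T
    · exact Submodule.smul_mem _ _ (Submodule.subset_span (Finset.mem_image_of_mem _ hi))
    · rw [supp_subset_iff.1 hv i hi, zero_smul]
      exact Submodule.zero_mem _
  exact (Submodule.finrank_mono h).trans
    ((finrank_span_finset_le_card B).trans Finset.card_image_le)

/-- The net bound is applied in one variable and then in the other, each time at the cost of a
factor 2. -/
lemma exists_net_supp (T : Finset (Fin n)) :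
    ∃ F : Finset (EuclideanSpace ℝ (Fin n)), F.card ≤ 5 ^ T.card ∧ (∀ p ∈ F, ‖p‖ ≤ 1) ∧
      ∀ (D : EuclideanSpace ℝ (Fin n) →ₗ[ℝ] EuclideanSpace ℝ (Fin n) →ₗ[ℝ] ℝ) (b : ℝ),
        (∀ p ∈ F, ∀ p' ∈ F, |D p p'| ≤ b) → ∀ v v', supp v ⊆ T → supp v' ⊆ T →
          |D v v'| ≤ 4 * b * (‖v‖ * ‖v'‖) := by
  classical
  obtain ⟨F, hF1, hF2, hF3⟩ := exists_net (suppSubmodule T)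
  refine ⟨F.image Subtype.val, Finset.card_image_le.trans (hF1.trans
    (Nat.pow_le_pow_right (by norm_num) (finrank_suppSubmodule_le T))), ?_, ?_⟩
  · intro p hp
    obtain ⟨q, hq, rfl⟩ := Finset.mem_image.1 hp
    exact hF2 q hq
  · intro D b h v v' hv hv'
    have s1 : ∀ p ∈ F, |D p v'| ≤ 2 * b * ‖v'‖ := fun p hp =>
      abs_le_of_net hF3 ((D p).comp (suppSubmodule T).subtype)
        (fun p' hp' => h _ (Finset.mem_image_of_mem _ hp) _ (Finset.mem_image_of_mem _ hp'))
        ⟨v', hv'⟩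
    have s2 := abs_le_of_net hF3 ((D.flip v').comp (suppSubmodule T).subtype) s1 ⟨v, hv⟩
    refine s2.trans (le_of_eq ?_)
    change 2 * (2 * b * ‖v'‖) * ‖v‖ = _
    ring

end net

section deviation
variable {n m d : ℕ} {u : Fin d → EuclideanSpace ℝ (Fin n)} {K : ℝ}

/-- Deviation of a weighted quadratic form of the light rows from its conditional mean. -/
noncomputable def lightDev (u : Fin d → EuclideanSpace ℝ (Fin n)) (w : EuclideanSpace ℝ (Fin n))
    (K : ℝ) (A : (Fin m × Fin 2) × Fin n → ℝ) (v v' : EuclideanSpace ℝ (Fin n)) : ℝ :=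
  ∑ j, lightInd K (frameCoords u A) j * (quad A j w (perp u v) * quad A j w (perp u v')) -
    1 / 2 * (∑ j, lightInd K (frameCoords u A) j * quad A j w w) * inner ℝ (perp u v) (perp u v')

lemma measurable_blockSq (j : Fin m) :
    Measurable fun X : (Fin m × Fin 2) × Fin d → ℝ => blockSq X j :=
  Finset.measurable_sum _ fun _ _ => (measurable_pi_apply _).pow_const 2

lemma measurable_lightInd (K : ℝ) (j : Fin m) :
    Measurable fun X : (Fin m × Fin 2) × Fin d → ℝ => lightInd K X j :=
  Measurable.ite (measurableSet_le (measurable_blockSq j) measurable_const) measurable_const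
    measurable_const

lemma measurable_lightDev (w v v' : EuclideanSpace ℝ (Fin n)) :
    Measurable fun A : (Fin m × Fin 2) × Fin n → ℝ => lightDev u w K A v v' := by
  have h : ∀ j, Measurable fun A : (Fin m × Fin 2) × Fin n → ℝ =>
      lightInd K (frameCoords u A) j := fun j => (measurable_lightInd K j).comp measurable_frameCoords
  refine Measurable.sub (Finset.measurable_sum _ fun j _ => (h j).mul
    ((measurable_quad _ _ _).mul (measurable_quad _ _ _))) (Measurable.mul_const (Measurable.const_mul
      (Finset.measurable_sum _ fun j _ => (h j).mul (measurable_quad _ _ _)) _) _)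

lemma measurePreserving_block_row {β : Fin m → Fin 2 → ℝ} (hβ : ∀ j, ∑ σ, β j σ ^ 2 = 1)
    {p : Fin n → ℝ} (hp : ∑ i, p i ^ 2 = 1) :
    MeasurePreserving (fun (G : (Fin m × Fin 2) × Fin n → ℝ) j =>
      ∑ σ, β j σ * ∑ i, G ((j, σ), i) * p i) (gv ((Fin m × Fin 2) × Fin n)) (gv (Fin m)) :=
  (measurePreserving_block_comb hβ).comp (measurePreserving_row_dot hp)

/-- Given the frame coordinates, `quad A j w (perp u v)` is a known multiple of a Gaussian variable,
independently over `j`, so the deviation is a weighted sum of centred squares. Truncation bounds the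
weights by `16 K` and makes the Chernoff bound available. -/
lemma lightDev_tail (hu : Orthonormal ℝ u) (hn : 0 < n) (hK : 0 < K)
    {w : EuclideanSpace ℝ (Fin n)} (hw : perp u w = 0) (hw2 : ‖w‖ ≤ 2) {η : ℝ} (hη : 0 < η)
    (hηK : η ≤ K) {v : EuclideanSpace ℝ (Fin n)} (hv : ‖v‖ ≤ 2) :
    gv ((Fin m × Fin 2) × Fin n) {A | η * m ≤ |lightDev u w K A v v|} ≤
      ENNReal.ofReal (2 * Real.exp (-(η ^ 2 / (1024 * K ^ 2)) * m)) := by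
  have hmeas : MeasurableSet {A : (Fin m × Fin 2) × Fin n → ℝ |
      η * m ≤ |lightDev u w K A v v|} :=
    measurableSet_le measurable_const (measurable_lightDev w v v).abs
  have key := gv_le_of_frame hu hmeas ∅
    (b := ENNReal.ofReal (2 * Real.exp (-(η ^ 2 / (1024 * K ^ 2)) * m))) (fun X _ => ?_)
  · simpa using key
  set b : Fin m → Fin 2 → ℝ := fun j σ => ∑ k, inner ℝ (u k) w * X ((j, σ), k) with hb
  choose β hβ1 hβ using fun j => exists_unit_smul (b j)
  have : Nonempty (Fin n) := ⟨⟨0, hn⟩⟩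
  obtain ⟨p, hp1, hp⟩ := exists_unit_smul (fun i => perp u v i)
  obtain ⟨ν, hν⟩ : ∃ ν, ν = ∑ i, perp u v i ^ 2 := ⟨_, rfl⟩
  rw [← hν] at hp
  have hν0 : 0 ≤ ν := hν ▸ Finset.sum_nonneg fun _ _ => sq_nonneg _
  have hνn : ν = ‖perp u v‖ ^ 2 := by rw [norm_sq_eq_sum, hν]
  have hν4 : ν ≤ 4 := by
    rw [hνn]
    have := (norm_perp_le hu v).trans hv
    nlinarith [norm_nonneg (perp u v)]
  have hmp := measurePreserving_block_row hβ1 hp1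
  set a : Fin m → ℝ := fun j => lightInd K X j * (∑ σ, b j σ ^ 2) * ν with ha
  have hrw : ∀ G r, rdot (frameArray u X G) r w = ∑ k, inner ℝ (u k) w * X (r, k) := by
    intro G r
    rw [rdot_frameArray, hw, rdot_zero, add_zero]
  have hbsq : ∀ j, ∑ σ, b j σ ^ 2 = quad (frameArray u X 0) j w w := by
    intro j
    simp only [quad, hrw, hb, sq]
  have ha16 : ∀ j, |a j| ≤ 16 * K := by
    intro j
    have h1 := quad_self_le (frameArray u X 0) hu j hw
    rw [frameCoords_frameArray hu, ← hbsq] at h1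
    have h0 : 0 ≤ ∑ σ, b j σ ^ 2 := Finset.sum_nonneg fun _ _ => sq_nonneg _
    have hw4 : ‖w‖ ^ 2 ≤ 4 := by nlinarith [norm_nonneg w]
    simp only [ha, lightInd]
    split_ifs with hl
    · rw [one_mul, abs_of_nonneg (by positivity)]
      have : ∑ σ, b j σ ^ 2 ≤ K * 4 := h1.trans (mul_le_mul hl hw4 (by positivity) hK.le)
      calc (∑ σ, b j σ ^ 2) * ν ≤ (K * 4) * 4 := mul_le_mul this hν4 hν0 (by positivity)
        _ = _ := by ring
    · simp; positivity
  have ht := weighted_chiSq_tail a (K := 16 * K) (η := η) (N := m) (by positivity) ha16 hη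
    (by linarith) (by simp)
  rw [← hmp.map_eq] at ht
  refine (measure_mono ?_).trans ((Measure.le_map_apply hmp.measurable.aemeasurable _).trans
    (ht.trans_eq ?_))
  · intro G hG
    simp only [Set.mem_ofPred_eq, Set.mem_preimage] at hG ⊢
    convert hG using 2
    simp only [lightDev, frameCoords_frameArray hu]
    have hq : ∀ j, quad (frameArray u X G) j w (perp u v) =
        √(∑ σ, b j σ ^ 2) * √ν * ∑ σ, β j σ * ∑ i, G ((j, σ), i) * p i := by
      intro j
      simp only [quad, hrw, rdot_frameArray_perp hu, Finset.mul_sum]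
      refine Finset.sum_congr rfl fun σ _ => ?_
      rw [show ∑ k, inner ℝ (u k) w * X ((j, σ), k) = b j σ from rfl, hβ j σ, rdot]
      simp only [Finset.mul_sum]
      refine Finset.sum_congr rfl fun i _ => ?_
      rw [hp i]
      ring
    have hqw : ∀ j, quad (frameArray u X G) j w w = ∑ σ, b j σ ^ 2 := by
      intro j
      simp only [quad, hrw, hb, sq]
    simp only [hq, hqw, real_inner_self_eq_norm_sq, ← hνn]
    rw [Finset.mul_sum, Finset.sum_mul, ← Finset.sum_sub_distrib]
    refine Finset.sum_congr rfl fun j _ => ?_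
    have e1 := Real.sq_sqrt hν0
    have e2 := Real.sq_sqrt (Finset.sum_nonneg fun σ (_ : σ ∈ Finset.univ) => sq_nonneg (b j σ))
    simp only [ha]
    generalize ∑ σ, β j σ * ∑ i, G ((j, σ), i) * p i = g
    calc _ = lightInd K X j * (∑ σ, b j σ ^ 2) * ν * (g ^ 2 - 1 / 2) := by ring
      _ = lightInd K X j * (√(∑ σ, b j σ ^ 2) ^ 2) * (√ν) ^ 2 * g ^ 2 -
          lightInd K X j * (∑ σ, b j σ ^ 2) * ν * (1 / 2) := by rw [e1, e2]; ring
      _ = _ := by ring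
  · congr 3
    ring

lemma lightDev_eq_bilin (w : EuclideanSpace ℝ (Fin n)) (A : (Fin m × Fin 2) × Fin n → ℝ) :
    ∃ D : EuclideanSpace ℝ (Fin n) →ₗ[ℝ] EuclideanSpace ℝ (Fin n) →ₗ[ℝ] ℝ,
      ∀ v v', D v v' = lightDev u w K A v v' :=
  ⟨LinearMap.mk₂ ℝ (lightDev u w K A)
    (fun v₁ v₂ v' => by
      simp only [lightDev, perp_add, quad_add_right, inner_add_left, add_mul, mul_add,
        Finset.sum_add_distrib]
      ring)
    (fun c v v' => by
      simp only [lightDev, perp_smul, quad_smul_right, real_inner_smul_left, smul_eq_mul]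
      rw [mul_sub, Finset.mul_sum _ _ c]
      congr 1
      · exact Finset.sum_congr rfl fun j _ => by ring
      · ring)
    (fun v v₁ v₂ => by
      simp only [lightDev, perp_add, quad_add_right, inner_add_right, mul_add,
        Finset.sum_add_distrib]
      ring)
    (fun c v v' => by
      simp only [lightDev, perp_smul, quad_smul_right, real_inner_smul_right, smul_eq_mul]
      rw [mul_sub, Finset.mul_sum _ _ c]
      congr 1
      · exact Finset.sum_congr rfl fun j _ => by ring
      · ring), fun _ _ => rfl⟩

lemma lightDev_comm (w : EuclideanSpace ℝ (Fin n)) (A : (Fin m × Fin 2) × Fin n → ℝ)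
    (v v' : EuclideanSpace ℝ (Fin n)) : lightDev u w K A v v' = lightDev u w K A v' v := by
  simp only [lightDev, real_inner_comm (perp u v) (perp u v')]
  congr 1
  exact Finset.sum_congr rfl fun j _ => by ring

/-- Union bound over supports of size `2 s` and pairs of net points; the number of these is
exponential in `s log (n / s)`, and the Chernoff exponent is proportional to `m`. -/
lemma lightDev_sup_tail (hu : Orthonormal ℝ u) {s : ℕ} (hs : 0 < s) (hsn : 2 * s ≤ n) (hK : 0 < K)
    {w : EuclideanSpace ℝ (Fin n)} (hw : perp u w = 0) (hw2 : ‖w‖ ≤ 2) {η : ℝ} (hη : 0 < η)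
    (hηK : η ≤ K) (hm : 0 < m)
    (hms : 163840 * K ^ 2 / η ^ 2 * s * Real.log ((n : ℝ) / s) ≤ m) :
    gv ((Fin m × Fin 2) × Fin n) {A | ¬ ∀ (T : Finset (Fin n)), T.card ≤ 2 * s →
      ∀ v v', supp v ⊆ T → supp v' ⊆ T → |lightDev u w K A v v'| ≤ η * m * (‖v‖ * ‖v'‖)} ≤
      ENNReal.ofReal (32768 * K ^ 2 / η ^ 2 / m) := by
  classical
  have hm' : (0 : ℝ) < m := by exact_mod_cast hm
  choose F hF1 hF2 hF3 using exists_net_supp (n := n)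
  set 𝓣 := Finset.powersetCard (2 * s) (Finset.univ : Finset (Fin n))
  set Bad : EuclideanSpace ℝ (Fin n) → Set ((Fin m × Fin 2) × Fin n → ℝ) := fun q =>
    {A | η / 2 * m ≤ |lightDev u w K A q q|} with hBad
  have hsub : {A : (Fin m × Fin 2) × Fin n → ℝ | ¬ ∀ (T : Finset (Fin n)), T.card ≤ 2 * s →
      ∀ v v', supp v ⊆ T → supp v' ⊆ T → |lightDev u w K A v v'| ≤ η * m * (‖v‖ * ‖v'‖)} ⊆
      ⋃ T ∈ 𝓣, ⋃ q ∈ F T ×ˢ F T, (Bad (q.1 + q.2) ∪ Bad (q.1 - q.2)) := by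
    intro A hA
    by_contra hc
    apply hA
    intro T hT v v' hv hv'
    obtain ⟨T', hsub, hT'⟩ := Finset.exists_superset_card_eq hT (by simpa using hsn)
    obtain ⟨D, hD⟩ := lightDev_eq_bilin (u := u) (K := K) w A
    have hb : ∀ p ∈ F T', ∀ p' ∈ F T', |D p p'| ≤ η / 4 * m := by
      intro p hp p' hp'
      have h1 : A ∉ Bad (p + p') ∪ Bad (p - p') := fun h => hc (by
        simp only [Set.mem_iUnion]
        exact ⟨T', Finset.mem_powersetCard_univ.2 hT', (p, p'), Finset.mk_mem_product hp hp', h⟩)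
      simp only [Bad, Set.mem_union, Set.mem_ofPred_eq, not_or, not_le, ← hD] at h1
      have h2 : D p' p = D p p' := by rw [hD, hD, lightDev_comm]
      -- Polarisation reduces pairs to the diagonal values for which the tail bound is available;
      -- this is why that bound allows norms up to 2.
      have h3 : 4 * D p p' = D (p + p') (p + p') - D (p - p') (p - p') := by
        simp only [map_add, map_sub, LinearMap.add_apply, LinearMap.sub_apply, h2]
        ring
      have h4 := abs_sub (D (p + p') (p + p')) (D (p - p') (p - p'))
      rw [← h3, abs_mul, abs_of_pos (by norm_num : (0 : ℝ) < 4)] at h4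
      linarith [h1.1, h1.2]
    have := hF3 T' D _ hb v v' (hv.trans hsub) (hv'.trans hsub)
    rw [← hD]
    refine this.trans (le_of_eq (by ring))
  set c := η ^ 2 / (4096 * K ^ 2) with hc
  have hcpos : 0 < c := by positivity
  set Λ := (s : ℝ) * Real.log ((n : ℝ) / s) with hΛ
  have hlog := log_ratio_ge hs hsn
  have h0 : (0 : ℝ) < s := by exact_mod_cast hs
  have hsΛ : (s : ℝ) ≤ 2 * Λ := by rw [hΛ]; nlinarith
  -- Supports cost `exp (6 Λ)` and net pairs `exp (14 Λ)`, so half of the exponent `c m` pays for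
  -- the union.
  have hΛm : 40 * Λ ≤ c * m := by
    have h1 : 163840 * K ^ 2 / η ^ 2 * Λ ≤ m := by rw [hΛ, ← mul_assoc]; exact hms
    have h2 := mul_le_mul_of_nonneg_left h1 hcpos.le
    have h3 : c * (163840 * K ^ 2 / η ^ 2 * Λ) = 40 * Λ := by
      rw [hc]; field_simp; ring
    linarith
  have hBadp : ∀ q, ‖q‖ ≤ 2 → gv ((Fin m × Fin 2) × Fin n) (Bad q) ≤
      ENNReal.ofReal (2 * Real.exp (-c * m)) := by
    intro q hq
    refine (lightDev_tail hu (by omega) hK hw hw2 (η := η / 2) (by linarith) (by linarith)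
      hq).trans_eq ?_
    congr 4
    rw [hc]; ring
  refine (measure_mono hsub).trans ((measure_biUnion_finset_le _ _).trans ?_)
  have hT : ∀ T ∈ 𝓣, gv ((Fin m × Fin 2) × Fin n)
      (⋃ q ∈ F T ×ˢ F T, (Bad (q.1 + q.2) ∪ Bad (q.1 - q.2))) ≤
      ENNReal.ofReal (Real.exp (14 * Λ) * (4 * Real.exp (-c * m))) := by
    intro T hT
    refine (measure_biUnion_finset_le _ _).trans ?_
    calc _ ≤ ∑ q ∈ F T ×ˢ F T, ENNReal.ofReal (4 * Real.exp (-c * m)) := by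
          refine Finset.sum_le_sum fun q hq => (measure_union_le _ _).trans ?_
          obtain ⟨h1, h2⟩ := Finset.mem_product.1 hq
          have n1 := hF2 T _ h1
          have n2 := hF2 T _ h2
          refine (add_le_add (hBadp _ ((norm_add_le _ _).trans (by linarith)))
            (hBadp _ ((norm_sub_le _ _).trans (by linarith)))).trans_eq ?_
          rw [← ENNReal.ofReal_add (by positivity) (by positivity)]
          congr 1; ring
      _ = ENNReal.ofReal ((F T ×ˢ F T).card * (4 * Real.exp (-c * m))) := by
          rw [Finset.sum_const, nsmul_eq_mul, ← ENNReal.ofReal_natCast,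
            ← ENNReal.ofReal_mul (by positivity)]
      _ ≤ _ := by
          apply ENNReal.ofReal_le_ofReal
          gcongr
          rw [Finset.card_product]
          have hTc : T.card = 2 * s := Finset.mem_powersetCard_univ.1 hT
          have h1 : ((F T).card : ℝ) ≤ 5 ^ (2 * s) := by
            have := hF1 T
            rw [hTc] at this
            exact_mod_cast this
          have h25 : (625 : ℝ) ≤ Real.exp 7 := by
            have h1 := Real.exp_one_gt_d9
            have h2 : Real.exp 7 = Real.exp 1 ^ 7 := by rw [← Real.exp_nat_mul]; norm_num
            rw [h2]
            have h5 : 2.7 ≤ Real.exp 1 := by linarith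
            calc (625 : ℝ) ≤ 2.7 ^ 7 := by norm_num
              _ ≤ _ := by gcongr
          push_cast
          calc ((F T).card : ℝ) * (F T).card ≤ 5 ^ (2 * s) * 5 ^ (2 * s) := by gcongr
            _ = 625 ^ s := by rw [← pow_add, show 2 * s + 2 * s = 4 * s by ring, pow_mul]; norm_num
            _ ≤ (Real.exp 7) ^ s := by gcongr
            _ = Real.exp (s * 7) := by rw [← Real.exp_nat_mul]
            _ ≤ _ := Real.exp_le_exp.2 (by linarith)
  refine (Finset.sum_le_sum hT).trans ?_
  rw [Finset.sum_const, Finset.card_powersetCard, Finset.card_univ, Fintype.card_fin,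
    nsmul_eq_mul, ← ENNReal.ofReal_natCast, ← ENNReal.ofReal_mul (by positivity)]
  apply ENNReal.ofReal_le_ofReal
  have hch := choose_le_exp hs hsn
  rw [mul_assoc] at hch
  have e1 := exp_neg_le_inv (c := c / 2) (by positivity) hm'
  calc (n.choose (2 * s) : ℝ) * (Real.exp (14 * Λ) * (4 * Real.exp (-c * m)))
      ≤ Real.exp (6 * Λ) * (Real.exp (14 * Λ) * (4 * Real.exp (-c * m))) := by gcongr
    _ = 4 * Real.exp (6 * Λ + (14 * Λ + -c * m)) := by rw [Real.exp_add, Real.exp_add]; ring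
    _ ≤ 4 * Real.exp (-(c / 2 * m)) := by gcongr; linarith
    _ ≤ 4 * (1 / (c / 2) / m) := by gcongr
    _ = _ := by rw [hc]; field_simp; norm_num

end deviation

end GraHTP

/-! ### Tail bounds for the gradient noise and for the light rows. -/

namespace GraHTP

variable {n m d : ℕ} {u : Fin d → EuclideanSpace ℝ (Fin n)} {k₀ : Fin d} {C K : ℝ}

/-- The pairing of a row with a vector in the span of a frame, in terms of the frame coordinates
of the row. -/
noncomputable def coordDot (u : Fin d → EuclideanSpace ℝ (Fin n)) (v : EuclideanSpace ℝ (Fin n))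
    (X : (Fin m × Fin 2) × Fin d → ℝ) (r : Fin m × Fin 2) : ℝ := ∑ k, inner ℝ (u k) v * X (r, k)

/-- The form `quad` for vectors in the span of a frame, in terms of the frame coordinates. -/
noncomputable def coordQuad (u : Fin d → EuclideanSpace ℝ (Fin n))
    (v v' : EuclideanSpace ℝ (Fin n)) (X : (Fin m × Fin 2) × Fin d → ℝ) (j : Fin m) : ℝ :=
  ∑ σ, coordDot u v X (j, σ) * coordDot u v' X (j, σ)

lemma coordDot_frameCoords {v : EuclideanSpace ℝ (Fin n)} (hv : perp u v = 0)
    (A : (Fin m × Fin 2) × Fin n → ℝ) (r : Fin m × Fin 2) :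
    coordDot u v (frameCoords u A) r = rdot A r v := by
  conv_rhs => rw [eq_proj hv]
  rw [rdot_proj, coordDot]

lemma coordQuad_frameCoords {v v' : EuclideanSpace ℝ (Fin n)} (hv : perp u v = 0)
    (hv' : perp u v' = 0) (A : (Fin m × Fin 2) × Fin n → ℝ) (j : Fin m) :
    coordQuad u v v' (frameCoords u A) j = quad A j v v' := by
  simp only [coordQuad, quad, coordDot_frameCoords hv, coordDot_frameCoords hv']

lemma measurable_coordDot (v : EuclideanSpace ℝ (Fin n)) (r : Fin m × Fin 2) :
    Measurable fun X : (Fin m × Fin 2) × Fin d → ℝ => coordDot u v X r :=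
  Finset.measurable_sum _ fun _ _ => (measurable_pi_apply _).const_mul _

lemma measurable_coordQuad (v v' : EuclideanSpace ℝ (Fin n)) (j : Fin m) :
    Measurable fun X : (Fin m × Fin 2) × Fin d → ℝ => coordQuad u v v' X j :=
  Finset.measurable_sum _ fun _ _ => (measurable_coordDot _ _).mul (measurable_coordDot _ _)

/-- The parameter `η² / V` in `noise_tail` turns its bound into `(η m)²`, and Cauchy–Schwarz on a
support of size `2 s` passes from coordinates to sparse test vectors. -/
lemma noise_bound_tail (hu : Orthonormal ℝ u) (hd : d ≤ 3) {s : ℕ} (hs : 0 < s)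
    (hsn : 2 * s ≤ n) {η V : ℝ} (hη : 0 < η) (hV : 0 < V) (hm : 0 < m)
    (hms : 200 * V / η ^ 2 * s * Real.log ((n : ℝ) / s) ≤ m)
    (κ : ((Fin m × Fin 2) × Fin d → ℝ) → Fin m × Fin 2 → ℝ) (hκ : ∀ r, Measurable fun X => κ X r) :
    gv ((Fin m × Fin 2) × Fin n) {A | ∑ r, κ (frameCoords u A) r ^ 2 ≤ V * m ∧
      ¬ ∀ v, (supp v).card ≤ 2 * s →
        |∑ r, κ (frameCoords u A) r * rdot A r (perp u v)| ≤ η * m * ‖v‖} ≤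
      ENNReal.ofReal (400 * V / η ^ 2 / m) := by
  have hm' : (0 : ℝ) < m := by exact_mod_cast hm
  have h1 := noise_tail hu hd hs hsn (η := η ^ 2 / V) (by positivity) hV hm
    (by rwa [div_div_eq_mul_div]) κ hκ
  rw [div_div_eq_mul_div] at h1
  refine (measure_mono ?_).trans h1
  rintro A ⟨hA, hnot⟩
  refine ⟨hA, ?_⟩
  by_contra hc
  push Not at hc
  apply hnot
  intro v hv
  set L : EuclideanSpace ℝ (Fin n) →ₗ[ℝ] ℝ :=
    { toFun := fun v => ∑ r, κ (frameCoords u A) r * rdot A r (perp u v)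
      map_add' := fun v v' => by
        simp only [perp_add, rdot_add, mul_add, Finset.sum_add_distrib]
      map_smul' := fun c v => by
        simp only [perp_smul, rdot_smul, RingHom.id_apply, smul_eq_mul, Finset.mul_sum]
        exact Finset.sum_congr rfl fun r _ => by ring } with hL
  refine sparse_test hsn (L := L) (c := η * m) (by positivity) (fun T hT => ?_) hv
  refine (hc T hT).le.trans (le_of_eq ?_)
  field_simp

/-- Conditions on the rows used to control the gradient step from `z`. -/
def GradGood (u : Fin d → EuclideanSpace ℝ (Fin n)) (x z : EuclideanSpace ℝ (Fin n)) (η : ℝ)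
    (s : ℕ) (A : (Fin m × Fin 2) × Fin n → ℝ) : Prop :=
  ∀ t, (supp t).card ≤ 2 * s → |∑ j, (quad A j z z - quad A j x x) * quad A j z (perp u t)| ≤
    η * m * (‖z - x‖ * ‖t‖)

/-- The weights of the rows in the gradient of the loss. -/
noncomputable def gradWeight (u : Fin d → EuclideanSpace ℝ (Fin n))
    (x z : EuclideanSpace ℝ (Fin n)) (X : (Fin m × Fin 2) × Fin d → ℝ) (r : Fin m × Fin 2) : ℝ :=
  (coordQuad u z z X r.1 - coordQuad u x x X r.1) * coordDot u z X r

lemma measurable_gradWeight (x z : EuclideanSpace ℝ (Fin n)) (r : Fin m × Fin 2) :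
    Measurable fun X : (Fin m × Fin 2) × Fin d → ℝ => gradWeight u x z X r :=
  ((measurable_coordQuad _ _ _).sub (measurable_coordQuad _ _ _)).mul (measurable_coordDot _ _)

lemma gradWeight_frameCoords {x z : EuclideanSpace ℝ (Fin n)} (hx : perp u x = 0)
    (hz : perp u z = 0) (A : (Fin m × Fin 2) × Fin n → ℝ) (r : Fin m × Fin 2) :
    gradWeight u x z (frameCoords u A) r = (quad A r.1 z z - quad A r.1 x x) * rdot A r z := by
  simp only [gradWeight, coordQuad_frameCoords hx hx, coordQuad_frameCoords hz hz,
    coordDot_frameCoords hz]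

/-- The gradient is a linear combination of the rows with weights that depend only on the frame
coordinates. Both the noise bound and the conditioning argument for the support rest on this. -/
lemma sum_gradWeight_mul {x z : EuclideanSpace ℝ (Fin n)} (hx : perp u x = 0)
    (hz : perp u z = 0) (A : (Fin m × Fin 2) × Fin n → ℝ) (v : EuclideanSpace ℝ (Fin n)) :
    ∑ r, gradWeight u x z (frameCoords u A) r * rdot A r v =
      ∑ j, (quad A j z z - quad A j x x) * quad A j z v := by
  rw [Fintype.sum_prod_type]
  refine Finset.sum_congr rfl fun j _ => ?_
  rw [quad.eq_1 A j z v, Finset.mul_sum]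
  refine Finset.sum_congr rfl fun σ _ => ?_
  rw [gradWeight_frameCoords hx hz]
  ring

/-- A difference of squares is the form at `z - x` and `z + x`, so it is linear in the error; the
gradient noise is thereby proportional to the error. -/
lemma abs_quad_sub_quad_le (hu : Orthonormal ℝ u) {x z : EuclideanSpace ℝ (Fin n)}
    (hx : perp u x = 0) (hz : perp u z = 0) (hx1 : ‖x‖ = 1) (hzx : ‖z - x‖ ≤ 1)
    (A : (Fin m × Fin 2) × Fin n → ℝ) (j : Fin m) :
    |quad A j z z - quad A j x x| ≤ 3 * (blockSq (frameCoords u A) j * ‖z - x‖) := by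
  have h0 : perp u (z - x) = 0 := by rw [perp_sub, hx, hz, sub_zero]
  have h2 : perp u (z + x) = 0 := by rw [perp_add, hx, hz, add_zero]
  have e : quad A j z z - quad A j x x = quad A j (z - x) (z + x) := by
    rw [quad_sub_left, quad_add_right, quad_add_right, quad_comm A j z x]; ring
  have h3 : ‖z + x‖ ≤ 3 := by
    have : z + x = (z - x) + ((2 : ℝ) • x) := by rw [two_smul]; abel
    rw [this]
    refine (norm_add_le _ _).trans ?_
    rw [norm_smul, hx1]; norm_num; linarith
  rw [e]
  refine (abs_quad_le A hu j h0 h2).trans ?_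
  have hb := blockSq_nonneg (frameCoords u A) j
  have : blockSq (frameCoords u A) j * (‖z - x‖ * ‖z + x‖) ≤
      blockSq (frameCoords u A) j * (‖z - x‖ * 3) := by gcongr
  linarith

lemma sum_gradWeight_sq {x z : EuclideanSpace ℝ (Fin n)} (hx : perp u x = 0)
    (hz : perp u z = 0) (A : (Fin m × Fin 2) × Fin n → ℝ) :
    ∑ r, gradWeight u x z (frameCoords u A) r ^ 2 =
      ∑ j, (quad A j z z - quad A j x x) ^ 2 * quad A j z z := by
  rw [Fintype.sum_prod_type]
  refine Finset.sum_congr rfl fun j _ => ?_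
  conv_rhs => rw [quad.eq_1 A j z z]
  simp only [gradWeight_frameCoords hx hz]
  simp only [Fin.sum_univ_two, quad]
  ring

lemma sum_gradWeight_sq_le (hu : Orthonormal ℝ u) {ε : ℝ} {z : EuclideanSpace ℝ (Fin n)}
    (hz : perp u z = 0) (hzx : ‖z - u k₀‖ ≤ 1) {A : (Fin m × Fin 2) × Fin n → ℝ}
    (hg : FrameGood k₀ C ε (frameCoords u A)) :
    ∑ r, gradWeight u (u k₀) z (frameCoords u A) r ^ 2 ≤ 36 * C * ‖z - u k₀‖ ^ 2 * m := by
  have hx := perp_frame hu k₀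
  have hz2 : ‖z‖ ^ 2 ≤ 4 := by
    have h1 : ‖z‖ ≤ ‖z - u k₀‖ + ‖u k₀‖ := by
      simpa using norm_add_le (z - u k₀) (u k₀)
    have h2 : ‖z‖ ≤ 2 := by linarith [hu.1 k₀]
    nlinarith [norm_nonneg z]
  rw [sum_gradWeight_sq hx hz]
  have hterm : ∀ j, (quad A j z z - quad A j (u k₀) (u k₀)) ^ 2 * quad A j z z ≤
      36 * ‖z - u k₀‖ ^ 2 * (blockSq (frameCoords u A) j) ^ 3 := by
    intro j
    have hb := blockSq_nonneg (frameCoords u A) j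
    have h1 := abs_quad_sub_quad_le hu hx hz (hu.1 k₀) hzx A j
    have h2 := quad_self_le A hu j hz
    have h3 := quad_self_nonneg A j z
    have h4 : (quad A j z z - quad A j (u k₀) (u k₀)) ^ 2 ≤
        (3 * (blockSq (frameCoords u A) j * ‖z - u k₀‖)) ^ 2 := by
      rw [← sq_abs]; gcongr
    have h5 : quad A j z z ≤ blockSq (frameCoords u A) j * 4 := h2.trans (by gcongr)
    calc _ ≤ (3 * (blockSq (frameCoords u A) j * ‖z - u k₀‖)) ^ 2 *
          (blockSq (frameCoords u A) j * 4) := by gcongr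
      _ = _ := by ring
  refine (Finset.sum_le_sum fun j _ => hterm j).trans ?_
  rw [← Finset.mul_sum]
  have := hg.sum_le fun j => pow_le_one_add_pow_six (blockSq_nonneg (frameCoords u A) j)
    (k := 3) (by norm_num)
  calc _ ≤ 36 * ‖z - u k₀‖ ^ 2 * (C * m) := by gcongr
    _ = _ := by ring

lemma gradGood_tail (hu : Orthonormal ℝ u) (hd : d ≤ 3) {s : ℕ} (hs : 0 < s)
    (hsn : 2 * s ≤ n) {ε η : ℝ} (hη : 0 < η) (hC : 0 < C) (hm : 0 < m)
    (hms : 7200 * C / η ^ 2 * s * Real.log ((n : ℝ) / s) ≤ m) {z : EuclideanSpace ℝ (Fin n)}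
    (hz : perp u z = 0) (hzx : ‖z - u k₀‖ ≤ 1) :
    gv ((Fin m × Fin 2) × Fin n) {A | FrameGood k₀ C ε (frameCoords u A) ∧
      ¬ GradGood u (u k₀) z η s A} ≤ ENNReal.ofReal (14400 * C / η ^ 2 / m) := by
  have hx := perp_frame hu k₀
  -- Tolerance and variance scale with the error and its square, so the probability does not depend
  -- on it. Positivity of both fails for `z = x`, where the gradient vanishes anyway.
  rcases eq_or_ne (z - u k₀) 0 with h0 | h0
  · have hzx : z = u k₀ := sub_eq_zero.1 h0
    have : {A : (Fin m × Fin 2) × Fin n → ℝ | FrameGood k₀ C ε (frameCoords u A) ∧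
        ¬ GradGood u (u k₀) z η s A} = ∅ := by
      ext A
      simp [GradGood, hzx]
    rw [this, measure_empty]
    exact zero_le
  have hn : 0 < ‖z - u k₀‖ := norm_pos_iff.2 h0
  have e : ∀ a : ℝ, a * (36 * C * ‖z - u k₀‖ ^ 2) / (η * ‖z - u k₀‖) ^ 2 =
      a * 36 * C / η ^ 2 := by
    intro a; field_simp
  have h1 := noise_bound_tail hu hd hs hsn (η := η * ‖z - u k₀‖) (V := 36 * C * ‖z - u k₀‖ ^ 2)
    (by positivity) (by positivity) hm (by rw [e]; norm_num; exact hms)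
    (gradWeight u (u k₀) z) (measurable_gradWeight _ _)
  rw [e, show (400 : ℝ) * 36 = 14400 by norm_num] at h1
  refine (measure_mono ?_).trans h1
  rintro A ⟨hg, hnot⟩
  refine ⟨sum_gradWeight_sq_le hu hz hzx hg, fun hc => hnot fun t ht => ?_⟩
  have := hc t ht
  rw [sum_gradWeight_mul hx hz] at this
  refine this.trans (le_of_eq (by ring))

/-- The weights of the rows in the cross terms of the light Gauss-Newton matrix. -/
noncomputable def crossWeight (u : Fin d → EuclideanSpace ℝ (Fin n))
    (w : EuclideanSpace ℝ (Fin n)) (K : ℝ) (k : Fin d) (X : (Fin m × Fin 2) × Fin d → ℝ)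
    (r : Fin m × Fin 2) : ℝ :=
  lightInd K X r.1 * (coordQuad u w (u k) X r.1 * coordDot u w X r)

/-- Cross terms are linear in the orthogonal part, hence noise with weights fixed by the frame, of
total square at most `16 C m`. Orthogonal terms are the deviation already controlled uniformly by
`lightDev_sup_tail`. -/
lemma lightGood_tail (hu : Orthonormal ℝ u) (hd : d ≤ 3) {s : ℕ} (hs : 0 < s)
    (hsn : 2 * s ≤ n) {ε η : ℝ} (hη : 0 < η) (hC : 0 < C) (hK : 0 < K) (hηK : η ≤ K) (hm : 0 < m)
    (hms : 3200 * C / η ^ 2 * s * Real.log ((n : ℝ) / s) ≤ m)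
    (hms' : 163840 * K ^ 2 / η ^ 2 * s * Real.log ((n : ℝ) / s) ≤ m)
    {w : EuclideanSpace ℝ (Fin n)} (hw : perp u w = 0) (hw2 : ‖w‖ ≤ 2) :
    gv ((Fin m × Fin 2) × Fin n) {A | FrameGood k₀ C ε (frameCoords u A) ∧
      ¬ LightGood u w K η s A} ≤
      ENNReal.ofReal ((19200 * C / η ^ 2 + 32768 * K ^ 2 / η ^ 2) / m) := by
  set B₁ : Fin d → Set ((Fin m × Fin 2) × Fin n → ℝ) := fun k =>
    {A | ∑ r, crossWeight u w K k (frameCoords u A) r ^ 2 ≤ 16 * C * m ∧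
      ¬ ∀ v, (supp v).card ≤ 2 * s →
        |∑ r, crossWeight u w K k (frameCoords u A) r * rdot A r (perp u v)| ≤ η * m * ‖v‖}
  set B₂ : Set ((Fin m × Fin 2) × Fin n → ℝ) := {A | ¬ ∀ (T : Finset (Fin n)), T.card ≤ 2 * s →
      ∀ v v', supp v ⊆ T → supp v' ⊆ T → |lightDev u w K A v v'| ≤ η * m * (‖v‖ * ‖v'‖)}
  have hcw : ∀ k A r, crossWeight u w K k (frameCoords (m := m) u A) r =
      lightInd K (frameCoords u A) r.1 * (quad A r.1 w (u k) * rdot A r w) := by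
    intro k A r
    rw [crossWeight, coordQuad_frameCoords hw (perp_frame hu k), coordDot_frameCoords hw]
  have hsub : {A : (Fin m × Fin 2) × Fin n → ℝ | FrameGood k₀ C ε (frameCoords u A) ∧
      ¬ LightGood u w K η s A} ⊆ (⋃ k ∈ Finset.univ, B₁ k) ∪ B₂ := by
    rintro A ⟨hg, hnot⟩
    by_contra hc
    simp only [Set.mem_union, Set.mem_iUnion, Finset.mem_univ, exists_true_left, not_or,
      not_exists, B₁, B₂, Set.mem_ofPred_eq, not_and, not_not] at hc
    refine hnot ⟨fun k v hv => ?_, hc.2⟩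
    have hsq : ∑ r, crossWeight u w K k (frameCoords u A) r ^ 2 ≤ 16 * C * m := by
      rw [Fintype.sum_prod_type]
      have hterm : ∀ j, ∑ σ, crossWeight u w K k (frameCoords u A) (j, σ) ^ 2 ≤
          16 * blockSq (frameCoords u A) j ^ 3 := by
        intro j
        have hb := blockSq_nonneg (frameCoords u A) j
        have h1 := abs_quad_le A hu j hw (perp_frame hu k)
        have h2 := quad_self_le A hu j hw
        have h3 := quad_self_nonneg A j w
        have hw4 : ‖w‖ ^ 2 ≤ 4 := by nlinarith [norm_nonneg w]
        have e : ∑ σ, crossWeight u w K k (frameCoords u A) (j, σ) ^ 2 =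
            lightInd K (frameCoords u A) j ^ 2 * (quad A j w (u k) ^ 2 * quad A j w w) := by
          simp only [hcw]
          conv_rhs => rw [quad.eq_1 A j w w]
          simp only [Fin.sum_univ_two]
          ring
        have h4 : quad A j w (u k) ^ 2 ≤ (blockSq (frameCoords u A) j * 2) ^ 2 := by
          rw [← sq_abs]
          have : |quad A j w (u k)| ≤ blockSq (frameCoords u A) j * 2 := by
            rw [hu.1 k, mul_one] at h1
            exact h1.trans (by gcongr)
          gcongr
        have h5 : quad A j w w ≤ blockSq (frameCoords u A) j * 4 := h2.trans (by gcongr)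
        have h6 : lightInd K (frameCoords u A) j ^ 2 ≤ 1 := by
          rcases lightInd_eq_zero_or_one K (frameCoords u A) j with h | h <;> rw [h] <;> norm_num
        rw [e]
        calc _ ≤ 1 * ((blockSq (frameCoords u A) j * 2) ^ 2 *
              (blockSq (frameCoords u A) j * 4)) := by gcongr
          _ = _ := by ring
      refine (Finset.sum_le_sum fun j _ => hterm j).trans ?_
      rw [← Finset.mul_sum]
      have := hg.sum_le fun j => pow_le_one_add_pow_six (blockSq_nonneg (frameCoords u A) j)
        (k := 3) (by norm_num)
      linarith
    have := hc.1 k hsq v hv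
    convert this using 2
    rw [Fintype.sum_prod_type]
    refine Finset.sum_congr rfl fun j _ => ?_
    simp only [hcw]
    rw [quad.eq_1 A j w (perp u v), Finset.mul_sum, Finset.mul_sum]
    exact Finset.sum_congr rfl fun σ _ => by ring
  have p1 : ∀ k ∈ Finset.univ, gv ((Fin m × Fin 2) × Fin n) (B₁ k) ≤
      ENNReal.ofReal (6400 * C / η ^ 2 / m) := by
    intro k _
    refine (noise_bound_tail hu hd hs hsn (η := η) (V := 16 * C) hη (by positivity) hm
      (by rw [← mul_assoc]; norm_num; exact hms) (crossWeight u w K k)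
      (fun r => (measurable_lightInd K r.1).mul ((measurable_coordQuad _ _ _).mul
        (measurable_coordDot _ _)))).trans_eq ?_
    congr 2
    ring
  refine (measure_mono hsub).trans ((measure_union_le _ _).trans
    ((add_le_add ((measure_biUnion_finset_le _ _).trans (Finset.sum_le_sum p1))
      (lightDev_sup_tail hu hs hsn hK hw hw2 hη hηK hm hms')).trans ?_))
  rw [Finset.sum_const, Finset.card_univ, Fintype.card_fin, nsmul_eq_mul,
    ← ENNReal.ofReal_natCast, ← ENNReal.ofReal_mul (by positivity),
    ← ENNReal.ofReal_add (by positivity) (by positivity)]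
  apply ENNReal.ofReal_le_ofReal
  have hd' : (d : ℝ) ≤ 3 := by exact_mod_cast hd
  have hp : 0 ≤ 6400 * C / η ^ 2 / m := by positivity
  calc _ ≤ 3 * (6400 * C / η ^ 2 / m) + 32768 * K ^ 2 / η ^ 2 / m := by gcongr
    _ = _ := by ring

end GraHTP

/-! ### Lower bound for the weights of the rows in the gradient. -/

namespace GraHTP

variable {n m d : ℕ} {u : Fin d → EuclideanSpace ℝ (Fin n)} {k₀ : Fin d} {C K : ℝ}

lemma norm_sq_eq_frame (hu : Orthonormal ℝ u) {h : EuclideanSpace ℝ (Fin n)}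
    (hh : perp u h = 0) : ‖h‖ ^ 2 = ∑ k, inner ℝ (u k) h ^ 2 := by
  have := inner_eq_frame hu h h
  rw [real_inner_self_eq_norm_sq, hh, inner_zero_left, add_zero] at this
  rw [this]
  exact Finset.sum_congr rfl fun k _ => by ring

/-- The limiting covariance in the frame is at least one half, and `9 ε` is the entrywise error
times the squared bound `3 ‖h‖` on the sum of the absolute coordinates. -/
lemma sum_quad_sq_ge (hu : Orthonormal ℝ u) (hd : d ≤ 3) {ε : ℝ} (hε : 0 ≤ ε)
    {A : (Fin m × Fin 2) × Fin n → ℝ} (hg : FrameGood k₀ C ε (frameCoords u A))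
    {h : EuclideanSpace ℝ (Fin n)} (hh : perp u h = 0) :
    (1 / 2 - 9 * ε) * m * ‖h‖ ^ 2 ≤ ∑ j, quad A j (u k₀) h ^ 2 := by
  set a : Fin d → ℝ := fun k => inner ℝ (u k) h with ha
  have e1 : ∀ j, quad A j (u k₀) h = ∑ k, a k * quad A j (u k₀) (u k) := by
    intro j
    conv_lhs => rw [eq_proj hh, proj, quad_sum_right]
    exact Finset.sum_congr rfl fun k _ => by rw [quad_smul_right]
  have e2 := sum_bilinear (fun _ : Fin m => (1 : ℝ)) a a fun j k => quad A j (u k₀) (u k)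
  have e3 : ∑ j, quad A j (u k₀) h ^ 2 = ∑ k, ∑ l, a k * a l *
      ∑ j, quad A j (u k₀) (u k) * quad A j (u k₀) (u l) := by
    simp only [one_mul] at e2
    rw [e2]
    exact Finset.sum_congr rfl fun j _ => by rw [e1, sq]
  have hS := sum_abs_inner_le hu hd h
  have hm0 : (0 : ℝ) ≤ m := Nat.cast_nonneg m
  have hS0 : 0 ≤ ∑ k, |a k| := Finset.sum_nonneg fun _ _ => abs_nonneg _
  have hterm : ∀ k l, a k * a l * (m * (if k = l then (if k = k₀ then 2 else 1 / 2) else 0)) -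
      |a k| * |a l| * (ε * m) ≤
      a k * a l * ∑ j, quad A j (u k₀) (u k) * quad A j (u k₀) (u l) := by
    intro k l
    have h1 := hg.cov_quad k l
    have h2 : |a k * a l * (∑ j, quad A j (u k₀) (u k) * quad A j (u k₀) (u l) -
        m * (if k = l then (if k = k₀ then 2 else 1 / 2) else 0))| ≤ |a k| * |a l| * (ε * m) := by
      rw [abs_mul, abs_mul]
      gcongr
    have := (abs_le.1 h2).1
    linarith
  have hdiag : ∑ k, ∑ l, a k * a l *
      (m * (if k = l then (if k = k₀ then 2 else 1 / 2) else 0)) ≥ 1 / 2 * m * ‖h‖ ^ 2 := by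
    rw [norm_sq_eq_frame hu hh, Finset.mul_sum]
    refine Finset.sum_le_sum fun k _ => ?_
    simp only [mul_ite, mul_zero, Finset.sum_ite_eq, Finset.mem_univ, if_true]
    have hp : 0 ≤ (m : ℝ) * a k ^ 2 := by positivity
    split_ifs
    · change 1 / 2 * (m : ℝ) * a k ^ 2 ≤ _
      linarith
    · change 1 / 2 * (m : ℝ) * a k ^ 2 ≤ _
      linarith
  have hoff : ∑ k, ∑ l, |a k| * |a l| * (ε * m) ≤ 9 * ε * m * ‖h‖ ^ 2 := by
    have : ∑ k, ∑ l, |a k| * |a l| * (ε * m) = (∑ k, |a k|) * (∑ l, |a l|) * (ε * m) := by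
      rw [Finset.sum_mul_sum, Finset.sum_mul]
      exact Finset.sum_congr rfl fun k _ => by rw [Finset.sum_mul]
    rw [this]
    calc _ ≤ (3 * ‖h‖) * (3 * ‖h‖) * (ε * m) := by gcongr
      _ = _ := by ring
  rw [e3]
  have h3 := Finset.sum_le_sum fun k (_ : k ∈ Finset.univ) =>
    Finset.sum_le_sum fun l (_ : l ∈ Finset.univ) => hterm k l
  simp only [Finset.sum_sub_distrib] at h3
  linarith

/-- The weights of the rows in the gradient do not degenerate. -/
lemma sum_gradWeight_sq_ge (hu : Orthonormal ℝ u) (hd : d ≤ 3) (hC : 1 ≤ C)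
    {A : (Fin m × Fin 2) × Fin n → ℝ} (hg : FrameGood k₀ C (1 / 10 ^ 6) (frameCoords u A))
    {z : EuclideanSpace ℝ (Fin n)} (hz : perp u z = 0) (hzx : C * ‖z - u k₀‖ ≤ 1 / 10 ^ 6) :
    1 / (50 * C) * m * ‖z - u k₀‖ ^ 2 ≤ ∑ r, gradWeight u (u k₀) z (frameCoords u A) r ^ 2 := by
  have hx := perp_frame hu k₀
  rw [sum_gradWeight_sq hx hz]
  set x := u k₀ with hxdef
  set h := z - x with hh
  have hp : perp u h = 0 := by rw [hh, perp_sub, hx, hz, sub_zero]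
  have hge := sum_quad_sq_ge hu hd (by norm_num) hg hp
  have hh0 := norm_nonneg h
  have hm0 : (0 : ℝ) ≤ m := Nat.cast_nonneg m
  set b := blockSq (frameCoords u A) with hb
  have hb0 : ∀ j, 0 ≤ b j := blockSq_nonneg _
  -- Threshold for `quad A j z z`. Above it the weight controls the squared residual. Below it the
  -- residual itself is small, being `2 quad A j h z - quad A j h h` with `quad A j h z` bounded by
  -- Cauchy–Schwarz. The value makes the total loss `8 s₀ C` equal to `0.4`, less than half of the
  -- available mass.
  set s₀ : ℝ := 1 / (20 * C) with hs
  have hs0 : 0 < s₀ := by positivity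
  have hterm : ∀ j, s₀ * (2 * quad A j x h ^ 2 - 8 * s₀ * ‖h‖ ^ 2 * b j - 3 * ‖h‖ ^ 4 * b j ^ 2) ≤
      (quad A j z z - quad A j x x) ^ 2 * quad A j z z := by
    intro j
    have hzh : z = x + h := by simp [hh]
    have c1 : quad A j z z - quad A j x x = 2 * quad A j x h + quad A j h h := by
      rw [hzh, quad_add_left, quad_add_right, quad_add_right, quad_comm A j h x]; ring
    have c2 : quad A j z z - quad A j x x = 2 * quad A j h z - quad A j h h := by
      rw [c1, quad_comm A j h z, hzh, quad_add_left]; ring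
    have hhh : quad A j h h ^ 2 ≤ (b j * ‖h‖ ^ 2) ^ 2 := by
      have := quad_self_le A hu j hp
      have h0 := quad_self_nonneg A j h
      gcongr
    have hzz := quad_self_nonneg A j z
    have lower : 2 * quad A j x h ^ 2 - b j ^ 2 * ‖h‖ ^ 4 ≤
        (quad A j z z - quad A j x x) ^ 2 := by
      rw [c1]
      nlinarith [sq_nonneg (quad A j x h + quad A j h h)]
    rcases le_or_gt s₀ (quad A j z z) with hle | hlt
    · have hpos : 0 ≤ 8 * s₀ * ‖h‖ ^ 2 * b j := by have := hb0 j; positivity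
      have hpos2 : 0 ≤ ‖h‖ ^ 4 * b j ^ 2 := by positivity
      calc _ ≤ s₀ * (quad A j z z - quad A j x x) ^ 2 := by gcongr; linarith
        _ ≤ _ := by rw [mul_comm]; gcongr
    · have h1 : quad A j h z ^ 2 ≤ b j * ‖h‖ ^ 2 * s₀ :=
        (quad_sq_le A j h z).trans (mul_le_mul (quad_self_le A hu j hp) hlt.le hzz
          (mul_nonneg (hb0 j) (sq_nonneg _)))
      have h2 : (quad A j z z - quad A j x x) ^ 2 ≤ 8 * s₀ * ‖h‖ ^ 2 * b j +
          2 * (b j ^ 2 * ‖h‖ ^ 4) := by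
        rw [c2]
        nlinarith [sq_nonneg (2 * quad A j h z + quad A j h h)]
      have h3 : 2 * quad A j x h ^ 2 - 8 * s₀ * ‖h‖ ^ 2 * b j - 3 * ‖h‖ ^ 4 * b j ^ 2 ≤ 0 := by
        linarith
      have h4 : 0 ≤ (quad A j z z - quad A j x x) ^ 2 * quad A j z z := by positivity
      nlinarith
  have hsum := Finset.sum_le_sum fun j (_ : j ∈ Finset.univ) => hterm j
  rw [← Finset.mul_sum, Finset.sum_sub_distrib, Finset.sum_sub_distrib, ← Finset.mul_sum,
    ← Finset.mul_sum, ← Finset.mul_sum] at hsum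
  have m1 : ∑ j, b j ≤ C * m := hg.sum_le fun j => by
    simpa using pow_le_one_add_pow_six (hb0 j) (k := 1) (by norm_num)
  have m2 : ∑ j, b j ^ 2 ≤ C * m :=
    hg.sum_le fun j => pow_le_one_add_pow_six (hb0 j) (k := 2) (by norm_num)
  refine le_trans ?_ hsum
  have e0 : 8 * s₀ * ‖h‖ ^ 2 * ∑ j, b j ≤ 8 * s₀ * ‖h‖ ^ 2 * (C * m) := by gcongr
  have e1 : 8 * s₀ * ‖h‖ ^ 2 * (C * m) = 0.4 * (m * ‖h‖ ^ 2) := by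
    rw [hs]; field_simp; ring
  have e2 : 3 * ‖h‖ ^ 4 * ∑ j, b j ^ 2 ≤ 3 * ‖h‖ ^ 4 * (C * m) := by gcongr
  have hh1 : ‖h‖ ≤ 1 := by nlinarith
  have e3 : 3 * ‖h‖ ^ 4 * (C * m) ≤ 0.01 * (m * ‖h‖ ^ 2) := by
    have : C * ‖h‖ ^ 2 ≤ 1 / 10 ^ 6 := by nlinarith
    calc 3 * ‖h‖ ^ 4 * (C * m) = 3 * (m * ‖h‖ ^ 2) * (C * ‖h‖ ^ 2) := by ring
      _ ≤ 3 * (m * ‖h‖ ^ 2) * (1 / 10 ^ 6) := by gcongr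
      _ ≤ _ := by
        have : 0 ≤ m * ‖h‖ ^ 2 := by positivity
        linarith
  have hmh : 0 ≤ m * ‖h‖ ^ 2 := by positivity
  have e4 : 0.4 * (m * ‖h‖ ^ 2) ≤ 2 * ∑ j, quad A j x h ^ 2 - 8 * s₀ * ‖h‖ ^ 2 * ∑ j, b j -
      3 * ‖h‖ ^ 4 * ∑ j, b j ^ 2 := by nlinarith
  calc 1 / (50 * C) * m * ‖h‖ ^ 2 = s₀ * (0.4 * (m * ‖h‖ ^ 2)) := by
        rw [hs]; field_simp; ring
    _ ≤ _ := by gcongr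

end GraHTP

/-! ### The heavy rows tested against a fixed vector. -/

namespace GraHTP

section fluctuation
variable {R : Type*} [Fintype R]

/-- Chebyshev bound for a linear form of a Gaussian vector. -/
lemma linear_gauss_tail (θ : R → ℝ) {c V : ℝ} (hc : 0 < c) (hV : ∑ r, θ r ^ 2 ≤ V) :
    gv R {g | c ≤ |∑ r, θ r * g r|} ≤ ENNReal.ofReal (V / c ^ 2) := by
  have hL : ∀ r, MemLp (fun x : ℝ => θ r * x) 2 (gaussianReal 0 (1 / 2)) := fun r =>
    (memLp_id_gaussianReal' 2 (by simp)).const_mul (θ r)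
  have hvar : ∀ r, Var[fun x : ℝ => θ r * x; gaussianReal 0 (1 / 2)] ≤ θ r ^ 2 := by
    intro r
    rw [variance_const_mul, variance_fun_id_gaussianReal]
    push_cast
    nlinarith [sq_nonneg (θ r)]
  have h := chebyshev_pi (gaussianReal 0 (1 / 2)) (fun (r : R) x => θ r * x) hL hc
    ((Finset.sum_le_sum fun r _ => hvar r).trans hV)
  have hz : ∀ r, ∫ y : ℝ, θ r * y ∂(gaussianReal 0 (1 / 2)) = 0 := by
    intro r
    rw [integral_const_mul, integral_id_gaussianReal, mul_zero]
  simp only [hz, Finset.sum_const_zero, sub_zero] at h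
  exact h

/-- Chebyshev bound for a weighted sum of squares of a Gaussian vector. -/
lemma sq_gauss_tail (a : R → ℝ) {c V : ℝ} (hc : 0 < c) (hV : ∑ r, a r ^ 2 ≤ V) :
    gv R {g | c ≤ |∑ r, a r * g r ^ 2 - 1 / 2 * ∑ r, a r|} ≤ ENNReal.ofReal (V / c ^ 2) := by
  have hL : ∀ r, MemLp (fun x : ℝ => a r * x ^ 2) 2 (gaussianReal 0 (1 / 2)) := fun r => by
    have h : HasAllMoments (fun x : ℝ => x) (gaussianReal 0 (1 / 2)) := fun p hp =>
      memLp_id_gaussianReal' p hp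
    exact (h.pow 2).memLp_two.const_mul (a r)
  have hvar : ∀ r, Var[fun x : ℝ => a r * x ^ 2; gaussianReal 0 (1 / 2)] ≤ a r ^ 2 := by
    intro r
    refine (variance_le_expectation_sq (hL r).1).trans ?_
    have : ∀ x : ℝ, ((fun x : ℝ => a r * x ^ 2) ^ 2) x = a r ^ 2 * x ^ 4 := fun x => by
      simp only [Pi.pow_apply]; ring
    simp_rw [this]
    rw [integral_const_mul, integral_pow_four_half]
    nlinarith [sq_nonneg (a r)]
  have h := chebyshev_pi (gaussianReal 0 (1 / 2)) (fun (r : R) x => a r * x ^ 2) hL hc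
    ((Finset.sum_le_sum fun r _ => hvar r).trans hV)
  have hz : ∀ r, ∫ y : ℝ, a r * y ^ 2 ∂(gaussianReal 0 (1 / 2)) = 1 / 2 * a r := by
    intro r
    rw [integral_const_mul, integral_sq_half, mul_comm]
  simp only [hz, ← Finset.mul_sum] at h
  exact h

end fluctuation

variable {n m d : ℕ} {u : Fin d → EuclideanSpace ℝ (Fin n)} {k₀ : Fin d} {C K : ℝ}

/-- The contribution of the heavy rows to the Gauss-Newton matrix. -/
noncomputable def heavySum (u : Fin d → EuclideanSpace ℝ (Fin n)) (w : EuclideanSpace ℝ (Fin n))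
    (K : ℝ) (A : (Fin m × Fin 2) × Fin n → ℝ) (y : EuclideanSpace ℝ (Fin n)) : ℝ :=
  ∑ j, (1 - lightInd K (frameCoords u A) j) * quad A j w y ^ 2

/-- The product of the indicator of the heavy rows and their energies. -/
noncomputable def heavyEnergy (K : ℝ) (X : (Fin m × Fin 2) × Fin d → ℝ) (j : Fin m) : ℝ :=
  (1 - lightInd K X j) * blockSq X j

lemma heavyEnergy_nonneg (X : (Fin m × Fin 2) × Fin d → ℝ) (j : Fin m) :
    0 ≤ heavyEnergy K X j := by
  refine mul_nonneg ?_ (blockSq_nonneg _ _)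
  rcases lightInd_eq_zero_or_one K X j with h | h <;> rw [h] <;> norm_num

lemma heavyEnergy_le (X : (Fin m × Fin 2) × Fin d → ℝ) (j : Fin m) :
    heavyEnergy K X j ≤ blockSq X j := by
  have := blockSq_nonneg X j
  rcases lightInd_eq_zero_or_one K X j with h | h <;> rw [heavyEnergy, h] <;> linarith

/-- On a heavy row `b > K`, so `b ≤ b² / K`: a higher moment buys the small factor `1 / K`. -/
lemma heavyEnergy_le_div (hK : 0 < K) (X : (Fin m × Fin 2) × Fin d → ℝ) (j : Fin m) :
    heavyEnergy K X j ≤ blockSq X j ^ 2 / K := by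
  have hb := blockSq_nonneg X j
  unfold heavyEnergy lightInd
  split_ifs with h
  · simp; positivity
  · push Not at h
    rw [sub_zero, one_mul, le_div_iff₀ hK]
    nlinarith

/-- Heavy sum in terms of a decomposition of the pairings of the rows with `y`. -/
lemma heavySum_le (hu : Orthonormal ℝ u) {w y : EuclideanSpace ℝ (Fin n)} (hw : perp u w = 0)
    (hw2 : ‖w‖ ≤ 2) {A : (Fin m × Fin 2) × Fin n → ℝ} {θ g : Fin m × Fin 2 → ℝ} {ζ ν : ℝ}
    (hy : ∀ r, rdot A r y = rdot A r (proj u y) + (θ r * ζ + ν * g r)) :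
    heavySum u w K A y ≤ 12 * (∑ j, heavyEnergy K (frameCoords u A) j *
        blockSq (frameCoords u A) j * ‖y‖ ^ 2 +
      ζ ^ 2 * ∑ j, heavyEnergy K (frameCoords u A) j * ∑ σ, θ (j, σ) ^ 2 +
      ν ^ 2 * ∑ r, heavyEnergy K (frameCoords u A) r.1 * g r ^ 2) := by
  set X := frameCoords u A with hX
  have hterm : ∀ j, (1 - lightInd K X j) * quad A j w y ^ 2 ≤
      12 * (heavyEnergy K X j * blockSq X j * ‖y‖ ^ 2 +
        ζ ^ 2 * (heavyEnergy K X j * ∑ σ, θ (j, σ) ^ 2) +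
        ν ^ 2 * ∑ σ, heavyEnergy K X j * g (j, σ) ^ 2) := by
    intro j
    have hb := blockSq_nonneg X j
    have hχ : 0 ≤ 1 - lightInd K X j := by
      rcases lightInd_eq_zero_or_one K X j with h | h <;> rw [h] <;> norm_num
    have hpy : perp u (proj u y) = 0 := by
      have h1 := proj_add_perp (u := u) y
      have h2 : perp u (proj u y + perp u y) = perp u (proj u y) + perp u y := by
        rw [perp_add, perp_perp hu]
      rw [h1] at h2
      simpa using h2.symm
    have hpn : ‖proj u y‖ ^ 2 ≤ ‖y‖ ^ 2 := by
      rw [← real_inner_self_eq_norm_sq, inner_proj_proj hu]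
      simpa [sq] using sum_inner_sq_le hu y
    have hw4 : ‖w‖ ^ 2 ≤ 4 := by nlinarith [norm_nonneg w]
    have h1 : quad A j w w ≤ 4 * blockSq X j :=
      (quad_self_le A hu j hw).trans (by rw [mul_comm]; gcongr)
    have h2 : quad A j (proj u y) (proj u y) ≤ blockSq X j * ‖y‖ ^ 2 :=
      (quad_self_le A hu j hpy).trans (by gcongr)
    have h3 : quad A j y y ≤ 3 * (blockSq X j * ‖y‖ ^ 2 + ζ ^ 2 * ∑ σ, θ (j, σ) ^ 2 +
        ν ^ 2 * ∑ σ, g (j, σ) ^ 2) := by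
      have h4 : quad A j y y ≤ 3 * (quad A j (proj u y) (proj u y) + ζ ^ 2 * ∑ σ, θ (j, σ) ^ 2 +
          ν ^ 2 * ∑ σ, g (j, σ) ^ 2) := by
        simp only [quad, Finset.mul_sum, ← Finset.sum_add_distrib]
        refine Finset.sum_le_sum fun σ _ => ?_
        rw [hy]
        generalize rdot A (j, σ) (proj u y) = p
        nlinarith [sq_nonneg (p - θ (j, σ) * ζ), sq_nonneg (p - ν * g (j, σ)),
          sq_nonneg (θ (j, σ) * ζ - ν * g (j, σ))]
      linarith
    have h5 := quad_self_nonneg A j y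
    calc (1 - lightInd K X j) * quad A j w y ^ 2
        ≤ (1 - lightInd K X j) * (4 * blockSq X j * (3 * (blockSq X j * ‖y‖ ^ 2 +
          ζ ^ 2 * ∑ σ, θ (j, σ) ^ 2 + ν ^ 2 * ∑ σ, g (j, σ) ^ 2))) := by
          refine mul_le_mul_of_nonneg_left ((quad_sq_le A j w y).trans ?_) hχ
          exact mul_le_mul h1 h3 h5 (by positivity)
      _ = _ := by rw [← Finset.mul_sum, heavyEnergy]; ring
  refine (Finset.sum_le_sum fun j _ => hterm j).trans (le_of_eq ?_)
  rw [← Finset.mul_sum, Finset.sum_add_distrib, Finset.sum_add_distrib, ← Finset.mul_sum,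
    ← Finset.mul_sum, Fintype.sum_prod_type]

/-- The combination along `θ` of the modified rows is exactly `γ`, with no trace of `B`; this is
what makes `γ` the conditioning variable. -/
lemma sum_mul_rdot_replaceComb {θ : Fin m × Fin 2 → ℝ} (hθ : ∑ r, θ r ^ 2 = 1) (γ : Fin n → ℝ)
    (B : (Fin m × Fin 2) × Fin n → ℝ) (v : EuclideanSpace ℝ (Fin n)) :
    ∑ r, θ r * rdot (replaceComb θ γ B) r v = ∑ i, γ i * v i := by
  have h : ∀ i, ∑ r, θ r * replaceComb θ γ B (r, i) = γ i := by
    intro i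
    simp only [replaceComb, mul_add, mul_sub, Finset.sum_add_distrib, Finset.sum_sub_distrib]
    have e1 : ∑ r, θ r * (θ r * γ i) = (∑ r, θ r ^ 2) * γ i := by
      rw [Finset.sum_mul]; exact Finset.sum_congr rfl fun r _ => by ring
    have e2 : ∑ r, θ r * (θ r * ∑ r', θ r' * B (r', i)) =
        (∑ r, θ r ^ 2) * ∑ r', θ r' * B (r', i) := by
      rw [Finset.sum_mul]; exact Finset.sum_congr rfl fun r _ => by ring
    rw [e1, e2, hθ]; ring
  simp only [rdot, Finset.mul_sum]
  rw [Finset.sum_comm]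
  refine Finset.sum_congr rfl fun i _ => ?_
  rw [← h i, Finset.sum_mul]
  exact Finset.sum_congr rfl fun r _ => by ring

lemma rdot_replaceComb (θ : Fin m × Fin 2 → ℝ) (γ : Fin n → ℝ)
    (B : (Fin m × Fin 2) × Fin n → ℝ) (r : Fin m × Fin 2) (v : EuclideanSpace ℝ (Fin n)) :
    rdot (replaceComb θ γ B) r v =
      θ r * (∑ i, γ i * v i - ∑ r', θ r' * rdot B r' v) + rdot B r v := by
  have e : ∑ r', θ r' * rdot B r' v = ∑ i, (∑ r', θ r' * B (r', i)) * v i := by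
    simp only [rdot, Finset.mul_sum, Finset.sum_mul]
    rw [Finset.sum_comm]
    exact Finset.sum_congr rfl fun i _ => Finset.sum_congr rfl fun r' _ => by ring
  rw [e, ← Finset.sum_sub_distrib]
  simp only [rdot, replaceComb, Finset.mul_sum, ← Finset.sum_add_distrib]
  exact Finset.sum_congr rfl fun i _ => by rw [← Finset.mul_sum]; ring

/-- For a fixed sparse vector `y`, the heavy sum is small with high probability, given the
coordinates of the rows in the frame and their combination with the weights of the gradient. -/
lemma heavySum_tail (hu : Orthonormal ℝ u) (hn : 0 < n) (hC : 1 ≤ C)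
    (hK : 10 ^ 6 * C ≤ K) (hm : 0 < m) {w y : EuclideanSpace ℝ (Fin n)} (hw : perp u w = 0)
    (hw2 : ‖w‖ ≤ 2) {X : (Fin m × Fin 2) × Fin d → ℝ}
    (hX : ∑ j, (1 + blockSq X j) ^ 6 ≤ C * m)
    {θ : Fin m × Fin 2 → ℝ} (hθ1 : ∑ r, θ r ^ 2 = 1)
    (hθ : ∑ j, heavyEnergy K X j * ∑ σ, θ (j, σ) ^ 2 ≤ 1800 * C ^ 2)
    {γ : Fin n → ℝ} (hγ : (∑ i, γ i * perp u y i) ^ 2 ≤ 1 / (10 ^ 10 * C ^ 2) * m * ‖y‖ ^ 2) :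
    gv ((Fin m × Fin 2) × Fin n) {B | 1 / 10 ^ 4 * m * ‖y‖ ^ 2 <
      heavySum u w K (frameArray u X (replaceComb θ γ B)) y} ≤
      ENNReal.ofReal (10 ^ 13 * C ^ 2 / m) := by
  have hm' : (0 : ℝ) < m := by exact_mod_cast hm
  have hK0 : 0 < K := by linarith
  have hb := blockSq_nonneg X
  have : Nonempty (Fin n) := ⟨⟨0, hn⟩⟩
  obtain ⟨p, hp1, hp⟩ := exists_unit_smul (fun i => perp u y i)
  obtain ⟨ν2, hν2⟩ : ∃ ν2, ν2 = ∑ i, perp u y i ^ 2 := ⟨_, rfl⟩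
  rw [← hν2] at hp
  have hν20 : 0 ≤ ν2 := hν2 ▸ Finset.sum_nonneg fun _ _ => sq_nonneg _
  have hνy : ν2 ≤ ‖y‖ ^ 2 := by
    rw [hν2, ← norm_sq_eq_sum]
    have := norm_perp_le hu y
    gcongr
  have hmp := measurePreserving_row_dot (R := Fin m × Fin 2) hp1
  have mom : ∀ k, k ≤ 6 → ∑ j, blockSq X j ^ k ≤ C * m := fun k hk =>
    (Finset.sum_le_sum fun j _ => pow_le_one_add_pow_six (hb j) hk).trans hX
  set a : Fin m × Fin 2 → ℝ := fun r => heavyEnergy K X r.1 with ha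
  -- The factor `C⁻²` offsets the bound `1800 C²` in `hθ`.
  set c₁ : ℝ := √(1 / (10 ^ 10 * C ^ 2) * m) with hc₁
  have hc₁0 : 0 < c₁ := Real.sqrt_pos.2 (by positivity)
  have hc₁sq : c₁ ^ 2 = 1 / (10 ^ 10 * C ^ 2) * m := Real.sq_sqrt (by positivity)
  have ha2 : ∑ r, a r ^ 2 ≤ 2 * C * m := by
    have : ∑ r, a r ^ 2 = 2 * ∑ j, heavyEnergy K X j ^ 2 := by
      rw [Fintype.sum_prod_type, Finset.mul_sum]
      exact Finset.sum_congr rfl fun j _ => by simp [ha]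
    rw [this]
    have h1 : ∑ j, heavyEnergy K X j ^ 2 ≤ ∑ j, blockSq X j ^ 2 := by
      refine Finset.sum_le_sum fun j _ => ?_
      have h1 := heavyEnergy_le (K := K) X j
      have h2 := heavyEnergy_nonneg (K := K) X j
      gcongr
    have := mom 2 (by norm_num)
    linarith
  have ha1 : 1 / 2 * ∑ r, a r ≤ 1 / 10 ^ 6 * m := by
    have : ∑ r, a r = 2 * ∑ j, heavyEnergy K X j := by
      rw [Fintype.sum_prod_type, Finset.mul_sum]
      exact Finset.sum_congr rfl fun j _ => by simp [ha]
    rw [this]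
    have h1 : ∑ j, heavyEnergy K X j ≤ ∑ j, blockSq X j ^ 2 / K :=
      Finset.sum_le_sum fun j _ => heavyEnergy_le_div hK0 X j
    rw [← Finset.sum_div] at h1
    have h2 : (∑ j, blockSq X j ^ 2) / K ≤ 1 / 10 ^ 6 * m := by
      rw [div_le_iff₀ hK0]
      have := mom 2 (by norm_num)
      nlinarith
    linarith
  have ha3 : ∑ j, heavyEnergy K X j * blockSq X j * ‖y‖ ^ 2 ≤ 1 / 10 ^ 6 * m * ‖y‖ ^ 2 := by
    rw [← Finset.sum_mul]
    gcongr
    have h1 : ∑ j, heavyEnergy K X j * blockSq X j ≤ ∑ j, blockSq X j ^ 3 / K := by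
      refine Finset.sum_le_sum fun j _ => ?_
      have := mul_le_mul_of_nonneg_right (heavyEnergy_le_div hK0 X j) (hb j)
      refine this.trans (le_of_eq (by ring))
    rw [← Finset.sum_div] at h1
    refine h1.trans ?_
    rw [div_le_iff₀ hK0]
    have := mom 3 (by norm_num)
    nlinarith
  have t1 := linear_gauss_tail θ hc₁0 hθ1.le
  have t2 := sq_gauss_tail a (c := 1 / 10 ^ 6 * m) (by positivity) ha2
  have hsum := (measure_union_le _ _).trans (add_le_add t1 t2)
  rw [← hmp.map_eq] at hsum
  refine (measure_mono ?_).trans ((Measure.le_map_apply hmp.measurable.aemeasurable _).trans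
    (hsum.trans ?_))
  · intro B hB
    by_contra hc
    simp only [Set.mem_preimage, Set.mem_union, Set.mem_ofPred_eq, not_or, not_le] at hc hB
    obtain ⟨hc1, hc2⟩ := hc
    set g : Fin m × Fin 2 → ℝ := fun r => ∑ i, B (r, i) * p i with hg
    have hBy : ∀ r, rdot B r (perp u y) = √ν2 * g r := by
      intro r
      simp only [rdot, hg, Finset.mul_sum]
      exact Finset.sum_congr rfl fun i _ => by rw [hp i]; ring
    set ζ₁ := ∑ i, γ i * perp u y i
    -- A row paired with `y` has three parts: a frame part, fixed by `X`; a part along `θ` with the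
    -- common scalar `ζ`, which involves `γ`; and an independent Gaussian part `√ν2 * g r`. They are
    -- small respectively by the moments, by the spread of `θ`, and by Chebyshev.
    have key := heavySum_le (K := K) hu hw hw2 (A := frameArray u X (replaceComb θ γ B))
      (y := y) (θ := θ) (g := g) (ζ := ζ₁ - √ν2 * ∑ r, θ r * g r) (ν := √ν2) (by
        intro r
        conv_lhs => rw [← proj_add_perp (u := u) y]
        rw [rdot_add, rdot_frameArray_perp hu, rdot_replaceComb]
        simp only [hBy]
        congr 3
        rw [Finset.mul_sum]
        congr 1
        exact Finset.sum_congr rfl fun r _ => by ring)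
    rw [frameCoords_frameArray hu, Real.sq_sqrt hν20] at key
    have hζ : (ζ₁ - √ν2 * ∑ r, θ r * g r) ^ 2 ≤
        4 * (1 / (10 ^ 10 * C ^ 2) * m * ‖y‖ ^ 2) := by
      have h1 : (∑ r, θ r * g r) ^ 2 ≤ c₁ ^ 2 := by
        rw [← sq_abs]; gcongr
      have h2 : (√ν2 * ∑ r, θ r * g r) ^ 2 ≤ ‖y‖ ^ 2 * c₁ ^ 2 := by
        rw [mul_pow, Real.sq_sqrt hν20]
        gcongr
      rw [hc₁sq] at h2
      nlinarith [sq_nonneg (ζ₁ + √ν2 * ∑ r, θ r * g r)]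
    have hag : ∑ r, a r * g r ^ 2 ≤ 2 / 10 ^ 6 * m := by
      have := (abs_lt.1 hc2).2
      linarith
    have hag0 : 0 ≤ ∑ r, a r * g r ^ 2 :=
      Finset.sum_nonneg fun r _ => mul_nonneg (heavyEnergy_nonneg _ _) (sq_nonneg _)
    have hθ0 : 0 ≤ ∑ j, heavyEnergy K X j * ∑ σ, θ (j, σ) ^ 2 :=
      Finset.sum_nonneg fun j _ => mul_nonneg (heavyEnergy_nonneg _ _)
        (Finset.sum_nonneg fun _ _ => sq_nonneg _)
    have k1 : (ζ₁ - √ν2 * ∑ r, θ r * g r) ^ 2 * ∑ j, heavyEnergy K X j * ∑ σ, θ (j, σ) ^ 2 ≤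
        4 * (1 / (10 ^ 10 * C ^ 2) * m * ‖y‖ ^ 2) * (1800 * C ^ 2) :=
      mul_le_mul hζ hθ hθ0 (by positivity)
    have k1' : 4 * (1 / (10 ^ 10 * C ^ 2) * m * ‖y‖ ^ 2) * (1800 * C ^ 2) =
        7200 / 10 ^ 10 * (m * ‖y‖ ^ 2) := by field_simp; ring
    have k2 : ν2 * ∑ r, heavyEnergy K X r.1 * g r ^ 2 ≤ ‖y‖ ^ 2 * (2 / 10 ^ 6 * m) :=
      mul_le_mul hνy hag hag0 (by positivity)
    have hmy : 0 ≤ m * ‖y‖ ^ 2 := by positivity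
    linarith
  · rw [← ENNReal.ofReal_add (by positivity) (by positivity)]
    apply ENNReal.ofReal_le_ofReal
    rw [hc₁sq]
    have e1 : 1 / (1 / (10 ^ 10 * C ^ 2) * m) = 10 ^ 10 * C ^ 2 / m := by field_simp
    have e2 : 2 * C * m / (1 / 10 ^ 6 * m) ^ 2 = 2 * 10 ^ 12 * C / m := by field_simp
    rw [e1, e2, ← add_div]
    gcongr
    nlinarith

end GraHTP

/-! ### The support selected by the gradient step and the heavy rows on the missed part. -/

namespace GraHTP

variable {n m d : ℕ} {u : Fin d → EuclideanSpace ℝ (Fin n)} {k₀ : Fin d} {C K : ℝ}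

/-- The support of the hard thresholding of a vector without ties. -/
noncomputable def topSet (s : ℕ) (v : Fin n → ℝ) : Finset (Fin n) :=
  Finset.univ.filter fun i => (∑ k, if |v i| < |v k| then 1 else 0) < s ∧ v i ≠ 0

/-- Without ties the kept indices are those with fewer than `s` strictly larger competitors,
whatever the tie-breaking rule. The support becomes a function of the vector; kept zeros are
excluded in `topSet` because they do not belong to the support. -/
lemma supp_eq_topSet {s : ℕ} {v w : EuclideanSpace ℝ (Fin n)} (h : IsHardThreshold s v w)
    (hties : ∀ i k, i ≠ k → |v i| ≠ |v k|) : supp w = topSet s v := by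
  obtain ⟨S, hS, htop, hw⟩ := h
  ext i
  rw [mem_supp, hw, topSet, Finset.mem_filter, ← Finset.card_filter]
  simp only [Finset.mem_univ, true_and]
  by_cases hi : i ∈ S
  · have : (Finset.univ.filter fun k => |v i| < |v k|).card < s := by
      rw [← hS]
      refine Finset.card_lt_card ⟨fun k hk => ?_, fun hc => ?_⟩
      · by_contra hkS
        exact absurd (Finset.mem_filter.1 hk).2 (not_lt.2 (htop i hi k hkS))
      · exact absurd (Finset.mem_filter.1 (hc hi)).2 (lt_irrefl _)
    simp [hi, this]
  · have : s ≤ (Finset.univ.filter fun k => |v i| < |v k|).card := by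
      rw [← hS]
      refine Finset.card_le_card fun k hk => Finset.mem_filter.2 ⟨Finset.mem_univ _, ?_⟩
      exact lt_of_le_of_ne (htop k hk i hi) (hties i k fun h => hi (h ▸ hk))
    simp [hi, this]

lemma measurableSet_topSet_eq {α : Type*} [MeasurableSpace α] {v : α → Fin n → ℝ}
    (hv : ∀ i, Measurable fun x => v x i) (s : ℕ) (S : Finset (Fin n)) :
    MeasurableSet {x | topSet s (v x) = S} := by
  have h : {x | topSet s (v x) = S} = ⋂ i, {x | i ∈ topSet s (v x) ↔ i ∈ S} := by
    ext x
    simp [Finset.ext_iff]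
  rw [h]
  refine MeasurableSet.iInter fun i => ?_
  have hm : MeasurableSet {x | i ∈ topSet s (v x)} := by
    have : {x | i ∈ topSet s (v x)} =
        {x | (∑ k, if |v x i| < |v x k| then 1 else 0) < s} ∩ {x | v x i ≠ 0} := by
      ext x
      simp [topSet]
    rw [this]
    refine MeasurableSet.inter (measurableSet_lt (Finset.measurable_sum _ fun k _ =>
      Measurable.ite (measurableSet_lt (hv i).abs (hv k).abs) measurable_const measurable_const)
      measurable_const) (measurableSet_eq_fun (hv i) measurable_const).compl
  by_cases hi : i ∈ S
  · simpa [hi] using hm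
  · have e : {x | i ∈ topSet s (v x) ↔ i ∈ S} = {x | i ∈ topSet s (v x)}ᶜ := by
      ext x
      simp [hi]
    rw [e]
    exact hm.compl

/-- The coordinates of a gradient step. -/
noncomputable def stepCoord (x z : EuclideanSpace ℝ (Fin n)) (μ : ℝ)
    (A : (Fin m × Fin 2) × Fin n → ℝ) (i : Fin n) : ℝ :=
  z i - μ * (1 / (m : ℝ) * ∑ j, (quad A j z z - quad A j x x) *
    quad A j z (EuclideanSpace.single i 1))

lemma gradient_step_apply (x z : EuclideanSpace ℝ (Fin n)) (μ : ℝ)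
    (A : (Fin m × Fin 2) × Fin n → ℝ) (i : Fin n) :
    (z - μ • gradient (loss (toComplexRows A) (measurements (toComplexRows A) x)) z) i =
      stepCoord x z μ A i := by
  rw [stepCoord, ← inner_gradient_loss, EuclideanSpace.inner_single_right]
  simp

lemma measurable_stepCoord (x z : EuclideanSpace ℝ (Fin n)) (μ : ℝ) (i : Fin n) :
    Measurable fun A : (Fin m × Fin 2) × Fin n → ℝ => stepCoord x z μ A i :=
  measurable_const.sub ((Finset.measurable_sum _ fun j _ => ((measurable_quad j _ _).sub
    (measurable_quad j _ _)).mul (measurable_quad j _ _)).const_mul _ |>.const_mul _)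

lemma measurable_heavySum (w y : EuclideanSpace ℝ (Fin n)) :
    Measurable fun A : (Fin m × Fin 2) × Fin n → ℝ => heavySum u w K A y :=
  Finset.measurable_sum _ fun j _ =>
    (measurable_const.sub ((measurable_lightInd K j).comp measurable_frameCoords)).mul
      ((measurable_quad j _ _).pow_const 2)

/-- The heavy rows are negligible for the part of the solution missed by the gradient step. -/
def HeavyGood (u : Fin d → EuclideanSpace ℝ (Fin n)) (x z w : EuclideanSpace ℝ (Fin n)) (μ K : ℝ)
    (s : ℕ) (A : (Fin m × Fin 2) × Fin n → ℝ) : Prop :=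
  heavySum u w K A (x - restrict (topSet s (stepCoord x z μ A)) x) ≤
    1 / 10 ^ 4 * m * ‖x - restrict (topSet s (stepCoord x z μ A)) x‖ ^ 2

lemma measurableSet_heavyGood (x z w : EuclideanSpace ℝ (Fin n)) (μ : ℝ) (s : ℕ) :
    MeasurableSet {A : (Fin m × Fin 2) × Fin n → ℝ | ¬ HeavyGood u x z w μ K s A} := by
  have h : {A : (Fin m × Fin 2) × Fin n → ℝ | ¬ HeavyGood u x z w μ K s A} =
      ⋃ S : Finset (Fin n), {A | topSet s (stepCoord x z μ A) = S} ∩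
        {A | heavySum u w K A (x - restrict S x) ≤
          1 / 10 ^ 4 * m * ‖x - restrict S x‖ ^ 2}ᶜ := by
    ext A
    simp [HeavyGood]
  rw [h]
  exact MeasurableSet.iUnion fun S =>
    (measurableSet_topSet_eq (measurable_stepCoord x z μ) s S).inter
      (measurableSet_le (measurable_heavySum _ _) measurable_const).compl

lemma supp_sub_restrict_subset (S : Finset (Fin n)) (x : EuclideanSpace ℝ (Fin n)) :
    supp (x - restrict S x) ⊆ supp x := by
  intro i hi
  rw [mem_supp] at hi ⊢
  intro h
  apply hi
  rw [PiLp.sub_apply, restrict_apply, h]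
  simp

/-- Orthogonally to the frame the gradient sees the rows only through their combination along the
normalised weights `θ`, which equals `γ` after the replacement. Given `X` and `γ`, the gradient step
is therefore deterministic. -/
lemma stepCoord_frameArray {x z : EuclideanSpace ℝ (Fin n)} (hu : Orthonormal ℝ u)
    (hx : perp u x = 0) (hz : perp u z = 0) (μ : ℝ) {X : (Fin m × Fin 2) × Fin d → ℝ}
    {θ : Fin m × Fin 2 → ℝ} (hθ1 : ∑ r, θ r ^ 2 = 1) {c : ℝ}
    (hθ : ∀ r, gradWeight u x z X r = c * θ r) (γ : Fin n → ℝ)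
    (B B' : (Fin m × Fin 2) × Fin n → ℝ) :
    stepCoord x z μ (frameArray u X (replaceComb θ γ B)) =
      stepCoord x z μ (frameArray u X (replaceComb θ γ B')) := by
  have h : ∀ B i, stepCoord x z μ (frameArray u X (replaceComb θ γ B)) i =
      z i - μ * (1 / (m : ℝ) * (∑ r, gradWeight u x z X r *
        ∑ k, inner ℝ (u k) (EuclideanSpace.single i (1 : ℝ)) * X (r, k) +
        c * ∑ l, γ l * perp u (EuclideanSpace.single i 1) l)) := by
    intro B i
    rw [stepCoord, ← sum_gradWeight_mul hx hz, frameCoords_frameArray hu]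
    congr 3
    simp only [rdot_frameArray, mul_add, Finset.sum_add_distrib]
    congr 1
    rw [← sum_mul_rdot_replaceComb hθ1 γ B, Finset.mul_sum]
    exact Finset.sum_congr rfl fun r _ => by rw [hθ]; ring
  ext i
  rw [h, h]

/-- Two successive conditionings, on the frame coordinates and on `γ`, freeze the selected support
and hence the missed part `y`. The residual randomness `B` then meets a fixed vector and
`heavySum_tail` applies, with no union over supports. The dependence of `γ` on nothing but the past
is harmless, since `γ` is small on all sparse sets. -/
lemma heavyGood_tail (hu : Orthonormal ℝ u) (hd : d ≤ 3) {s : ℕ} (hs : 0 < s)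
    (hsn : 2 * s ≤ n) (hC : 1 ≤ C) (hK : 10 ^ 6 * C ≤ K) (hm : 0 < m)
    (hms : 2 * 10 ^ 12 * C ^ 2 * s * Real.log ((n : ℝ) / s) ≤ m) {z w : EuclideanSpace ℝ (Fin n)}
    (hx : IsSparse s (u k₀)) (hz : perp u z = 0) (hzx : C * ‖z - u k₀‖ ≤ 1 / 10 ^ 6)
    (hzx0 : z ≠ u k₀) (hw : perp u w = 0) (hw2 : ‖w‖ ≤ 2) (μ : ℝ) :
    gv ((Fin m × Fin 2) × Fin n) {A | ¬ HeavyGood u (u k₀) z w μ K s A} ≤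
      gv ((Fin m × Fin 2) × Fin d) {X | ¬ FrameGood k₀ C (1 / 10 ^ 6) X} +
      ENNReal.ofReal (2 * 10 ^ 13 * C ^ 2 / m) := by
  classical
  have hm' : (0 : ℝ) < m := by exact_mod_cast hm
  have hxp := perp_frame hu k₀
  have hmeas := measurableSet_heavyGood (m := m) (u := u) (K := K) (u k₀) z w μ s
  refine gv_le_of_frame hu hmeas _ fun X hX => ?_
  simp only [Set.mem_ofPred_eq, not_not] at hX
  have hXm : ∑ j, (1 + blockSq X j) ^ 6 ≤ C * m := hX.moment
  have hb := blockSq_nonneg X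
  have : Nonempty (Fin m × Fin 2) := ⟨(⟨0, hm⟩, 0)⟩
  obtain ⟨θ, hθ1, hθ⟩ := exists_unit_smul (gradWeight u (u k₀) z X)
  set A₀ := frameArray u X (0 : (Fin m × Fin 2) × Fin n → ℝ) with hA₀
  have hA₀X : frameCoords u A₀ = X := frameCoords_frameArray hu X 0
  have hA₀g : FrameGood k₀ C (1 / 10 ^ 6) (frameCoords u A₀) := by rw [hA₀X]; exact hX
  have hge := sum_gradWeight_sq_ge hu hd hC hA₀g hz hzx
  rw [hA₀X] at hge
  have hn0 : 0 < ‖z - u k₀‖ := norm_pos_iff.2 (sub_ne_zero.2 hzx0)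
  have hzx1 : ‖z - u k₀‖ ≤ 1 := by nlinarith
  obtain ⟨W, hW⟩ : ∃ W, W = ∑ r, gradWeight u (u k₀) z X r ^ 2 := ⟨_, rfl⟩
  rw [← hW] at hge hθ
  have hWpos : 0 < W := lt_of_lt_of_le (by positivity) hge
  -- Each block of unnormalised weights is at most `36 ‖z - x‖² b³`, while their total `W` is at
  -- least `m ‖z - x‖² / (50 C)`. The error cancels in the quotient, leaving `36 · 50 · C²`.
  have hθsum : ∑ j, heavyEnergy K X j * ∑ σ, θ (j, σ) ^ 2 ≤ 1800 * C ^ 2 := by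
    have hblock : ∀ j, W * ∑ σ, θ (j, σ) ^ 2 ≤ 36 * ‖z - u k₀‖ ^ 2 * blockSq X j ^ 3 := by
      intro j
      have e : W * ∑ σ, θ (j, σ) ^ 2 =
          (quad A₀ j z z - quad A₀ j (u k₀) (u k₀)) ^ 2 * quad A₀ j z z := by
        rw [quad.eq_1 A₀ j z z, Finset.mul_sum, Finset.mul_sum]
        refine Finset.sum_congr rfl fun σ _ => ?_
        have h1 : W * θ (j, σ) ^ 2 = gradWeight u (u k₀) z X (j, σ) ^ 2 := by
          rw [hθ, mul_pow, Real.sq_sqrt hWpos.le]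
        rw [h1, ← hA₀X, gradWeight_frameCoords hxp hz, quad.eq_1 A₀ j z z]
        ring
      have h1 := abs_quad_sub_quad_le hu hxp hz (hu.1 k₀) hzx1 A₀ j
      have h2 := quad_self_le A₀ hu j hz
      have h3 := quad_self_nonneg A₀ j z
      rw [hA₀X] at h1 h2
      have hz2 : ‖z‖ ^ 2 ≤ 4 := by
        have h1 : ‖z‖ ≤ ‖z - u k₀‖ + ‖u k₀‖ := by
          simpa using norm_add_le (z - u k₀) (u k₀)
        have h2 : ‖z‖ ≤ 2 := by linarith [hu.1 k₀]
        nlinarith [norm_nonneg z]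
      have h4 : (quad A₀ j z z - quad A₀ j (u k₀) (u k₀)) ^ 2 ≤
          (3 * (blockSq X j * ‖z - u k₀‖)) ^ 2 := by
        rw [← sq_abs]; gcongr
      have hbj := hb j
      have h5 : quad A₀ j z z ≤ blockSq X j * 4 := h2.trans (by gcongr)
      rw [e]
      calc _ ≤ (3 * (blockSq X j * ‖z - u k₀‖)) ^ 2 * (blockSq X j * 4) := by gcongr
        _ = _ := by ring
    have h1 : W * ∑ j, heavyEnergy K X j * ∑ σ, θ (j, σ) ^ 2 ≤
        36 * ‖z - u k₀‖ ^ 2 * (C * m) := by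
      have mom : ∑ j, blockSq X j ^ 4 ≤ C * m :=
        (Finset.sum_le_sum fun j _ => pow_le_one_add_pow_six (hb j) (by norm_num)).trans hXm
      calc _ = ∑ j, heavyEnergy K X j * (W * ∑ σ, θ (j, σ) ^ 2) := by
            rw [Finset.mul_sum]; exact Finset.sum_congr rfl fun j _ => by ring
        _ ≤ ∑ j, 36 * ‖z - u k₀‖ ^ 2 * blockSq X j ^ 4 := by
            refine Finset.sum_le_sum fun j _ => ?_
            have hbj := hb j
            have := mul_le_mul (heavyEnergy_le (K := K) X j) (hblock j)
              (mul_nonneg hWpos.le (Finset.sum_nonneg fun _ _ => sq_nonneg _)) hbj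
            refine this.trans (le_of_eq (by ring))
        _ ≤ _ := by rw [← Finset.mul_sum]; gcongr
    have h2 : 36 * ‖z - u k₀‖ ^ 2 * (C * m) ≤ W * (1800 * C ^ 2) := by
      calc 36 * ‖z - u k₀‖ ^ 2 * (C * m) =
            (1 / (50 * C) * m * ‖z - u k₀‖ ^ 2) * (1800 * C ^ 2) := by field_simp; ring
        _ ≤ _ := by gcongr
    exact le_of_mul_le_mul_left (h1.trans h2) hWpos
  set η : ℝ := 1 / (10 ^ 10 * C ^ 2) with hη
  have hη0 : 0 < η := by positivity
  have hmeas2 : MeasurableSet {G : (Fin m × Fin 2) × Fin n → ℝ |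
      frameArray u X G ∈ {A | ¬ HeavyGood u (u k₀) z w μ K s A}} :=
    ((measurePreserving_frameArray (m := m) hu).measurable.comp measurable_prodMk_left) hmeas
  refine (gv_le_of_comb (Or.inl hθ1) hmeas2 {γ | ∃ T : Finset (Fin n), T.card = 2 * s ∧
      η * m ≤ ∑ i ∈ T, (perp u (WithLp.toLp 2 γ) i) ^ 2} (b := ENNReal.ofReal
        (10 ^ 13 * C ^ 2 / m)) fun γ hγ => ?_).trans ?_
  · simp only [Set.mem_ofPred_eq, not_exists, not_and, not_le] at hγ
    set S := topSet s (stepCoord (u k₀) z μ (frameArray u X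
      (replaceComb θ γ (0 : (Fin m × Fin 2) × Fin n → ℝ)))) with hS
    have hSB : ∀ B : (Fin m × Fin 2) × Fin n → ℝ, topSet s (stepCoord (u k₀) z μ
        (frameArray u X (replaceComb θ γ B))) = S := by
      intro B
      rw [hS, stepCoord_frameArray hu hxp hz μ hθ1 hθ γ B 0]
    have hysupp : (supp (u k₀ - restrict S (u k₀))).card ≤ 2 * s :=
      (Finset.card_le_card (supp_sub_restrict_subset S _)).trans (hx.trans (by omega))
    set y := u k₀ - restrict S (u k₀)
    have hγy : (∑ i, γ i * perp u y i) ^ 2 ≤ η * m * ‖y‖ ^ 2 := by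
      obtain ⟨T, hT1, hT2⟩ := Finset.exists_superset_card_eq hysupp (by simpa using hsn)
      -- The vector `perp u y` need not be sparse, so the self-adjoint projection is moved to `γ`,
      -- and the sum shrinks to the support of `y`.
      have e1 : ∑ i, γ i * perp u y i = ∑ i ∈ T, perp u (WithLp.toLp 2 γ) i * y i := by
        have a1 := inner_eq_frame hu (perp u (WithLp.toLp 2 γ)) y
        have a2 := inner_eq_frame hu (WithLp.toLp 2 γ) (perp u y)
        simp only [perp_perp hu, inner_frame_perp hu, zero_mul, mul_zero, Finset.sum_const_zero, zero_add] at a1 a2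
        have a3 : inner ℝ (perp u (WithLp.toLp 2 γ)) y = inner ℝ (WithLp.toLp 2 γ) (perp u y) := by
          rw [a2, ← a1, real_inner_comm]
        rw [inner_eq_sum, inner_eq_sum] at a3
        rw [← a3.trans rfl]
        symm
        refine Finset.sum_subset (Finset.subset_univ T) fun i _ hi => ?_
        have : y i = 0 := by
          by_contra h0
          exact hi (hT1 (mem_supp.2 h0))
        rw [this, mul_zero]
      rw [e1]
      refine (Finset.sum_mul_sq_le_sq_mul_sq _ _ _).trans ?_
      refine mul_le_mul (hγ T hT2).le ?_ (Finset.sum_nonneg fun _ _ => sq_nonneg _) (by positivity)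
      rw [norm_sq_eq_sum]
      exact Finset.sum_le_sum_of_subset_of_nonneg (Finset.subset_univ _) fun _ _ _ => sq_nonneg _
    have := heavySum_tail hu (by omega) hC hK hm (y := y) hw hw2 hXm hθ1 hθsum hγy
    refine (measure_mono fun B hB => ?_).trans this
    simp only [Set.mem_ofPred_eq, HeavyGood, hSB, not_le] at hB ⊢
    exact hB
  · have e : 400 / η / (m : ℝ) = 4 * 10 ^ 12 * C ^ 2 / m := by
      rw [hη]; field_simp; norm_num
    have h1 := sparse_gauss_tail hu hd hs hsn hη0 hm (by
      refine le_trans (le_of_eq ?_) hms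
      congr 2
      rw [hη]; field_simp; norm_num)
    rw [e] at h1
    refine (add_le_add_left h1 _).trans ?_
    rw [← ENNReal.ofReal_add (by positivity) (by positivity), ← add_div]
    apply ENNReal.ofReal_le_ofReal
    gcongr
    nlinarith [sq_nonneg C]

end GraHTP

/-! ### Almost sure absence of ties. -/

namespace GraHTP

section line
variable {κ : Type*} [Fintype κ] [DecidableEq κ]

lemma measurePreserving_line {D : κ → ℝ} (hD : ∑ a, D a ^ 2 = 1) :
    MeasurePreserving (fun (p : (κ → ℝ) × (Unit → ℝ)) a =>
      (p.1 a - D a * ∑ b, D b * p.1 b) + D a * p.2 ()) ((gv κ).prod (gv Unit)) (gv κ) := by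
  convert measurePreserving_of_rows_add (κ := κ) (fun (a b : κ) => (if a = b then 1 else 0) - D a * D b)
    (fun (a : κ) (_ : Unit) => D a) ?_ using 1
  · ext p a
    simp only [sub_mul, ite_mul, one_mul, zero_mul, Finset.sum_sub_distrib, Finset.sum_ite_eq,
      Finset.mem_univ, if_true, Finset.univ_unique, Finset.sum_singleton, Finset.mul_sum, mul_assoc]
  · intro a a'
    have h : ∑ b, D a * D b * (D a' * D b) = D a * D a' * ∑ b, D b ^ 2 := by
      rw [Finset.mul_sum]; exact Finset.sum_congr rfl fun b _ => by ring
    simp only [sub_mul, mul_sub, Finset.sum_sub_distrib, ite_mul, one_mul, zero_mul, mul_ite,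
      mul_one, mul_zero, Finset.sum_ite_eq, Finset.mem_univ, if_true, h, hD,
      Finset.univ_unique, Finset.sum_singleton]
    split_ifs <;> ring

/-- A set that meets all the lines in some direction in finite sets is negligible. -/
lemma gv_eq_zero_of_line {D : κ → ℝ} (hD : ∑ a, D a ^ 2 = 1) {W : Set (κ → ℝ)}
    (hW : MeasurableSet W) (h : ∀ E : κ → ℝ, {t : ℝ | (fun a => E a + D a * t) ∈ W}.Finite) :
    gv κ W = 0 := by
  have hmp := measurePreserving_line hD
  rw [← hmp.measure_preimage hW.nullMeasurableSet]
  -- Fubini along direction `D`: on each line the set is finite, and the one-dimensional Gaussian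
  -- law has no atoms.
  have := prod_measure_le (gv κ) (gv Unit) (hmp.measurable hW) ∅ (b := 0) fun G _ => ?_
  · simpa using this
  have hfin := h fun a => G a - D a * ∑ b, D b * G b
  have hc := measurePreserving_coord (κ := Unit) ()
  have : NullSingletonClass (gaussianReal 0 (1 / 2)) := nullSingletonClass_gaussianReal (by norm_num)
  have h0 : gaussianReal 0 (1 / 2) {t : ℝ | (fun a => (G a - D a * ∑ b, D b * G b) + D a * t) ∈ W}
      = 0 := hfin.measure_zero _
  rw [← hc.measure_preimage hfin.measurableSet.nullMeasurableSet] at h0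
  exact h0.le

end line

lemma finite_setOf_quartic {a₄ a₃ a₂ a₁ a₀ : ℝ} (h : a₄ ≠ 0) :
    {t : ℝ | a₄ * t ^ 4 + a₃ * t ^ 3 + a₂ * t ^ 2 + a₁ * t + a₀ = 0}.Finite := by
  classical
  set P : Polynomial ℝ := Polynomial.C a₄ * Polynomial.X ^ 4 + Polynomial.C a₃ * Polynomial.X ^ 3 +
    Polynomial.C a₂ * Polynomial.X ^ 2 + Polynomial.C a₁ * Polynomial.X + Polynomial.C a₀ with hP
  have hP0 : P ≠ 0 := by
    intro h0
    have := congrArg (fun p => Polynomial.coeff p 4) h0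
    simp [hP, Polynomial.coeff_X_pow] at this
    exact h this
  refine (P.roots.toFinset.finite_toSet).subset fun t ht => ?_
  simp only [Finset.mem_coe, Multiset.mem_toFinset, Polynomial.mem_roots hP0, Polynomial.IsRoot]
  simpa [hP] using ht

variable {n m : ℕ}

lemma quad_line (D E : (Fin m × Fin 2) × Fin n → ℝ) (t : ℝ) (j : Fin m)
    (v v' : EuclideanSpace ℝ (Fin n)) :
    quad (fun a => E a + D a * t) j v v' = t ^ 2 * quad D j v v' +
      t * (∑ σ, (rdot D (j, σ) v * rdot E (j, σ) v' + rdot E (j, σ) v * rdot D (j, σ) v')) +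
      quad E j v v' := by
  have h : ∀ r v, rdot (fun a => E a + D a * t) r v = rdot E r v + t * rdot D r v := by
    intro r v
    simp only [rdot, Finset.mul_sum, ← Finset.sum_add_distrib]
    exact Finset.sum_congr rfl fun i _ => by ring
  simp only [quad, h, Finset.mul_sum, ← Finset.sum_add_distrib]
  exact Finset.sum_congr rfl fun σ _ => by ring

/-- The gradient of the loss has no atoms in a nonzero direction. -/
lemma gv_gradient_eq_zero (hm : 0 < m) {x z q : EuclideanSpace ℝ (Fin n)} (hz : z ≠ 0)
    (hq : q ≠ 0) (h1 : z - x ≠ 0) (h2 : z + x ≠ 0) (c : ℝ) :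
    gv ((Fin m × Fin 2) × Fin n)
      {A | ∑ j, (quad A j z z - quad A j x x) * quad A j z q = c} = 0 := by
  classical
  have hmeas : MeasurableSet {A : (Fin m × Fin 2) × Fin n → ℝ |
      ∑ j, (quad A j z z - quad A j x x) * quad A j z q = c} :=
    measurableSet_eq_fun (Finset.measurable_sum _ fun j _ => ((measurable_quad j _ _).sub
      (measurable_quad j _ _)).mul (measurable_quad j _ _)) measurable_const
  -- A functional that vanishes at none of the four vectors. Moving the real part of the first row
  -- along its coefficient vector makes the expression a quartic in the line parameter with leading
  -- coefficient `f (z - x) * f (z + x) * (f z * f q) / ν ^ 4`, which is not zero.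
  obtain ⟨f, hf⟩ := Module.exists_dual_forall_apply_ne_zero (K := ℝ)
    (![z, q, z - x, z + x] : Fin 4 → EuclideanSpace ℝ (Fin n)) (by
      intro i; fin_cases i <;> simpa)
  have f0 : f z ≠ 0 := hf 0
  have f1 : f q ≠ 0 := hf 1
  have f2 : f (z - x) ≠ 0 := hf 2
  have f3 : f (z + x) ≠ 0 := hf 3
  set p : Fin n → ℝ := fun i => f (EuclideanSpace.single i 1) with hp
  have hfp : ∀ v : EuclideanSpace ℝ (Fin n), f v = ∑ i, p i * v i := by
    intro v
    conv_lhs => rw [eq_sum_single v]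
    rw [map_sum]
    exact Finset.sum_congr rfl fun i _ => by rw [map_smul, smul_eq_mul, mul_comm]
  have hp0 : 0 < ∑ i, p i ^ 2 := by
    refine lt_of_le_of_ne (Finset.sum_nonneg fun _ _ => sq_nonneg _) fun h => f0 ?_
    have := (Finset.sum_eq_zero_iff_of_nonneg fun i _ => sq_nonneg (p i)).1 h.symm
    rw [hfp]
    refine Finset.sum_eq_zero fun i hi => ?_
    have h0 : p i = 0 := by simpa using this i hi
    rw [h0, zero_mul]
  set ν := √(∑ i, p i ^ 2) with hν
  have hν0 : 0 < ν := Real.sqrt_pos.2 hp0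
  have hνsq : ν ^ 2 = ∑ i, p i ^ 2 := Real.sq_sqrt hp0.le
  set r₀ : Fin m × Fin 2 := (⟨0, hm⟩, 0) with hr₀
  set D : (Fin m × Fin 2) × Fin n → ℝ := fun a => if a.1 = r₀ then p a.2 / ν else 0 with hD
  have hDr : ∀ r v, rdot D r v = if r = r₀ then f v / ν else 0 := by
    intro r v
    rw [rdot, hfp]
    by_cases hr : r = r₀
    · simp only [hD, hr, if_true, Finset.sum_div]
      exact Finset.sum_congr rfl fun i _ => by ring
    · simp [hD, hr]
  have hD1 : ∑ a, D a ^ 2 = 1 := by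
    rw [Fintype.sum_prod_type]
    simp only [hD, ite_pow]
    rw [Finset.sum_comm]
    simp only [Finset.sum_ite_eq', Finset.mem_univ, if_true, div_pow, hνsq, ne_eq,
      OfNat.ofNat_ne_zero, not_false_eq_true, zero_pow]
    rw [← Finset.sum_div, div_self hp0.ne']
  have hDq : ∀ j v v', quad D j v v' = if j = ⟨0, hm⟩ then f v * f v' / ν ^ 2 else 0 := by
    intro j v v'
    simp only [quad, hDr, hr₀, Prod.mk.injEq, Fin.sum_univ_two]
    by_cases hj : j = ⟨0, hm⟩
    · simp [hj]; ring
    · simp [hj]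
  refine gv_eq_zero_of_line hD1 hmeas fun E => ?_
  set cr : Fin m → EuclideanSpace ℝ (Fin n) → EuclideanSpace ℝ (Fin n) → ℝ := fun j v v' =>
    ∑ σ, (rdot D (j, σ) v * rdot E (j, σ) v' + rdot E (j, σ) v * rdot D (j, σ) v') with hcr
  have key : ∀ t, ∑ j, (quad (fun a => E a + D a * t) j z z - quad (fun a => E a + D a * t) j x x) *
      quad (fun a => E a + D a * t) j z q - c =
      (∑ j, (quad D j z z - quad D j x x) * quad D j z q) * t ^ 4 +
      (∑ j, ((quad D j z z - quad D j x x) * cr j z q + (cr j z z - cr j x x) * quad D j z q)) *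
        t ^ 3 +
      (∑ j, ((quad D j z z - quad D j x x) * quad E j z q + (cr j z z - cr j x x) * cr j z q +
        (quad E j z z - quad E j x x) * quad D j z q)) * t ^ 2 +
      (∑ j, ((cr j z z - cr j x x) * quad E j z q +
        (quad E j z z - quad E j x x) * cr j z q)) * t +
      (∑ j, (quad E j z z - quad E j x x) * quad E j z q - c) := by
    intro t
    simp only [quad_line, Finset.sum_mul, ← Finset.sum_add_distrib, add_sub]
    congr 1
    exact Finset.sum_congr rfl fun j _ => by simp only [hcr]; ring
  have hlead : ∑ j, (quad D j z z - quad D j x x) * quad D j z q ≠ 0 := by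
    have : ∑ j, (quad D j z z - quad D j x x) * quad D j z q =
        f (z - x) * f (z + x) * (f z * f q) / ν ^ 4 := by
      rw [Finset.sum_eq_single (⟨0, hm⟩ : Fin m)]
      · simp only [hDq, if_true, map_sub, map_add]
        field_simp
        ring
      · intro j _ hj
        simp [hDq, hj]
      · simp
    rw [this]
    positivity
  obtain ⟨a₃, a₂, a₁, a₀, key⟩ : ∃ a₃ a₂ a₁ a₀ : ℝ, ∀ t,
      ∑ j, (quad (fun a => E a + D a * t) j z z - quad (fun a => E a + D a * t) j x x) *
        quad (fun a => E a + D a * t) j z q - c =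
      (∑ j, (quad D j z z - quad D j x x) * quad D j z q) * t ^ 4 + a₃ * t ^ 3 + a₂ * t ^ 2 +
        a₁ * t + a₀ := ⟨_, _, _, _, key⟩
  refine (finite_setOf_quartic (a₃ := a₃) (a₂ := a₂) (a₁ := a₁) (a₀ := a₀) hlead).subset fun t ht => ?_
  have h := key t
  rw [sub_eq_zero.2 ht] at h
  exact h.symm

/-- Almost surely the coordinates of a gradient step have different magnitudes. -/
lemma gv_ties_eq_zero (hm : 0 < m) {x z : EuclideanSpace ℝ (Fin n)} {μ : ℝ} (hμ : μ ≠ 0)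
    (hz : z ≠ 0) (h1 : z - x ≠ 0) (h2 : z + x ≠ 0) :
    gv ((Fin m × Fin 2) × Fin n)
      {A | ¬ ∀ i k, i ≠ k → |stepCoord x z μ A i| ≠ |stepCoord x z μ A k|} = 0 := by
  have hm' : (m : ℝ) ≠ 0 := by exact_mod_cast hm.ne'
  set e : Fin n → EuclideanSpace ℝ (Fin n) := fun i => EuclideanSpace.single i 1
  set B : Fin n → Fin n → ℝ → Set ((Fin m × Fin 2) × Fin n → ℝ) := fun i k c =>
    {A | i ≠ k ∧ ∑ j, (quad A j z z - quad A j x x) * quad A j z (e i + c • e k) =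
      (z i + c * z k) * m / μ} with hB
  have hsub : {A : (Fin m × Fin 2) × Fin n → ℝ | ¬ ∀ i k, i ≠ k →
      |stepCoord x z μ A i| ≠ |stepCoord x z μ A k|} ⊆ ⋃ i, ⋃ k, (B i k 1 ∪ B i k (-1)) := by
    intro A hA
    simp only [Set.mem_ofPred_eq, not_forall, not_not] at hA
    obtain ⟨i, k, hik, hA⟩ := hA
    simp only [Set.mem_iUnion]
    refine ⟨i, k, ?_⟩
    -- Equal magnitudes mean that this holds for `c = 1` or `c = -1`, which prescribes the gradient
    -- in the nonzero direction `e i + c • e k`.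
    have hlin : ∀ c : ℝ, stepCoord x z μ A i + c * stepCoord x z μ A k = 0 →
        A ∈ B i k c := by
      intro c hc
      refine ⟨hik, ?_⟩
      simp only [quad_add_right, quad_smul_right, mul_add, Finset.sum_add_distrib]
      simp only [stepCoord] at hc
      have e1 : ∑ j, (quad A j z z - quad A j x x) * (c * quad A j z (e k)) =
          c * ∑ j, (quad A j z z - quad A j x x) * quad A j z (e k) := by
        rw [Finset.mul_sum]; exact Finset.sum_congr rfl fun j _ => by ring
      rw [e1, eq_div_iff hμ]
      field_simp at hc
      linear_combination -hc
    rcases abs_eq_abs.1 hA with h | h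
    · exact Or.inr (hlin (-1) (by rw [h]; ring))
    · exact Or.inl (hlin 1 (by rw [h]; ring))
  refine measure_mono_null hsub (measure_iUnion_null fun i => measure_iUnion_null fun k => ?_)
  have hnull : ∀ c, gv ((Fin m × Fin 2) × Fin n) (B i k c) = 0 := by
    intro c
    by_cases hik : i = k
    · simp [hB, hik]
    · refine measure_mono_null (fun A hA => hA.2) (gv_gradient_eq_zero hm hz (q := e i + c • e k)
        ?_ h1 h2 ((z i + c * z k) * m / μ))
      intro h0
      have := congrArg (fun v : EuclideanSpace ℝ (Fin n) => v i) h0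
      simp [e, hik] at this
  exact measure_union_null (hnull 1) (hnull (-1))

end GraHTP

/-! ### The frame of the data, homogeneity, and one iteration on a good event. -/

namespace GraHTP

variable {n m d : ℕ}

/-- Vectors spanned by a unit vector and two further vectors have an orthonormal frame. -/
lemma exists_frame {x : EuclideanSpace ℝ (Fin n)} (hx : ‖x‖ = 1)
    (z w : EuclideanSpace ℝ (Fin n)) :
    ∃ (d : ℕ) (u : Fin d → EuclideanSpace ℝ (Fin n)) (k₀ : Fin d), d ≤ 3 ∧ Orthonormal ℝ u ∧
      u k₀ = x ∧ perp u z = 0 ∧ perp u w = 0 := by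
  classical
  set B : Finset (EuclideanSpace ℝ (Fin n)) := {x, z, w} with hB
  set V := Submodule.span ℝ (B : Set (EuclideanSpace ℝ (Fin n))) with hV
  have hxV : x ∈ V := Submodule.subset_span (by simp [hB])
  have hzV : z ∈ V := Submodule.subset_span (by simp [hB])
  have hwV : w ∈ V := Submodule.subset_span (by simp [hB])
  -- The basis of the span is built by extending `{x}`, so that `x` itself is a frame vector.
  have ho : Orthonormal ℝ ((↑) : ({(⟨x, hxV⟩ : V)} : Set V) → V) := by
    rw [orthonormal_iff_ite]
    rintro ⟨a, ha⟩ ⟨b, hb⟩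
    rw [Set.mem_singleton_iff] at ha hb
    subst ha hb
    simp [hx]
  obtain ⟨S, b, hS, hb⟩ := ho.exists_orthonormalBasis_extension
  set e := S.equivFin with he
  have hxS : (⟨x, hxV⟩ : V) ∈ S := hS (Set.mem_singleton _)
  refine ⟨S.card, fun k => ((e.symm k : V) : EuclideanSpace ℝ (Fin n)), e ⟨_, hxS⟩, ?_, ?_, ?_, ?_⟩
  · have h1 := Module.finrank_eq_card_basis b.toBasis
    rw [Fintype.card_coe] at h1
    rw [← h1]
    exact (finrank_span_finset_le_card B).trans (Finset.card_le_three)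
  · have h1 := b.orthonormal.comp e.symm e.symm.injective
    rw [hb] at h1
    exact h1.comp_linearIsometry V.subtypeₗᵢ
  · simp
  · have key : ∀ v ∈ V, perp (fun k => ((e.symm k : V) : EuclideanSpace ℝ (Fin n))) v = 0 := by
      intro v hv
      have h1 := b.sum_repr' ⟨v, hv⟩
      rw [hb] at h1
      have h2 := congrArg (Subtype.val) h1
      rw [perp, sub_eq_zero, proj]
      rw [AddSubmonoidClass.coe_finsetSum, ← e.symm.sum_comp] at h2
      exact h2.symm
    exact ⟨key z hzV, key w hwV⟩

section transfer
variable {A : (Fin m × Fin 2) × Fin n → ℝ}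

lemma sdist_smul {b c : ℝ} (h : b = c ∨ b = -c) (v x : EuclideanSpace ℝ (Fin n)) :
    sdist (b • v) (c • x) = |c| * sdist v x := by
  have h1 : ‖c • x - c • v‖ = |c| * ‖x - v‖ := by rw [← smul_sub, norm_smul, Real.norm_eq_abs]
  have h2 : ‖c • x + c • v‖ = |c| * ‖x + v‖ := by rw [← smul_add, norm_smul, Real.norm_eq_abs]
  rcases h with rfl | rfl
  · rw [sdist, h1, h2, sdist, mul_min_of_nonneg _ _ (abs_nonneg _)]
  · rw [sdist, neg_smul, sub_neg_eq_add, ← sub_eq_add_neg, h1, h2, sdist, min_comm,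
      mul_min_of_nonneg _ _ (abs_nonneg _)]

lemma supp_smul {c : ℝ} (hc : c ≠ 0) (v : EuclideanSpace ℝ (Fin n)) : supp (c • v) = supp v := by
  ext i
  simp [mem_supp, hc]

/-- The gradient is homogeneous of degree three and the data ignore the sign of `x`, so `b` and `c`
need only agree in absolute value. A step size `μ` thus becomes `μ c²` after normalisation. -/
lemma gradient_loss_smul {b c : ℝ} (h : b ^ 2 = c ^ 2) (x z : EuclideanSpace ℝ (Fin n)) :
    gradient (loss (toComplexRows A) (measurements (toComplexRows A) (c • x))) (b • z) =
      b ^ 3 • gradient (loss (toComplexRows A) (measurements (toComplexRows A) x)) z := by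
  refine ext_inner_right ℝ fun v => ?_
  rw [real_inner_smul_left, inner_gradient_loss, inner_gradient_loss]
  simp only [quad_smul_left, quad_smul_right]
  rw [mul_left_comm (b ^ 3)]
  congr 1
  rw [Finset.mul_sum]
  refine Finset.sum_congr rfl fun j _ => ?_
  linear_combination (b * quad A j x x * quad A j z v) * h

lemma IsHardThreshold.smul {s : ℕ} {v w : EuclideanSpace ℝ (Fin n)} (h : IsHardThreshold s v w)
    (c : ℝ) : IsHardThreshold s (c • v) (c • w) := by
  obtain ⟨S, hS, htop, hw⟩ := h
  refine ⟨S, hS, fun i hi j hj => ?_, fun i => ?_⟩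
  · simp only [PiLp.smul_apply, smul_eq_mul, abs_mul]
    exact mul_le_mul_of_nonneg_left (htop i hi j hj) (abs_nonneg _)
  · simp [hw]

lemma IsGradientStep.of_smul {s : ℕ} {μ b c : ℝ} (hb : b ≠ 0) (h : b ^ 2 = c ^ 2)
    {x z v : EuclideanSpace ℝ (Fin n)}
    (hv : IsGradientStep (toComplexRows A) (measurements (toComplexRows A) (c • x)) s μ (b • z) v) :
    IsGradientStep (toComplexRows A) (measurements (toComplexRows A) x) s (μ * c ^ 2) z
      (b⁻¹ • v) := by
  have h1 := IsHardThreshold.smul hv b⁻¹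
  rw [gradient_loss_smul h] at h1
  rw [IsGradientStep]
  convert h1 using 1
  rw [smul_sub, inv_smul_smul₀ hb, smul_smul, smul_smul, ← h]
  congr 2
  field_simp

lemma gaussNewton_residual (hm : 0 < m) (x w v : EuclideanSpace ℝ (Fin n)) (j : Fin m) :
    (jacobian (toComplexRows A) w).mulVec (v - w).ofLp j +
      resid (toComplexRows A) (measurements (toComplexRows A) x) w j =
      1 / √m * (quad A j w (v - w) + 1 / 2 * (quad A j w w - quad A j x x)) := by
  have hm' : (0 : ℝ) < √m := Real.sqrt_pos.2 (by exact_mod_cast hm)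
  rw [jacobian_mulVec, resid_eq]
  field_simp

lemma IsGaussNewtonStep.of_smul (hm : 0 < m) {S : Finset (Fin n)} {b c : ℝ} (hb : b ≠ 0)
    (h : b ^ 2 = c ^ 2) {x w v : EuclideanSpace ℝ (Fin n)}
    (hv : IsGaussNewtonStep (toComplexRows A) (measurements (toComplexRows A) (c • x)) S
      (b • w) v) :
    IsGaussNewtonStep (toComplexRows A) (measurements (toComplexRows A) x) S w (b⁻¹ • v) := by
  have hres : ∀ v' : EuclideanSpace ℝ (Fin n), ∀ j,
      (jacobian (toComplexRows A) (b • w)).mulVec (b • v' - b • w).ofLp j +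
      resid (toComplexRows A) (measurements (toComplexRows A) (c • x)) (b • w) j =
      b ^ 2 * ((jacobian (toComplexRows A) w).mulVec (v' - w).ofLp j +
      resid (toComplexRows A) (measurements (toComplexRows A) x) w j) := by
    intro v' j
    rw [gaussNewton_residual hm, gaussNewton_residual hm, ← smul_sub]
    simp only [quad_smul_left, quad_smul_right]
    linear_combination (1 / √m * (1 / 2) * quad A j x x) * h
  refine ⟨by rw [supp_smul (inv_ne_zero hb)]; exact hv.1, fun v' hv' => ?_⟩
  have h1 := hv.2 (b • v') (by rw [supp_smul hb]; exact hv')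
  have h2 : v = b • (b⁻¹ • v) := (smul_inv_smul₀ hb v).symm
  rw [h2] at h1
  simp only [hres, mul_pow, ← Finset.mul_sum] at h1
  exact le_of_mul_le_mul_left h1 (by positivity)

end transfer

section deterministic
variable {u : Fin d → EuclideanSpace ℝ (Fin n)} {k₀ : Fin d} {C K : ℝ}
  {A : (Fin m × Fin 2) × Fin n → ℝ}

/-- All the conditions on the rows under which one iteration makes progress. -/
structure StepGood (u : Fin d → EuclideanSpace ℝ (Fin n)) (k₀ : Fin d) (C K μ : ℝ) (s : ℕ)
    (z w : EuclideanSpace ℝ (Fin n)) (A : (Fin m × Fin 2) × Fin n → ℝ) : Prop where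
  frame : FrameGood k₀ C (1 / 10 ^ 6) (frameCoords u A)
  grad : GradGood u (u k₀) z (1 / 10 ^ 6) s A
  light : LightGood u w K (1 / 10 ^ 6) s A
  heavy : z ≠ u k₀ → HeavyGood u (u k₀) z w μ K s A
  ties : z ≠ u k₀ → ∀ i k, i ≠ k → |stepCoord (u k₀) z μ A i| ≠ |stepCoord (u k₀) z μ A k|

/-- The test vector is the restriction `t` of the error of the unthresholded step to `S ∪ supp x`;
pairing with it yields `‖t‖²`, so `‖t‖ ≤ 0.61 ‖h‖`. Thresholding then gives `2.62 · 0.61² < 0.975`.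
-/
lemma StepGood.gradient_step {s : ℕ} {μ : ℝ} {z w : EuclideanSpace ℝ (Fin n)}
    (hA : StepGood u k₀ C K μ s z w A)
    (hu : Orthonormal ℝ u) (hd : d ≤ 3) (hm : 0 < m) (hC : 1 ≤ C)
    (hx : IsSparse s (u k₀)) (hz : perp u z = 0)
    (hzx : C * ‖z - u k₀‖ ≤ 1 / 10 ^ 6) (hμ : μ ∈ Set.Ioo 0.3999 0.4001)
    {v : EuclideanSpace ℝ (Fin n)}
    (hv : IsGradientStep (toComplexRows A) (measurements (toComplexRows A) (u k₀)) s μ z v) :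
    ‖v - u k₀‖ ^ 2 ≤ 0.975 * ‖z - u k₀‖ ^ 2 := by
  classical
  obtain ⟨S, hS, htop, hw⟩ := hv
  set x := u k₀ with hxd
  set h := z - x with hh
  have hzh : z = x + h := by simp [hh]
  have hp : perp u h = 0 := by rw [hh, perp_sub, hz, hxd, perp_frame hu, sub_zero]
  set g := z - μ • gradient (loss (toComplexRows A) (measurements (toComplexRows A) x)) z with hg
  have h1 := hardThreshold_error hS htop hw hx
  set t := restrict (S ∪ supp x) (g - x) with ht
  have htc : (supp t).card ≤ 2 * s := by
    refine (Finset.card_le_card (supp_restrict_subset _ _)).trans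
      ((Finset.card_union_le _ _).trans ?_)
    have : (supp x).card ≤ s := hx
    omega
  have hn0 := norm_nonneg h
  have hh1 : ‖h‖ ≤ 1 := by nlinarith
  have hgr := hA.grad t htc
  rw [← hxd, ← hh, hzh] at hgr
  have h2 := gradient_step_inner hu hd hm hA.frame hp hh1 hzx hμ t hgr
  rw [← hxd, ← hzh] at h2
  have e : h - μ • gradient (loss (toComplexRows A) (measurements (toComplexRows A) x)) z =
      g - x := by rw [hg, hh]; abel
  rw [e, ht, inner_restrict_self, ← ht] at h2
  have h3 : ‖t‖ ≤ 0.61 * ‖h‖ := by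
    rcases (norm_nonneg t).eq_or_lt with h0 | h0
    · rw [← h0]; positivity
    · rw [sq] at h2
      exact le_of_mul_le_mul_right h2 h0
  have h4 : ‖t‖ ^ 2 ≤ (0.61 * ‖h‖) ^ 2 := by gcongr
  nlinarith [sq_nonneg ‖h‖]

/-- Where `v` vanishes its error is the entry of `x` itself, so the missed part of `x` is dominated
by the error of the gradient step. -/
lemma norm_sub_restrict_supp_le (x v : EuclideanSpace ℝ (Fin n)) :
    ‖x - restrict (supp v) x‖ ^ 2 ≤ ‖v - x‖ ^ 2 := by
  rw [norm_sq_eq_sum, norm_sq_eq_sum]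
  refine Finset.sum_le_sum fun i _ => ?_
  rw [PiLp.sub_apply, PiLp.sub_apply, restrict_apply]
  split_ifs with hi
  · rw [sub_self]; nlinarith [sq_nonneg (v i - x i)]
  · rw [mem_supp, not_not] at hi
    rw [hi]
    apply le_of_eq; ring

/-- The linear rate comes from `1.01 · 0.975` plus a negligible remainder, below `0.998²`. For the
quadratic rate, missing an index would cost the gradient step at least `|x i| ≥ ‖z - x‖`, against
its strict contraction; so nothing is missed and only the remainder survives. -/
lemma StepGood.gaussNewton_step {s : ℕ} {μ : ℝ} {z w : EuclideanSpace ℝ (Fin n)}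
    (hA : StepGood u k₀ C K μ s z w A)
    (hu : Orthonormal ℝ u) (hd : d ≤ 3) (hm : 0 < m) (hC : 1 ≤ C) (hK : 10 ^ 6 * C ≤ K)
    (hx : IsSparse s (u k₀)) (hz : perp u z = 0) (hw : perp u w = 0)
    (hzx : C * ‖z - u k₀‖ ≤ 1 / 10 ^ 6) (hwz : ‖u k₀ - w‖ ≤ ‖z - u k₀‖)
    (hμ : μ ∈ Set.Ioo 0.3999 0.4001) {v : EuclideanSpace ℝ (Fin n)}
    (hv : IsGradientStep (toComplexRows A) (measurements (toComplexRows A) (u k₀)) s μ z v)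
    (hwv : supp w ⊆ supp v) {z' : EuclideanSpace ℝ (Fin n)}
    (hz' : IsGaussNewtonStep (toComplexRows A) (measurements (toComplexRows A) (u k₀)) (supp v)
      w z') :
    ‖z' - u k₀‖ ≤ 0.998 * ‖z - u k₀‖ ∧
      ((∀ i, u k₀ i ≠ 0 → ‖z - u k₀‖ ≤ |u k₀ i|) →
        ‖z' - u k₀‖ ≤ 2 * C * ‖z - u k₀‖ ^ 2) := by
  have hvx := hA.gradient_step hu hd hm hC hx hz hzx hμ hv
  have hy := norm_sub_restrict_supp_le (u k₀) v
  have hScard : (supp v).card ≤ s := by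
    obtain ⟨S, hS, -, hSv⟩ := hv
    rw [← hS]
    refine Finset.card_le_card fun i hi => ?_
    by_contra h0
    rw [mem_supp, hSv, if_neg h0] at hi
    exact hi rfl
  have hheavy : ∑ j, (1 - lightInd K (frameCoords u A) j) *
      quad A j w (u k₀ - restrict (supp v) (u k₀)) ^ 2 ≤
      1 / 10 ^ 4 * m * ‖u k₀ - restrict (supp v) (u k₀)‖ ^ 2 := by
    -- For `z = x` the gradient step has no error, hence no part of `x` is missed; the conditions on
    -- heavy rows and ties are not available here and are not needed.
    by_cases h0 : z = u k₀
    · rw [h0, sub_self, norm_zero] at hvx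
      have h1 : ‖u k₀ - restrict (supp v) (u k₀)‖ ^ 2 = 0 :=
        le_antisymm (by linarith) (sq_nonneg _)
      have h2 : u k₀ - restrict (supp v) (u k₀) = 0 := by simpa using h1
      rw [h2]
      simp [quad, rdot_zero]
    · have h1 := hA.heavy h0
      have h2 : supp v = topSet s (stepCoord (u k₀) z μ A) := by
        have hco : (z - μ • gradient (loss (toComplexRows A)
            (measurements (toComplexRows A) (u k₀))) z).ofLp = stepCoord (u k₀) z μ A :=
          funext fun i => gradient_step_apply _ _ _ _ i
        rw [← hco]
        refine supp_eq_topSet hv ?_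
        rw [hco]
        exact hA.ties h0
      rw [h2]
      exact h1
  have hn0 := norm_nonneg (z - u k₀)
  have hCe : C * ‖u k₀ - w‖ ≤ 1 / 10 ^ 6 :=
    (mul_le_mul_of_nonneg_left hwz (by linarith)).trans hzx
  have key := gaussNewton_error hu hd hm hC hK hA.frame hw hCe hA.light hScard hx hwv hheavy hz'
  have he4 : ‖u k₀ - w‖ ^ 4 ≤ ‖z - u k₀‖ ^ 4 := by gcongr
  have hsmall : C * ‖z - u k₀‖ ^ 2 ≤ 1 / 10 ^ 6 := by nlinarith
  constructor
  · apply le_of_sq_le_sq _ (by positivity)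
    have : 2 * C * ‖u k₀ - w‖ ^ 4 ≤ 2 / 10 ^ 6 * ‖z - u k₀‖ ^ 2 := by
      calc 2 * C * ‖u k₀ - w‖ ^ 4 ≤ 2 * C * ‖z - u k₀‖ ^ 4 := by gcongr
        _ = 2 * (C * ‖z - u k₀‖ ^ 2) * ‖z - u k₀‖ ^ 2 := by ring
        _ ≤ 2 * (1 / 10 ^ 6) * ‖z - u k₀‖ ^ 2 := by gcongr
        _ = _ := by ring
    nlinarith [sq_nonneg ‖z - u k₀‖]
  · intro hmin
    have hsub : restrict (supp v) (u k₀) = u k₀ := by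
      ext i
      rw [restrict_apply]
      split_ifs with hi
      · rfl
      · by_contra h0
        have h1 := hmin i (Ne.symm h0)
        rw [mem_supp, not_not] at hi
        have h2 : (u k₀ i) ^ 2 ≤ ‖v - u k₀‖ ^ 2 := by
          have h3 : (v i - u k₀ i) ^ 2 ≤ ∑ l, (v - u k₀) l ^ 2 :=
            Finset.single_le_sum (f := fun l => (v - u k₀) l ^ 2) (fun l _ => sq_nonneg _)
              (Finset.mem_univ i)
          rw [← norm_sq_eq_sum, hi] at h3
          linarith
        have h4 : ‖z - u k₀‖ ^ 2 ≤ u k₀ i ^ 2 := by rw [← sq_abs (u k₀ i)]; gcongr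
        have h5 : u k₀ i ^ 2 ≤ 0 := by nlinarith
        exact h0 (pow_eq_zero_iff two_ne_zero |>.1 (le_antisymm h5 (sq_nonneg _))).symm
    rw [hsub, sub_self, norm_zero] at key
    apply le_of_sq_le_sq _ (by positivity)
    have : 2 * C * ‖u k₀ - w‖ ^ 4 ≤ 2 * C * ‖z - u k₀‖ ^ 4 := by gcongr
    have h4 : 0 ≤ ‖z - u k₀‖ ^ 4 := by positivity
    have h5 : 2 * C * ‖z - u k₀‖ ^ 4 ≤ 4 * C ^ 2 * ‖z - u k₀‖ ^ 4 := by
      gcongr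
      · norm_num
      · nlinarith
    calc _ ≤ 2 * C * ‖u k₀ - w‖ ^ 4 := by simpa using key
      _ ≤ 4 * C ^ 2 * ‖z - u k₀‖ ^ 4 := this.trans h5
      _ = _ := by ring

end deterministic

end GraHTP

/-! ### Probability of a good event and the passage to general data. -/

namespace GraHTP

section tail
variable {n m d : ℕ} {u : Fin d → EuclideanSpace ℝ (Fin n)} {k₀ : Fin d} {C K : ℝ}

lemma measurePreserving_frameCoords (hu : Orthonormal ℝ u) :
    MeasurePreserving (fun A : (Fin m × Fin 2) × Fin n → ℝ => frameCoords u A)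
      (gv ((Fin m × Fin 2) × Fin n)) (gv ((Fin m × Fin 2) × Fin d)) := by
  convert measurePreserving_of_rows
    (fun (p : (Fin m × Fin 2) × Fin d) (a : (Fin m × Fin 2) × Fin n) =>
      if p.1 = a.1 then u p.2 a.2 else 0) ?_ using 1
  · ext A ⟨r, k⟩
    rw [Fintype.sum_prod_type, Finset.sum_comm]
    simp [frameCoords, rdot, mul_comm]
  · rintro ⟨r, k⟩ ⟨r', k'⟩
    have h := orthonormal_iff_ite.1 hu k k'
    rw [inner_eq_sum] at h
    rw [Fintype.sum_prod_type, Finset.sum_comm]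
    simp only [ite_mul, zero_mul, Finset.sum_ite_eq, Finset.mem_univ, if_true, Prod.mk.injEq]
    by_cases hr : r = r'
    · subst hr
      simpa using h
    · simp [Ne.symm hr, hr]

/-- Union bound. The frame failure `c / m` is paid twice, once for itself and once inside the
conditioning for the heavy rows; ties have probability zero because `z` is close to the unit vector
`x`, hence differs from `0` and `-x`. -/
lemma stepGood_tail (hu : Orthonormal ℝ u) (hd : d ≤ 3) {s : ℕ} (hs : 0 < s)
    (hsn : 2 * s ≤ n) (hC : 1 ≤ C) (hm : 0 < m)
    (hms : 10 ^ 30 * C ^ 2 * s * Real.log ((n : ℝ) / s) ≤ m) {z w : EuclideanSpace ℝ (Fin n)}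
    (hx : IsSparse s (u k₀)) (hz : perp u z = 0) (hzx : C * ‖z - u k₀‖ ≤ 1 / 10 ^ 6)
    (hw : perp u w = 0) (hwx : ‖u k₀ - w‖ ≤ 1) {μ : ℝ} (hμ : μ ≠ 0) {c : ℝ} (hc : 0 ≤ c)
    (hF : gv ((Fin m × Fin 2) × Fin d) {X | ¬ FrameGood k₀ C (1 / 10 ^ 6) X} ≤
      ENNReal.ofReal (c / m)) :
    gv ((Fin m × Fin 2) × Fin n) {A | ¬ StepGood u k₀ C (10 ^ 6 * C) μ s z w A} ≤
      ENNReal.ofReal ((2 * c + 10 ^ 29 * C ^ 2) / m) := by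
  have hm' : (0 : ℝ) < m := by exact_mod_cast hm
  have hC0 : 0 < C := by linarith
  have hCC : C ≤ C ^ 2 := by nlinarith
  have hn0 := norm_nonneg (z - u k₀)
  have hzx1 : ‖z - u k₀‖ ≤ 1 := by nlinarith
  have hxn := hu.1 k₀
  have hw2 : ‖w‖ ≤ 2 := by
    have h1 : ‖w‖ ≤ ‖u k₀‖ + ‖u k₀ - w‖ := by
      have := norm_sub_le (u k₀) (u k₀ - w)
      rwa [sub_sub_cancel] at this
    linarith
  have hΛ : 0 ≤ (s : ℝ) * Real.log ((n : ℝ) / s) := by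
    have := log_ratio_ge hs hsn
    positivity
  have hcond : ∀ a : ℝ, a ≤ 10 ^ 30 * C ^ 2 → a * s * Real.log ((n : ℝ) / s) ≤ m := by
    intro a ha
    rw [mul_assoc] at hms ⊢
    exact (mul_le_mul_of_nonneg_right ha hΛ).trans hms
  set E := (Fin m × Fin 2) × Fin n → ℝ
  set F₁ : Set E := {A | ¬ FrameGood k₀ C (1 / 10 ^ 6) (frameCoords u A)}
  set F₂ : Set E := {A | FrameGood k₀ C (1 / 10 ^ 6) (frameCoords u A) ∧
    ¬ GradGood u (u k₀) z (1 / 10 ^ 6) s A}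
  set F₃ : Set E := {A | FrameGood k₀ C (1 / 10 ^ 6) (frameCoords u A) ∧
    ¬ LightGood u w (10 ^ 6 * C) (1 / 10 ^ 6) s A}
  set F₄ : Set E := {A | z ≠ u k₀ ∧ ¬ HeavyGood u (u k₀) z w μ (10 ^ 6 * C) s A}
  set F₅ : Set E := {A | z ≠ u k₀ ∧
    ¬ ∀ i k, i ≠ k → |stepCoord (u k₀) z μ A i| ≠ |stepCoord (u k₀) z μ A k|}
  have hsub : {A : E | ¬ StepGood u k₀ C (10 ^ 6 * C) μ s z w A} ⊆
      F₁ ∪ (F₂ ∪ (F₃ ∪ (F₄ ∪ F₅))) := by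
    intro A hA
    by_contra hcon
    simp only [Set.mem_union, not_or, F₁, F₂, F₃, F₄, F₅, Set.mem_ofPred_eq, not_and,
      not_not] at hcon
    obtain ⟨h1, h2, h3, h4, h5⟩ := hcon
    exact hA ⟨h1, h2 h1, h3 h1, h4, h5⟩
  have p1 : gv _ F₁ ≤ ENNReal.ofReal (c / m) := by
    have hmp := measurePreserving_frameCoords (m := m) hu
    rw [← hmp.map_eq] at hF
    exact (Measure.le_map_apply hmp.measurable.aemeasurable _).trans hF
  have p2 : gv _ F₂ ≤ ENNReal.ofReal (14400 * C / (1 / 10 ^ 6) ^ 2 / m) :=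
    gradGood_tail hu hd hs hsn (by norm_num) hC0 hm (hcond _ (by norm_num; nlinarith)) hz hzx1
  have p3 : gv _ F₃ ≤ ENNReal.ofReal ((19200 * C / (1 / 10 ^ 6) ^ 2 +
      32768 * (10 ^ 6 * C) ^ 2 / (1 / 10 ^ 6) ^ 2) / m) :=
    lightGood_tail hu hd hs hsn (by norm_num) hC0 (by positivity) (by norm_num; nlinarith) hm
      (hcond _ (by norm_num; nlinarith)) (hcond _ (by norm_num; nlinarith)) hw hw2
  have p4 : gv _ F₄ ≤ ENNReal.ofReal (c / m) + ENNReal.ofReal (2 * 10 ^ 13 * C ^ 2 / m) := by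
    by_cases h0 : z = u k₀
    · simp [F₄, h0]
    · refine le_trans (measure_mono fun A hA => hA.2) ((heavyGood_tail hu hd hs hsn hC le_rfl hm
        (hcond _ (by nlinarith)) hx hz hzx h0 hw hw2 μ).trans (by gcongr))
  have p5 : gv _ F₅ = 0 := by
    by_cases h0 : z = u k₀
    · simp [F₅, h0]
    · refine measure_mono_null (fun A hA => hA.2) (gv_ties_eq_zero hm hμ ?_ (sub_ne_zero.2 h0) ?_)
      · rintro rfl
        rw [zero_sub, norm_neg, hxn] at hzx
        linarith
      · intro h1
        have h2 : z - u k₀ = (-2 : ℝ) • u k₀ := by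
          rw [eq_neg_of_add_eq_zero_left h1, neg_smul, two_smul]; abel
        rw [h2, norm_smul, hxn] at hzx
        norm_num at hzx
        linarith
  refine (measure_mono hsub).trans ((measure_union_le _ _).trans ((add_le_add p1
    ((measure_union_le _ _).trans (add_le_add p2 ((measure_union_le _ _).trans (add_le_add p3
      ((measure_union_le _ _).trans (add_le_add p4 p5.le))))))).trans ?_))
  rw [add_zero, ← ENNReal.ofReal_add (by positivity) (by positivity),
    ← ENNReal.ofReal_add (by positivity) (by positivity),
    ← ENNReal.ofReal_add (by positivity) (by positivity),
    ← ENNReal.ofReal_add (by positivity) (by positivity)]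
  apply ENNReal.ofReal_le_ofReal
  simp only [← add_div]
  refine div_le_div_of_nonneg_right ?_ hm'.le
  norm_num
  nlinarith

/-- One iteration at normalized data makes progress. -/
def Progress (x z w : EuclideanSpace ℝ (Fin n)) (s : ℕ) (μ C : ℝ)
    (A : (Fin m × Fin 2) × Fin n → ℝ) : Prop :=
  ∀ v, IsGradientStep (toComplexRows A) (measurements (toComplexRows A) x) s μ z v →
    ‖v - x‖ ≤ 0.99 * ‖z - x‖ ∧ (‖x - w‖ ≤ ‖z - x‖ → supp w ⊆ supp v → ∀ z',
      IsGaussNewtonStep (toComplexRows A) (measurements (toComplexRows A) x) (supp v) w z' →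
      ‖z' - x‖ ≤ 0.998 * ‖z - x‖ ∧
        ((∀ i, x i ≠ 0 → ‖z - x‖ ≤ |x i|) → ‖z' - x‖ ≤ 2 * C * ‖z - x‖ ^ 2))

/-- The good event must be chosen before it is known whether `w` is close to `x`. If it is not, the
Gauss–Newton claim is vacuous, and `x` takes the place of `w` so that the conditions still make
sense. -/
lemma StepGood.progress {s : ℕ} {μ : ℝ} {z w : EuclideanSpace ℝ (Fin n)}
    {A : (Fin m × Fin 2) × Fin n → ℝ}
    (hA : StepGood u k₀ C (10 ^ 6 * C) μ s z (if ‖u k₀ - w‖ ≤ ‖z - u k₀‖ then w else u k₀) A)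
    (hu : Orthonormal ℝ u) (hd : d ≤ 3) (hm : 0 < m) (hC : 1 ≤ C)
    (hx : IsSparse s (u k₀)) (hz : perp u z = 0) (hw : perp u w = 0)
    (hzx : C * ‖z - u k₀‖ ≤ 1 / 10 ^ 6) (hμ : μ ∈ Set.Ioo 0.3999 0.4001) :
    Progress (u k₀) z w s μ C A := by
  intro v hv
  refine ⟨?_, fun hwz hwv z' hz' => ?_⟩
  · have := hA.gradient_step hu hd hm hC hx hz hzx hμ hv
    apply le_of_sq_le_sq _ (by positivity)
    nlinarith [sq_nonneg ‖z - u k₀‖]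
  · rw [if_pos hwz] at hA
    exact hA.gaussNewton_step hu hd hm hC le_rfl hx hz hw hzx hwz hμ hv hwv hz'

end tail

lemma FrameGood.mono {m d : ℕ} {k₀ : Fin d} {C C' ε : ℝ} {X : (Fin m × Fin 2) × Fin d → ℝ}
    (h : FrameGood k₀ C ε X) (hC : C ≤ C') : FrameGood k₀ C' ε X :=
  ⟨h.moment.trans (by gcongr), h.cov, h.energy⟩

lemma IsSparse.pos {n s : ℕ} {x : EuclideanSpace ℝ (Fin n)} (hx : IsSparse s x) (h0 : x ≠ 0) :
    0 < s := by
  refine lt_of_lt_of_le (Finset.card_pos.2 ?_) hx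
  by_contra h
  rw [Finset.not_nonempty_iff_eq_empty] at h
  refine h0 (PiLp.ext fun i => ?_)
  by_contra hi
  have : i ∈ supp x := mem_supp.2 hi
  rw [h] at this
  simp at this

/-- The dimension of the frame depends on the data but is at most three; summing the constants over
`d < 4` makes them absolute. -/
lemma exists_progress_const : ∃ C C₁ : ℝ, 1 ≤ C ∧ 0 < C₁ ∧
    ∀ (n s m : ℕ) (x z w : EuclideanSpace ℝ (Fin n)) (μ : ℝ), 0 < m → 2 * s ≤ n → ‖x‖ = 1 →
      IsSparse s x → C * ‖z - x‖ ≤ 1 / 10 ^ 6 → μ ∈ Set.Ioo (0.3999 : ℝ) 0.4001 →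
      10 ^ 30 * C ^ 2 * s * Real.log ((n : ℝ) / s) ≤ m →
      gv ((Fin m × Fin 2) × Fin n) {A | ¬ Progress x z w s μ C A} ≤ ENNReal.ofReal (C₁ / m) := by
  choose c hc0 hc using fun d => exists_frameGood_const d (ε := 1 / 10 ^ 6) (by norm_num)
  set I : ℕ → ℝ := fun d => ∫ y, blockMoment y ∂(gv (Fin 2 × Fin d)) + 1 with hI
  have hI1 : ∀ d, 1 ≤ I d := fun d => by
    have : 0 ≤ ∫ y, blockMoment y ∂(gv (Fin 2 × Fin d)) := integral_nonneg fun y => by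
      have : 0 ≤ ∑ p, y p ^ 2 := Finset.sum_nonneg fun _ _ => sq_nonneg _
      unfold blockMoment
      positivity
    simp only [hI]
    linarith
  set C := ∑ d ∈ Finset.range 4, I d with hC
  set c' := ∑ d ∈ Finset.range 4, c d with hc'
  have hIC : ∀ d ≤ 3, I d ≤ C := fun d hd => Finset.single_le_sum (f := I)
    (fun d _ => by linarith [hI1 d]) (Finset.mem_range.2 (by omega))
  have hcc : ∀ d ≤ 3, c d ≤ c' := fun d hd => Finset.single_le_sum (f := c)
    (fun d _ => (hc0 d).le) (Finset.mem_range.2 (by omega))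
  have hC1 : 1 ≤ C := (hI1 0).trans (hIC 0 (by norm_num))
  have hc'0 : 0 < c' := (hc0 0).trans_le (hcc 0 (by norm_num))
  refine ⟨C, 2 * c' + 10 ^ 29 * C ^ 2, hC1, by positivity, ?_⟩
  intro n s m x z w μ hm hsn hx1 hxs hzx hμ hms
  have hs : 0 < s := hxs.pos fun h => by simp [h] at hx1
  obtain ⟨d, u, k₀, hd, hu, rfl, hz, hw⟩ := exists_frame hx1 z w
  set w' := if ‖u k₀ - w‖ ≤ ‖z - u k₀‖ then w else u k₀ with hw'
  have hzx1 : ‖z - u k₀‖ ≤ 1 := by nlinarith [norm_nonneg (z - u k₀)]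
  have hw'p : perp u w' = 0 := by
    rw [hw']; split_ifs
    · exact hw
    · exact perp_frame hu k₀
  have hw'n : ‖u k₀ - w'‖ ≤ 1 := by
    rw [hw']; split_ifs with h
    · exact h.trans hzx1
    · simp
  have hF : gv ((Fin m × Fin 2) × Fin d) {X | ¬ FrameGood k₀ C (1 / 10 ^ 6) X} ≤
      ENNReal.ofReal (c' / m) := by
    refine (measure_mono fun X hX => ?_).trans ((hc d m k₀ hm).trans
      (ENNReal.ofReal_le_ofReal (by have := hcc d hd; gcongr)))
    exact fun h => hX (h.mono (hIC d hd))
  refine (measure_mono fun A hA => ?_).trans (stepGood_tail hu hd hs hsn hC1 hm hms hxs hz hzx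
    hw'p hw'n (by have := hμ.1; norm_num at this ⊢; linarith) hc'0.le hF)
  exact fun h => hA (h.progress hu hd hm hC1 hxs hz hw hzx hμ)

section reduction
variable {n m : ℕ}

/-- The sign attaining the minimum in `sdist` is put into the scaling factor, so that the normalised
vectors are compared in the ordinary norm. It is chosen separately for `z` and for `w`. -/
lemma exists_sign {c : ℝ} (hc : 0 < c) (x z : EuclideanSpace ℝ (Fin n)) :
    ∃ b, (b = c ∨ b = -c) ∧ c * ‖b⁻¹ • z - c⁻¹ • x‖ = sdist z x := by
  have h1 : c * ‖c⁻¹ • z - c⁻¹ • x‖ = ‖x - z‖ := by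
    rw [← smul_sub, norm_smul, Real.norm_eq_abs, abs_inv, abs_of_pos hc,
      mul_inv_cancel_left₀ hc.ne', norm_sub_rev]
  have h2 : c * ‖(-c)⁻¹ • z - c⁻¹ • x‖ = ‖x + z‖ := by
    have : (-c)⁻¹ • z - c⁻¹ • x = -(c⁻¹ • (x + z)) := by
      rw [inv_neg, neg_smul, smul_add]; abel
    rw [this, norm_neg, norm_smul, Real.norm_eq_abs, abs_inv, abs_of_pos hc,
      mul_inv_cancel_left₀ hc.ne']
  rcases min_choice ‖x - z‖ ‖x + z‖ with h | h
  · exact ⟨c, Or.inl rfl, h1.trans h.symm⟩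
  · exact ⟨-c, Or.inr rfl, h2.trans h.symm⟩

lemma sdist_le_mul {b c : ℝ} (hc : 0 < c) (hb : b = c ∨ b = -c) (v x : EuclideanSpace ℝ (Fin n)) :
    sdist v x ≤ c * ‖b⁻¹ • v - c⁻¹ • x‖ := by
  have hb0 : b ≠ 0 := by rcases hb with rfl | rfl <;> simp [hc.ne']
  have h := sdist_smul hb (b⁻¹ • v) (c⁻¹ • x)
  rw [smul_inv_smul₀ hb0, smul_inv_smul₀ hc.ne', abs_of_pos hc] at h
  rw [h, norm_sub_rev]
  exact mul_le_mul_of_nonneg_left (min_le_left _ _) hc.le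

lemma xmin_le {x : EuclideanSpace ℝ (Fin n)} {i : Fin n} (hi : x i ≠ 0) : xmin x ≤ |x i| :=
  csInf_le ⟨0, by rintro _ ⟨j, -, rfl⟩; exact abs_nonneg _⟩ ⟨i, hi, rfl⟩

/-- Progress for general data from progress for normalized data. -/
lemma Progress.denormalize (hm : 0 < m) {A : (Fin m × Fin 2) × Fin n → ℝ}
    {x z w v : EuclideanSpace ℝ (Fin n)} {s : ℕ} {μ C b c e : ℝ} (hc : 0 < c) (hcx : ‖x‖ = c)
    (hb : b = c ∨ b = -c) (hbz : c * ‖b⁻¹ • z - c⁻¹ • x‖ = sdist z x)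
    (he : e = c ∨ e = -c) (hew : c * ‖e⁻¹ • w - c⁻¹ • x‖ = sdist w x)
    (hA : Progress (c⁻¹ • x) (b⁻¹ • z) (e⁻¹ • w) s (μ * c ^ 2) C A)
    (hv : IsGradientStep (toComplexRows A) (measurements (toComplexRows A) x) s μ z v) :
    sdist v x ≤ 0.99 * sdist z x ∧ (supp w ⊆ supp v → sdist w x ≤ sdist v x → ∀ z',
      IsGaussNewtonStep (toComplexRows A) (measurements (toComplexRows A) x) (supp v) w z' →
      sdist z' x ≤ 0.998 * sdist z x ∧ (z ∈ basin s x (xmin x / ‖x‖) →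
        sdist z' x ≤ 2 * C / ‖x‖ * sdist z x ^ 2)) := by
  have hb0 : b ≠ 0 := by rcases hb with rfl | rfl <;> simp [hc.ne']
  have he0 : e ≠ 0 := by rcases he with rfl | rfl <;> simp [hc.ne']
  have hb2 : b ^ 2 = c ^ 2 := by rcases hb with rfl | rfl <;> ring
  have he2 : e ^ 2 = c ^ 2 := by rcases he with rfl | rfl <;> ring
  have hxx : c • c⁻¹ • x = x := smul_inv_smul₀ hc.ne' x
  have hv' := IsGradientStep.of_smul (A := A) (s := s) (μ := μ) hb0 hb2 (x := c⁻¹ • x)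
    (z := b⁻¹ • z) (v := v) (by rw [hxx, smul_inv_smul₀ hb0]; exact hv)
  obtain ⟨h1, h2⟩ := hA _ hv'
  have hvd : sdist v x ≤ 0.99 * sdist z x := by
    refine (sdist_le_mul hc hb v x).trans ?_
    rw [← hbz]
    calc _ ≤ c * (0.99 * ‖b⁻¹ • z - c⁻¹ • x‖) := mul_le_mul_of_nonneg_left h1 hc.le
      _ = _ := by ring
  refine ⟨hvd, fun hwv hwd z' hz' => ?_⟩
  have hz0 : 0 ≤ sdist z x := le_min (norm_nonneg _) (norm_nonneg _)
  have hwz : ‖c⁻¹ • x - e⁻¹ • w‖ ≤ ‖b⁻¹ • z - c⁻¹ • x‖ := by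
    rw [norm_sub_rev]
    refine le_of_mul_le_mul_left ?_ hc
    rw [hew, hbz]
    linarith
  -- The least-squares problem is rescaled with the sign of `w`, the gradient step with that of `z`.
  -- The signs need not agree: the measurements, the supports and `sdist` ignore them.
  have hz'' := IsGaussNewtonStep.of_smul (A := A) hm he0 he2 (x := c⁻¹ • x)
    (w := e⁻¹ • w) (v := z') (S := supp v) (by rw [hxx, smul_inv_smul₀ he0]; exact hz')
  obtain ⟨h3, h4⟩ := h2 hwz (by
    rw [supp_smul (inv_ne_zero he0), supp_smul (inv_ne_zero hb0)]; exact hwv) _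
      (by rw [supp_smul (inv_ne_zero hb0)]; exact hz'')
  refine ⟨?_, fun hbas => ?_⟩
  · refine (sdist_le_mul hc he z' x).trans ?_
    rw [← hbz]
    calc _ ≤ c * (0.998 * ‖b⁻¹ • z - c⁻¹ • x‖) := mul_le_mul_of_nonneg_left h3 hc.le
      _ = _ := by ring
  · have h5 : sdist z x ≤ xmin x := by
      have := hbas.1
      rwa [hcx, div_mul_cancel₀ _ hc.ne'] at this
    have h6 := h4 fun i hi => by
      have hi' : x i ≠ 0 := fun h => hi (by simp [h])
      have h7 := h5.trans (xmin_le hi')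
      rw [← hbz] at h7
      rw [PiLp.smul_apply, smul_eq_mul, abs_mul, abs_inv, abs_of_pos hc]
      rw [inv_mul_eq_div, le_div_iff₀ hc]
      linarith
    refine (sdist_le_mul hc he z' x).trans ?_
    rw [← hbz, hcx]
    calc _ ≤ c * (2 * C * ‖b⁻¹ • z - c⁻¹ • x‖ ^ 2) := mul_le_mul_of_nonneg_left h6 hc.le
      _ = _ := by field_simp

/-- The real array of the real and imaginary parts of complex vectors. -/
def ofComplexRows (a : Fin m → Fin n → ℂ) : (Fin m × Fin 2) × Fin n → ℝ :=
  fun p => if p.1.2 = 0 then (a p.1.1 p.2).re else (a p.1.1 p.2).im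

lemma toComplexRows_ofComplexRows (a : Fin m → Fin n → ℂ) :
    toComplexRows (ofComplexRows a) = a := by
  ext j i
  simp [toComplexRows, ofComplexRows]

lemma ofComplexRows_toComplexRows (A : (Fin m × Fin 2) × Fin n → ℝ) :
    ofComplexRows (toComplexRows A) = A := by
  ext ⟨⟨j, σ⟩, i⟩
  fin_cases σ <;> simp [toComplexRows, ofComplexRows]

lemma measurePreserving_ofComplexRows :
    MeasurePreserving (ofComplexRows (n := n) (m := m))
      (Measure.pi fun _ : Fin m => complexGaussianVector n) (gv ((Fin m × Fin 2) × Fin n)) := by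
  have hmeas : Measurable (ofComplexRows (n := n) (m := m)) := by
    refine measurable_pi_lambda _ fun p => ?_
    unfold ofComplexRows
    split_ifs
    · exact Complex.measurable_re.comp ((measurable_pi_apply _).comp (measurable_pi_apply _))
    · exact Complex.measurable_im.comp ((measurable_pi_apply _).comp (measurable_pi_apply _))
  refine ⟨hmeas, ?_⟩
  rw [← measurePreserving_toComplexRows.map_eq, Measure.map_map hmeas
    measurePreserving_toComplexRows.measurable]
  have : ofComplexRows ∘ toComplexRows (n := n) (m := m) = id :=
    funext ofComplexRows_toComplexRows
  rw [this, Measure.map_id]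

end reduction

end GraHTP

/-! ### The theorem. -/

theorem theorem2p1 :
    ∃ μ₁ μ₂ δ C₁ C₂ C₃ C₄ ρ α β : ℝ,
      0 < μ₁ ∧ μ₁ < μ₂ ∧ 0 < δ ∧ 0 < C₁ ∧ 0 < C₂ ∧ 0 < C₃ ∧ 0 < C₄ ∧
      0 < ρ ∧ ρ < 1 ∧ 0 < α ∧ α < 1 ∧ 0 < β ∧
      ∀ (n s m : ℕ) (x z w : EuclideanSpace ℝ (Fin n)) (μ : ℝ),
        2 * s ≤ n → x ≠ 0 → GraHTP.IsSparse s x →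
        z ∈ GraHTP.basin s x δ →
        μ ∈ Set.Ioo (μ₁ / ‖x‖ ^ 2) (μ₂ / ‖x‖ ^ 2) →
        C₄ * (s : ℝ) * Real.log ((n : ℝ) / (s : ℝ)) ≤ (m : ℝ) →
        ∀ (Ω : Type*) [MeasurableSpace Ω] (P : Measure Ω) [IsProbabilityMeasure P]
          (a : Fin m → Ω → Fin n → ℂ),
          (∀ j, HasLaw (a j) (GraHTP.complexGaussianVector n) P) →
          iIndepFun a P →
          1 - C₁ / (m : ℝ) - C₂ * Real.exp (-(C₃ * (m : ℝ) / Real.log (m : ℝ))) ≤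
            P.real {ω | ∀ u : EuclideanSpace ℝ (Fin n),
              GraHTP.IsGradientStep (fun j => a j ω)
                (GraHTP.measurements (fun j => a j ω) x) s μ z u →
              GraHTP.sdist u x ≤ ρ * GraHTP.sdist z x ∧
              (GraHTP.supp w ⊆ GraHTP.supp u → GraHTP.sdist w x ≤ GraHTP.sdist u x →
                ∀ z' : EuclideanSpace ℝ (Fin n),
                  GraHTP.IsGaussNewtonStep (fun j => a j ω)
                    (GraHTP.measurements (fun j => a j ω) x) (GraHTP.supp u) w z' →
                  GraHTP.sdist z' x ≤ α * GraHTP.sdist z x ∧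
                  (z ∈ GraHTP.basin s x (GraHTP.xmin x / ‖x‖) →
                    GraHTP.sdist z' x ≤ β / ‖x‖ * GraHTP.sdist z x ^ 2))} := by
  obtain ⟨C, C₁, hC, hC₁, key⟩ := GraHTP.exists_progress_const
  refine ⟨0.3999, 0.4001, 1 / (10 ^ 6 * C), C₁, 1, 1, 10 ^ 30 * C ^ 2, 0.99, 0.998, 2 * C,
    by norm_num, by norm_num, by positivity, hC₁, one_pos, one_pos, by positivity, by norm_num,
    by norm_num, by norm_num, by norm_num, by positivity, ?_⟩
  intro n s m x z w μ hsn hx hxs hz hμ hms Ω _ P _ a ha hind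
  rcases Nat.eq_zero_or_pos m with rfl | hm
  -- For `m = 0` the conventions for division by zero give `1 - 0 - 1 * exp 0 = 0` on the left.
  · simp
  have hm' : (0 : ℝ) < m := by exact_mod_cast hm
  obtain ⟨c, hcx⟩ : ∃ c, ‖x‖ = c := ⟨_, rfl⟩
  have hc : 0 < c := hcx ▸ norm_pos_iff.2 hx
  obtain ⟨b, hb, hbz⟩ := GraHTP.exists_sign hc x z
  obtain ⟨e, he, hew⟩ := GraHTP.exists_sign hc x w
  have hprob := key n s m (c⁻¹ • x) (b⁻¹ • z) (e⁻¹ • w) (μ * c ^ 2) hm hsn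
    (by rw [norm_smul, hcx, Real.norm_eq_abs, abs_inv, abs_of_pos hc, inv_mul_cancel₀ hc.ne'])
    (by rw [GraHTP.IsSparse, GraHTP.supp_smul (inv_ne_zero hc.ne')]; exact hxs)
    (by
      have h1 := hz.1
      rw [← hbz, hcx, mul_comm c] at h1
      have h2 := le_of_mul_le_mul_right h1 hc
      calc _ ≤ C * (1 / (10 ^ 6 * C)) := by gcongr
        _ = _ := by field_simp)
    (by
      rw [hcx] at hμ
      exact ⟨(div_lt_iff₀ (by positivity)).1 hμ.1, (lt_div_iff₀ (by positivity)).1 hμ.2⟩) hms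
  have hlaw := hind.hasLaw_pi ha
  have hmp := GraHTP.measurePreserving_ofComplexRows (n := n) (m := m)
  have hcomp : AEMeasurable (fun ω => GraHTP.ofComplexRows fun j => a j ω) P :=
    hmp.measurable.comp_aemeasurable hlaw.aemeasurable
  have hmap : P.map (fun ω => GraHTP.ofComplexRows fun j => a j ω) =
      GraHTP.gv ((Fin m × Fin 2) × Fin n) := by
    rw [← hmp.map_eq, ← hlaw.map_eq,
      AEMeasurable.map_map_of_aemeasurable hmp.measurable.aemeasurable hlaw.aemeasurable]
    rfl
  set G : Set Ω := {ω | ∀ u : EuclideanSpace ℝ (Fin n), _} with hG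
  have hbad : P Gᶜ ≤ ENNReal.ofReal (C₁ / m) := by
    rw [← hmap] at hprob
    -- The event quantifies over uncountably many vectors and is not shown to be measurable; the
    -- inequality for the image measure holds for arbitrary sets, and subadditivity replaces the
    -- complement rule below.
    refine (measure_mono fun ω hω => ?_).trans ((Measure.le_map_apply hcomp _).trans hprob)
    intro hprog
    refine hω fun v hv => ?_
    have := hprog.denormalize (z := z) (w := w) (v := v) hm hc hcx hb hbz he hew
    rw [GraHTP.toComplexRows_ofComplexRows] at this
    exact this hv
  have h1 : (1 : ℝ) ≤ P.real G + C₁ / m := by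
    have h2 : P Set.univ ≤ P G + P Gᶜ := by
      rw [← Set.union_compl_self G]
      exact measure_union_le _ _
    have h3 := h2.trans (add_le_add_right hbad _)
    rw [measure_univ] at h3
    have h4 := ENNReal.toReal_mono (by finiteness) h3
    rw [ENNReal.toReal_add (by finiteness) (by finiteness),
      ENNReal.toReal_ofReal (by positivity)] at h4
    simpa [Measure.real] using h4
  -- The bound `1 - C₁ / m` is already enough; the exponential term only has to be nonnegative.
  have h2 := Real.exp_pos (-(1 * (m : ℝ) / Real.log m))
  linarith
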